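/- Let $\mathbf{k}$ be a field. A mixed-braided vector space $(V,W,\tau)$ consists of finite-dimensional $\mathbf{k}$-vector spaces $V,W$ with invertible braidings $\sigma_V$ of $V\otimes V$ and $\sigma_W$ of $W\otimes W$ satisfying the braid equation, and an automorphism $\tau$ of $V\otimes W$ such that $(\sigma_V\otimes 1)(1\otimes\tau)(\sigma_V\otimes 1)(1\otimes\tau)=(1\otimes\tau)(\sigma_V\otimes 1)(1\otimes\tau)(\sigma_V\otimes 1)$ on $V^{\otimes 2}\otimes W$, $(\tau\otimes 1)(1\otimes\sigma_W)(\tau\otimes 1)(1\otimes\sigma_W)=(1\otimes\sigma_W)(\tau\otimes 1)(1\otimes\sigma_W)(\tau\otimes 1)$ on $V\otimes W^{\otimes 2}$, and such that $\sigma_1\tau_2\sigma_1^{-1}$ and $\sigma_3\tau_2\sigma_3^{-1}$ commute on $V^{\otimes 2}\otimes W^{\otimes 2}$ (with $\sigma_1=\sigma_V\otimes 1\otimes 1$, $\tau_2=1\otimes\tau\otimes 1$, $\sigma_3=1\otimes 1\otimes\sigma_W$). Then $V^{\otimes n}\otimes W^{\otimes m}$ is a representation of the mixed braid group $B_{n,m}\le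 B_{n+m}$ (the preimage of $S_n\times S_m$), in which $\sigma_i$ acts by $\sigma_V$ ($i<n$) or $\sigma_W$ ($i>n$) in the places $i,i+1$ and $\tau_n=\sigma_n^2$ acts by $\tau$ in the places $n,n+1$. Let $(V,W,\tau)$ be left-separable, with separated braiding $\varphi:V\otimes W\xrightarrow{\cong}W\otimes V$, i.e. $(1\otimes\sigma_V)(\varphi\otimes 1)(1\otimes\varphi)=(\varphi\otimes 1)(1\otimes\varphi)(\sigma_V\otimes 1)$ and $(\tau\otimes 1)(1\otimes\varphi)=(1\otimes\varphi)(\sigma_V\otimes 1)(1\otimes\tau)(\sigma_V^{-1}\otimes 1)$ on $V^{\otimes 2}\otimes W$, and suppose that $$(1\otimes\tau)(\varphi\otimes 1)=(\varphi\otimes 1)(1\otimes\sigma_W)(\tau\otimes 1)(1\otimes\sigma_W^{-1})\quad\text{on } V\otimes W^{\otimes 2}.$$ A $(p,q)$-shuffle is a permutation $\gamma$ of $p+q$ elements preserving the order on the first $p$ and on the last $q$; $\widetilde\gamma\in B_{p+q}$ denotes its positive lift, moving the right $q$ strands in front of the left $p$ strands. Let $\mathfrak A=\mathfrak A(V_\epsilon)=\bigoplus_{r\ge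 0}V^{\otimes r}$ be the quantum shuffle algebra of $(V,-\sigma_V)$, with product $x\star y=\sum_\gamma\widetilde\gamma(x\otimes y)$ over all $(p,q)$-shuffles ($p=\deg x$, $q=\deg y$), let $\mathfrak I\subset\mathfrak A$ be its augmentation ideal (elements of positive degree), and let $\mathfrak M=\bigoplus_{q\ge 1}\bigoplus_{0\le j\le q-1}V^{\otimes j}\otimes W\otimes V^{\otimes q-j-1}$ be the graded $\mathfrak A$-bimodule given by the same formula, where a crossing acts by $-\sigma_V$ on $V\otimes V$, by $-\varphi$ on $V\otimes W$ and by $-\tau\varphi^{-1}$ on $W\otimes V$. For $m\ge 1$ let $\mathcal M=(\mathfrak M,\dots,\mathfrak M)$ ($m$ copies). $F_q(\mathcal M,\mathfrak I)$ is the direct sum, over $1\le i_1<\dots<i_m\le q$, of the tensor products of $q$ factors, equal to $\mathfrak M$ in the places $i_1,\dots,i_m$ and to $\mathfrak I$ in all others; its differential is $\sum_{i=1}^{q-1}(-1)^{i-1}d_i$, where $d_i$ multiplies the $i$-th and $(i+1)$-st factors, and is $0$ if both are $\mathfrak M$. $F_{q,N}(\mathcal M,\mathfrak I)$ is its part of total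 degree $N$. For a representation $L$ of $B_{n,m}$, $D(n,m)_r\otimes L$ is the direct sum of copies of $L$ indexed by the triples $(\lambda,I,J)$, where $\lambda$ is a composition of $n+m$ of length $r-n+m$, $I=(i_1<\dots<i_m)$ consists of indices of parts of $\lambda$ and $J=(j_1,\dots,j_m)$ with $0\le j_k\le\lambda_{i_k}-1$. Let $\mathcal I=\{\iota_1,\dots,\iota_m\}$, $\iota_k=j_k+1+\sum_{i<i_k}\lambda_i$. The differential is $d=\sum_{i}(-1)^{i-1}d_i$ over $1\le i<l(\lambda)$, where $$d_i\big((\lambda,I,J)\otimes\ell\big)=\sum_{h}\sum_{\gamma}(-1)^{|\gamma|}(\rho^i,I',J')\otimes\eta_{\mathcal I}(\widetilde\gamma)(\ell).$$ Here $\rho^i$ is $\lambda$ with $\lambda_i$ and $\lambda_{i+1}$ replaced by their sum; $I'$ is $I$ with all entries greater than $i$ lowered by $1$; $\gamma$ runs over $(\lambda_i,\lambda_{i+1})$-shuffles, lifted to the $\lambda_i+\lambda_{i+1}$ strands following the first $\lambda_1+\dots+\lambda_{i-1}$; and $\eta_{\mathcal I}(a)=\widetilde{\alpha}_{a(\mathcal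 I)}^{-1}\,a\,\widetilde{\alpha}_{\mathcal I}\in B_{n,m}$, with $\alpha_{\mathcal I}$ the $(n,m)$-shuffle carrying the last $m$ elements to $\mathcal I$. If $i,i+1\notin I$, there is no sum over $h$, all shuffles occur, and $J'=J$. If $i\notin I$ and $i+1=i_k$, then $0\le h\le\lambda_i$, only the $\gamma$ with $\gamma(\lambda_i+j_k+1)=h+j_k+1$ occur, and $J'$ is $J$ with $j_k$ replaced by $j_k+h$. If $i=i_k$ and $i+1\notin I$, then $0\le h\le\lambda_{i+1}$, only the $\gamma$ with $\gamma(j_k+1)=j_k+h+1$ occur, and again $J'$ is $J$ with $j_k$ replaced by $j_k+h$. If $i,i+1\in I$, then $d_i=0$. Then, for all $n\ge 0$ and $m\ge 1$, both are chain complexes, and there is an isomorphism of chain complexes over $\mathbf{k}$ $$F_{*,n+m}(\mathcal M,\mathfrak I)\;\cong\;D(n,m)_{*+n-m}\otimes\big(V^{\otimes n}\otimes W^{\otimes m}\big).$$ -/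

import Mathlib

open scoped TensorProduct DirectSum

universe u

namespace QuantumShuffle
noncomputable section

/-- Artin's relations on the generators `σ_0, …, σ_{N-2}`. -/
def artinRelations (N : ℕ) : Set (FreeGroup (Fin (N - 1))) :=
  {r | ∃ i j : Fin (N - 1), (i : ℕ) + 1 < j ∧
      r = FreeGroup.of i * FreeGroup.of j * (FreeGroup.of j * FreeGroup.of i)⁻¹} ∪
  {r | ∃ i j : Fin (N - 1), (i : ℕ) + 1 = j ∧
      r = FreeGroup.of i * FreeGroup.of j * FreeGroup.of i *
        (FreeGroup.of j * FreeGroup.of i * FreeGroup.of j)⁻¹}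

/-- Artin's braid group on `N` strands. -/
abbrev BraidGroup (N : ℕ) : Type := PresentedGroup (artinRelations N)

/-- The generator `σ_i` (counted from `0`), crossing the strands in the places `i` and `i + 1`;
by convention `1` if there are no such places. -/
def braidGen (N i : ℕ) : BraidGroup N :=
  if h : i < N - 1 then PresentedGroup.of ⟨i, h⟩ else 1

/-- The braid spelled by a word in the generators. -/
def wordBraid (N : ℕ) (w : List ℕ) : BraidGroup N := (w.map (braidGen N)).prod

/-- To define a homomorphism out of the braid group, check Artin's relations. -/
def braidLift {N : ℕ} {G : Type*} [Group G] (f : ℕ → G)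
    (hc : ∀ i j, i + 1 < j → j + 1 < N → f i * f j = f j * f i)
    (hb : ∀ i, i + 2 < N → f i * f (i + 1) * f i = f (i + 1) * f i * f (i + 1)) :
    BraidGroup N →* G :=
  PresentedGroup.toGroup (f := fun i : Fin (N - 1) => f i) (by
    rintro r (⟨i, j, h, rfl⟩ | ⟨i, j, h, rfl⟩)
    · have := hc i j h (by have := j.2; omega)
      simp [this]
    · have := hb i (by have := j.2; omega)
      rw [h] at this
      simp [this])

theorem braidLift_gen {N : ℕ} {G : Type*} [Group G] (f : ℕ → G) (hc) (hb) {i : ℕ}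
    (h : i + 1 < N) : braidLift (N := N) f hc hb (braidGen N i) = f i := by
  have h' : i < N - 1 := by omega
  simp [braidLift, braidGen, h']

theorem braid_induction {N : ℕ} {P : BraidGroup N → Prop} (h1 : P 1)
    (hg : ∀ i, i + 1 < N → P (braidGen N i)) (hm : ∀ a b, P a → P b → P (a * b))
    (hi : ∀ a, P a → P a⁻¹) (a : BraidGroup N) : P a := by
  have h : a ∈ Subgroup.closure (Set.range (PresentedGroup.of (rels := artinRelations N))) := by
    rw [PresentedGroup.closure_range_of]; trivial
  induction h using Subgroup.closure_induction with
  | mem x hx =>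
    obtain ⟨i, rfl⟩ := hx
    have := hg i (by have := i.2; omega)
    simpa [braidGen] using this
  | one => exact h1
  | mul x y _ _ hx hy => exact hm x y hx hy
  | inv x _ hx => exact hi x hx

/-- The transposition of the places `i` and `i + 1`. -/
def placeSwap (N i : ℕ) : Equiv.Perm (Fin N) :=
  if h : i + 1 < N then Equiv.swap ⟨i, by omega⟩ ⟨i + 1, h⟩ else 1

theorem placeSwap_val {N i : ℕ} (h : i + 1 < N) (x : Fin N) :
    ((placeSwap N i x : Fin N) : ℕ) = Equiv.swap i (i + 1) (x : ℕ) := by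
  simp only [placeSwap, h, dif_pos, Equiv.swap_apply_def, Fin.ext_iff]
  split_ifs <;> rfl

/-- The underlying permutation of a braid: the strand in place `x` ends in place
`braidPerm N b x`. -/
def braidPerm (N : ℕ) : BraidGroup N →* Equiv.Perm (Fin N) :=
  braidLift (placeSwap N)
    (fun i j h hj => by
      ext x
      simp only [Equiv.Perm.mul_apply, placeSwap_val hj, placeSwap_val (show i + 1 < N by omega),
        Equiv.swap_apply_def]
      split_ifs <;> omega)
    (fun i h => by
      ext x
      simp only [Equiv.Perm.mul_apply, placeSwap_val (show i + 1 + 1 < N by omega),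
        placeSwap_val (show i + 1 < N by omega), Equiv.swap_apply_def]
      split_ifs <;> omega)

theorem braidPerm_gen {N i : ℕ} (h : i + 1 < N) :
    braidPerm N (braidGen N i) = placeSwap N i := braidLift_gen _ _ _ h

/-- The mixed braid group `B_{n,m}`: the preimage in `B_{n+m}` of `S_n × S_m`, i.e. the braids
that permute the first `n` places among themselves (and hence the last `m` ones). -/
def mixedBraidGroup (n m : ℕ) : Subgroup (BraidGroup (n + m)) where
  carrier := {b | ∀ x : Fin (n + m), (braidPerm (n + m) b x : ℕ) < n ↔ (x : ℕ) < n}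
  one_mem' := by simp
  mul_mem' := by
    intro a b ha hb x
    rw [map_mul, Equiv.Perm.mul_apply, ha, hb]
  inv_mem' := by
    intro a ha x
    have := ha ((braidPerm (n + m) a)⁻¹ x)
    simpa using this.symm

/-- The braid that carries the strands in the places `p, p + 1, …` to the increasing places
`l = [i₁, i₂, …]`, the strand in place `p` first, each in front of the strands to its left and
keeping the order of all others:
`⋯ (σ_{i₂} σ_{i₂+1} ⋯ σ_p) (σ_{i₁} σ_{i₁+1} ⋯ σ_{p-1})`, as a (positive, reduced) word. -/
def liftWord : ℕ → List ℕ → List ℕ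
  | _, [] => []
  | p, i :: l => liftWord (p + 1) l ++ List.range' i (p - i)

theorem wordBraid_append (N : ℕ) (w w' : List ℕ) :
    wordBraid N (w ++ w') = wordBraid N w * wordBraid N w' := by
  simp [wordBraid]

theorem range'_perm {N : ℕ} : ∀ (d i : ℕ), i + d < N → ∀ x : Fin N,
    ((braidPerm N (wordBraid N (List.range' i d)) x : Fin N) : ℕ) =
      if (x : ℕ) = i + d then i else if i ≤ (x : ℕ) ∧ (x : ℕ) < i + d then x + 1 else x := by
  intro d
  induction d with
  | zero =>
    intro i h x
    simp only [wordBraid, List.range'_zero, List.map_nil, List.prod_nil, map_one,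
      Equiv.Perm.one_apply]
    split_ifs <;> omega
  | succ d ih =>
    intro i h x
    have := ih (i + 1) (by omega) x
    simp only [wordBraid, List.range'_succ, List.map_cons, List.prod_cons, map_mul,
      Equiv.Perm.mul_apply] at this ⊢
    rw [braidPerm_gen (by omega), placeSwap_val (by omega), this]
    simp only [Equiv.swap_apply_def]
    split_ifs <;> omega

theorem liftWord_perm {N : ℕ} : ∀ (l : List ℕ) (p : ℕ), p + l.length = N → l.Pairwise (· < ·) →
    (∀ y ∈ l, y < N) →
      (∀ x : Fin N, (∀ y ∈ l, (x : ℕ) < y) → (x : ℕ) < p →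
        braidPerm N (wordBraid N (liftWord p l)) x = x) ∧
      (∀ x : Fin N, p ≤ (x : ℕ) →
        ((braidPerm N (wordBraid N (liftWord p l)) x : Fin N) : ℕ) ∈ l) := by
  intro l
  induction l with
  | nil =>
    intro p h _ _
    refine ⟨fun x _ _ => by simp [wordBraid, liftWord], fun x hx => ?_⟩
    have := x.2
    simp at h; omega
  | cons i l ih =>
    intro p h hl hlt
    simp only [List.length_cons] at h
    rw [List.pairwise_cons] at hl
    have ip : i ≤ p := by
      have hs : (i :: l).toFinset ⊆ Finset.Ico i N := by
        intro y hy
        rw [List.mem_toFinset] at hy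
        rw [Finset.mem_Ico]
        refine ⟨?_, hlt y hy⟩
        rcases List.mem_cons.1 hy with rfl | hy
        · exact le_rfl
        · exact (hl.1 y hy).le
      have := Finset.card_le_card hs
      rw [List.toFinset_card_of_nodup (List.nodup_cons.2 ⟨fun hi => lt_irrefl _ (hl.1 i hi),
        hl.2.imp (fun h => ne_of_lt h)⟩)] at this
      simp only [List.length_cons, Nat.card_Ico] at this
      omega
    obtain ⟨h1, h2⟩ := ih (p + 1) (by omega) hl.2 (fun y hy => hlt y (List.mem_cons_of_mem _ hy))
    have hr := range'_perm (N := N) (p - i) i (by omega)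
    constructor
    · intro x hx hxp
      have hxi := hx i List.mem_cons_self
      rw [liftWord, wordBraid_append, map_mul, Equiv.Perm.mul_apply]
      have e : braidPerm N (wordBraid N (List.range' i (p - i))) x = x := by
        ext
        rw [hr]
        split_ifs <;> omega
      rw [e]
      exact h1 x (fun y hy => hx y (List.mem_cons_of_mem _ hy)) (by omega)
    · intro x hx
      rw [liftWord, wordBraid_append, map_mul, Equiv.Perm.mul_apply]
      have hx' := hr x
      rcases Nat.eq_or_lt_of_le hx with hx | hx
      · rw [if_pos (by omega)] at hx'
        rw [h1 _ (fun y hy => by rw [hx']; exact hl.1 y hy) (by omega), hx']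
        exact List.mem_cons_self
      · rw [if_neg (by omega), if_neg (by omega)] at hx'
        have : braidPerm N (wordBraid N (List.range' i (p - i))) x = x := Fin.ext hx'
        rw [this]
        exact List.mem_cons_of_mem _ (h2 x (by omega))

/-- The list of the elements of `I` in increasing order. -/
def sortedPlaces {N : ℕ} (I : Finset (Fin N)) : List ℕ := (I.map Fin.valEmbedding).sort (· ≤ ·)

/-- The lift `α̃_I` to a braid of the `(n,m)`-shuffle `α_I` that carries the last `m` places to
the set `I`. -/
def shuffleLift (n m : ℕ) (I : Finset (Fin (n + m))) : BraidGroup (n + m) :=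
  wordBraid (n + m) (liftWord n (sortedPlaces I))

theorem shuffleLift_perm (n m : ℕ) (I : Finset (Fin (n + m))) (hI : I.card = m)
    (x : Fin (n + m)) : braidPerm (n + m) (shuffleLift n m I) x ∈ I ↔ n ≤ (x : ℕ) := by
  have key : ∀ x : Fin (n + m), n ≤ (x : ℕ) →
      braidPerm (n + m) (shuffleLift n m I) x ∈ I := by
    intro x hx
    have := (liftWord_perm (N := n + m) (sortedPlaces I) n (by simp [sortedPlaces, hI])
      ((Finset.sortedLT_sort _).pairwise) (by
        intro y hy
        simp only [sortedPlaces, Finset.mem_sort, Finset.mem_map] at hy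
        obtain ⟨z, _, rfl⟩ := hy
        exact z.2)).2 x hx
    simp only [sortedPlaces, Finset.mem_sort, Finset.mem_map] at this
    obtain ⟨z, hz, e⟩ := this
    have : z = _ := Fin.ext e
    exact this ▸ hz
  refine ⟨fun h => ?_, key x⟩
  set π := braidPerm (n + m) (shuffleLift n m I)
  set T : Finset (Fin (n + m)) := Finset.univ.filter (fun x => n ≤ (x : ℕ))
  have hT : T.card = m := by
    have : T = Finset.univ.map (Fin.natAddEmb n : Fin m ↪ Fin (n + m)) := by
      ext y
      simp only [T, Finset.mem_filter, Finset.mem_univ, true_and, Finset.mem_map]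
      constructor
      · intro hy
        exact ⟨⟨y - n, by omega⟩, Fin.ext (by simp; omega)⟩
      · rintro ⟨z, rfl⟩
        simp
    rw [this]; simp
  have hsub : T.map π.toEmbedding ⊆ I := by
    intro y hy
    obtain ⟨z, hz, rfl⟩ := Finset.mem_map.1 hy
    exact key z (by simpa [T] using hz)
  have heq := Finset.eq_of_subset_of_card_le hsub (by simp [hT, hI])
  rw [← heq] at h
  obtain ⟨z, hz, e⟩ := Finset.mem_map.1 h
  have : z = x := π.injective e
  subst this
  simpa [T] using hz

/-- For a set `I` of `m` places and a braid `a`, the element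
`η_I(a) = (α̃_{a(I)})⁻¹ a α̃_I` of the mixed braid group. -/
def eta {n m : ℕ} (I : Finset (Fin (n + m))) (hI : I.card = m) (a : BraidGroup (n + m)) :
    mixedBraidGroup n m :=
  ⟨(shuffleLift n m (I.map (braidPerm (n + m) a).toEmbedding))⁻¹ * a * shuffleLift n m I, by
    intro x
    set π := braidPerm (n + m) a with hπ
    have hJ : (I.map π.toEmbedding).card = m := by rw [Finset.card_map, hI]
    have h1 := shuffleLift_perm n m I hI x
    have h2 := shuffleLift_perm n m (I.map π.toEmbedding) hJ (braidPerm (n + m)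
      ((shuffleLift n m (I.map π.toEmbedding))⁻¹ * a * shuffleLift n m I) x)
    have h3 : braidPerm (n + m) (shuffleLift n m (I.map π.toEmbedding)) (braidPerm (n + m)
        ((shuffleLift n m (I.map π.toEmbedding))⁻¹ * a * shuffleLift n m I) x) =
        π (braidPerm (n + m) (shuffleLift n m I) x) := by
      rw [← Equiv.Perm.mul_apply, ← map_mul]
      simp [mul_assoc, hπ]
    rw [h3, Finset.mem_map_equiv, Equiv.symm_apply_apply, h1] at h2
    omega⟩

/-- The defining relations of the mixed braid group `B_{n,m}` for elements `g i`,
`0 ≤ i < n + m - 1`, where `g (n - 1)` stands for `τ_n = σ_n²` and the other `g i` stand for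
the crossings of two strands of the same colour. -/
structure MixedBraidRelations (n m : ℕ) {G : Type*} [Group G] (g : ℕ → G) : Prop where
  comm : ∀ i j, i + 1 < j → j + 1 < n + m → g i * g j = g j * g i
  braid : ∀ i, i + 2 < n + m → (i + 2 < n ∨ n ≤ i) →
    g i * g (i + 1) * g i = g (i + 1) * g i * g (i + 1)
  left : ∀ i, i + 2 = n → 1 ≤ m →
    g i * g (i + 1) * g i * g (i + 1) = g (i + 1) * g i * g (i + 1) * g i
  right : ∀ i, i + 1 = n → 2 ≤ m →
    g i * g (i + 1) * g i * g (i + 1) = g (i + 1) * g i * g (i + 1) * g i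
  mixed : ∀ i, i + 2 = n → 2 ≤ m →
    Commute (g i * g (i + 1) * (g i)⁻¹) (g (i + 2) * g (i + 1) * (g (i + 2))⁻¹)

section Twist

variable {G : Type*} [Group G]

/-- `σ_{n+k-1} ⋯ σ_n τ_n σ_n⁻¹ ⋯ σ_{n+k-1}⁻¹` (places counted from `0`): the last left strand
winds around the right strand with index `k`. -/
def lastTwist (n : ℕ) (g : ℕ → G) : ℕ → G
  | 0 => g (n - 1)
  | k + 1 => g (n + k) * lastTwist n g k * (g (n + k))⁻¹

/-- Auxiliary recursion for `twist`. -/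
def twistAux (n : ℕ) (g : ℕ → G) : ℕ → ℕ → G
  | 0, k => lastTwist n g k
  | j + 1, k => g (n - 2 - j) * twistAux n g j k * (g (n - 2 - j))⁻¹

/-- The left strand with index `a` winds around the right strand with index `k`:
`σ_a ⋯ σ_{n-2} θ σ_{n-2}⁻¹ ⋯ σ_a⁻¹` with `θ = lastTwist n g k`. -/
def twist (n : ℕ) (g : ℕ → G) (a k : ℕ) : G := twistAux n g (n - 1 - a) k

theorem twist_last (n : ℕ) (g : ℕ → G) (k : ℕ) : twist n g (n - 1) k = lastTwist n g k := by
  simp [twist, twistAux]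

theorem twist_left {n : ℕ} (g : ℕ → G) {a : ℕ} (k : ℕ) (h : a + 1 < n) :
    twist n g a k = g a * twist n g (a + 1) k * (g a)⁻¹ := by
  obtain ⟨j, rfl⟩ : ∃ j, n = a + 2 + j := ⟨n - a - 2, by omega⟩
  have e1 : a + 2 + j - 1 - a = j + 1 := by omega
  have e2 : a + 2 + j - 1 - (a + 1) = j := by omega
  have e3 : a + 2 + j - 2 - j = a := by omega
  simp only [twist, e1, e2, twistAux, e3]

theorem semiconj_left {n : ℕ} (g : ℕ → G) {a : ℕ} (k : ℕ) (h : a + 1 < n) :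
    SemiconjBy (g a) (twist n g (a + 1) k) (twist n g a k) := by
  rw [twist_left g k h]; simp [SemiconjBy, mul_assoc]

theorem commute_conj {u x x' y y' : G} (hx : SemiconjBy u x x') (hy : SemiconjBy u y y')
    (h : Commute x y) : Commute x' y' := by
  have h1 := (hx.mul_right hy).eq
  have h2 := (hy.mul_right hx).eq
  rw [h.eq, h2] at h1
  exact (mul_right_cancel h1).symm

theorem four_conj {u x x' y y' : G} (hx : SemiconjBy u x x') (hy : SemiconjBy u y y')
    (h : x * y * x * y = y * x * y * x) : x' * y' * x' * y' = y' * x' * y' * x' := by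
  have h1 := (((hx.mul_right hy).mul_right hx).mul_right hy).eq
  have h2 := (((hy.mul_right hx).mul_right hy).mul_right hx).eq
  rw [h, h2] at h1
  exact (mul_right_cancel h1).symm

theorem semiconj_of_braid {x y : G} (h : x * y * x = y * x * y) : SemiconjBy (x * y) x y := by
  simp only [SemiconjBy, ← mul_assoc]; exact h

variable {n m : ℕ} {g : ℕ → G}

theorem MixedBraidRelations.commute (hg : MixedBraidRelations n m g) {i j : ℕ}
    (h : i + 1 < j ∨ j + 1 < i) (hi : i + 1 < n + m) (hj : j + 1 < n + m) :
    Commute (g i) (g j) := by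
  rcases h with h | h
  · exact hg.comm i j h hj
  · exact (hg.comm j i h hi).symm

theorem MixedBraidRelations.semiconj_right (hg : MixedBraidRelations n m g) {a k : ℕ}
    (ha : a < n) (hk : k + 1 < m) :
    SemiconjBy (g (n + k)) (twist n g a k) (twist n g a (k + 1)) := by
  obtain ⟨j, rfl⟩ : ∃ j, n = a + 1 + j := ⟨n - a - 1, by omega⟩
  induction j generalizing a with
  | zero =>
    have := twist_last (a + 1 + 0) g
    simp only [add_zero, Nat.add_sub_cancel] at this ⊢
    rw [this, this, lastTwist]
    simp [SemiconjBy, mul_assoc]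
  | succ j ih =>
    have e : a + 1 + (j + 1) = a + 1 + 1 + j := by omega
    have := ih (a := a + 1) (by rw [← e]; exact hg) (by omega)
    rw [e] at hg ⊢
    rw [twist_left g k (by omega), twist_left g (k + 1) (by omega)]
    have hc : Commute (g (a + 1 + 1 + j + k)) (g a) :=
      hg.commute (by omega) (by omega) (by omega)
    exact (SemiconjBy.mul_right (hc : SemiconjBy _ _ _) this).mul_right hc.inv_right

theorem MixedBraidRelations.commute_right (hg : MixedBraidRelations n m g) {a j k : ℕ}
    (ha : a < n) (hk : k < m) (hj : j + 1 < m) (h : k < j ∨ j + 1 < k) :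
    Commute (g (n + j)) (twist n g a k) := by
  have key : ∀ k, k < m → (k < j ∨ j + 1 < k) → Commute (g (n + j)) (lastTwist n g k) := by
    have small : ∀ j, j + 1 < m → ∀ k, k < m → k < j → Commute (g (n + j)) (lastTwist n g k) := by
      intro j hj k
      induction k with
      | zero => exact fun _ h => hg.commute (by omega) (by omega) (by omega)
      | succ k ih =>
        intro h1 h2
        have hc : Commute (g (n + j)) (g (n + k)) :=
          hg.commute (by omega) (by omega) (by omega)
        exact (hc.mul_right (ih (by omega) (by omega))).mul_right hc.inv_right
    intro k
    induction k with
    | zero => exact fun h1 h2 => small j hj 0 h1 (by omega)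
    | succ k ih =>
      intro h1 h2
      rcases h2 with h2 | h2
      · exact small j hj _ h1 h2
      · by_cases e : j + 1 = k
        · subst e
          have hb := hg.braid (n + j) (by omega) (by omega)
          have h3 := semiconj_of_braid hb.symm
          have hc := small (j + 1) (by omega) j (by omega) (by omega)
          have h4 : SemiconjBy (g (n + (j + 1)) * g (n + j)) (lastTwist n g j)
              (lastTwist n g (j + 1 + 1)) := by
            simp only [lastTwist]
            simp [SemiconjBy, mul_assoc]
          exact commute_conj h3 h4 hc
        · have hc : Commute (g (n + j)) (g (n + k)) :=
            hg.commute (by omega) (by omega) (by omega)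
          exact (hc.mul_right (ih (by omega) (by omega))).mul_right hc.inv_right
  obtain ⟨i, hi⟩ : ∃ i, n = a + 1 + i := ⟨n - a - 1, by omega⟩
  induction i generalizing a with
  | zero =>
    have : a = n - 1 := by omega
    rw [this, twist_last]
    exact key k hk h
  | succ i ih =>
    rw [twist_left g k (by omega)]
    have hc : Commute (g (n + j)) (g a) := hg.commute (by omega) (by omega) (by omega)
    exact (hc.mul_right (ih (a := a + 1) (by omega) (by omega))).mul_right hc.inv_right

theorem MixedBraidRelations.commute_left (hg : MixedBraidRelations n m g) {k : ℕ} (hk : k < m) :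
    ∀ d a i : ℕ, a + 1 + d = n → i + 1 < n → (i + 1 < a ∨ a < i) →
      Commute (g i) (twist n g a k) := by
  intro d
  induction d using Nat.strong_induction_on with
  | _ d ih =>
    intro a i ha hi h
    rcases d with _ | d
    · have : a = n - 1 := by omega
      rw [this, twist_last]
      clear ih
      induction k with
      | zero => exact hg.commute (by omega) (by omega) (by omega)
      | succ k ih =>
        have hc : Commute (g i) (g (n + k)) := hg.commute (by omega) (by omega) (by omega)
        exact (hc.mul_right (ih (by omega))).mul_right hc.inv_right
    · by_cases e : i = a + 1
      · subst e
        obtain ⟨d, rfl⟩ : ∃ d', d = d' + 1 := ⟨d - 1, by omega⟩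
        have h1 := ih d (by omega) (a + 2) a (by omega) (by omega) (by omega)
        have hb := hg.braid a (by omega) (by omega)
        have h3 := semiconj_of_braid hb
        have h4 : SemiconjBy (g a * g (a + 1)) (twist n g (a + 2) k) (twist n g a k) :=
          (semiconj_left g k (by omega)).mul_left (semiconj_left g k (by omega))
        exact commute_conj h3 h4 h1
      · have hc : Commute (g i) (g a) := by
          exact hg.commute (by omega) (by omega) (by omega)
        rw [twist_left g k (by omega)]
        exact (hc.mul_right (ih d (by omega) (a + 1) i (by omega) hi (by omega))).mul_right
          hc.inv_right

theorem MixedBraidRelations.four_left (hg : MixedBraidRelations n m g) {k : ℕ} (hk : k < m) :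
    ∀ d a : ℕ, a + 2 + d = n → g a * twist n g (a + 1) k * g a * twist n g (a + 1) k =
      twist n g (a + 1) k * g a * twist n g (a + 1) k * g a := by
  intro d
  induction d with
  | zero =>
    intro a ha
    have e : a + 1 = n - 1 := by omega
    rw [e, twist_last]
    induction k with
    | zero =>
      have := hg.left a ha (by omega)
      rwa [e] at this
    | succ k ih =>
      have hc : Commute (g (n + k)) (g a) := hg.commute (by omega) (by omega) (by omega)
      exact four_conj (u := g (n + k)) hc (by simp [lastTwist, SemiconjBy, mul_assoc])
        (ih (by omega))
  | succ d ih =>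
    intro a ha
    have h1 := ih (a + 1) (by omega)
    have hb := hg.braid a (by omega) (by omega)
    have hc := hg.commute_left hk d (a + 2) a (by omega) (by omega) (by omega)
    have h3 := semiconj_of_braid hb.symm
    have h4 : SemiconjBy (g (a + 1) * g a) (twist n g (a + 1 + 1) k) (twist n g (a + 1) k) :=
      (semiconj_left g k (by omega)).mul_left hc
    exact four_conj h3 h4 h1

theorem MixedBraidRelations.four_right (hg : MixedBraidRelations n m g) {a k : ℕ} (ha : a < n)
    (hk : k + 1 < m) : twist n g a k * g (n + k) * twist n g a k * g (n + k) =
      g (n + k) * twist n g a k * g (n + k) * twist n g a k := by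
  obtain ⟨i, hi⟩ : ∃ i, n = a + 1 + i := ⟨n - a - 1, by omega⟩
  induction i generalizing a with
  | zero =>
    have : a = n - 1 := by omega
    subst this
    induction k with
    | zero =>
      rw [twist_last]
      have := hg.right (n - 1) (by omega) (by omega)
      rwa [show n - 1 + 1 = n + 0 by omega] at this
    | succ k ih =>
      have hb := hg.braid (n + k) (by omega) (by omega)
      have hc : Commute (g (n + (k + 1))) (twist n g (n - 1) k) :=
        hg.commute_right ha (by omega) (by omega) (by omega)
      have h3 := semiconj_of_braid hb
      have h4 : SemiconjBy (g (n + k) * g (n + k + 1)) (twist n g (n - 1) k)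
          (twist n g (n - 1) (k + 1)) := (hg.semiconj_right ha (by omega)).mul_left hc
      exact four_conj h4 h3 (ih (by omega))
  | succ i ih =>
    have hc : Commute (g a) (g (n + k)) := hg.commute (by omega) (by omega) (by omega)
    exact four_conj (semiconj_left g k (by omega)) hc (ih (a := a + 1) (by omega) (by omega))

theorem MixedBraidRelations.commute_twist (hg : MixedBraidRelations n m g) {a b k l : ℕ}
    (hab : a < b) (hb : b < n) (hkl : k < l) (hl : l < m) :
    Commute (twist n g a k) (twist n g b l) := by
  have key : ∀ k l, k < l → l < m → Commute (twist n g (n - 2) k) (twist n g (n - 1) l) := by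
    have base : ∀ k, k + 1 < m → Commute (twist n g (n - 2) k) (twist n g (n - 1) (k + 1)) := by
      intro k
      induction k with
      | zero =>
        intro hm
        have := hg.mixed (n - 2) (by omega) (by omega)
        rw [twist_left g 0 (by omega)]
        rw [show n - 2 + 1 = n - 1 by omega, show n - 2 + 2 = n + 0 by omega] at *
        rw [twist_last, twist_last]
        exact this
      | succ k ih =>
        intro hm
        have h1 : Commute (g (n + (k + 1))) (twist n g (n - 2) k) :=
          hg.commute_right (by omega) (by omega) (by omega) (by omega)
        have h2 : Commute (g (n + k)) (twist n g (n - 1) (k + 1 + 1)) :=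
          hg.commute_right (by omega) (by omega) (by omega) (by omega)
        exact commute_conj (u := g (n + k) * g (n + (k + 1)))
          ((hg.semiconj_right (by omega) (by omega)).mul_left h1)
          (SemiconjBy.mul_left h2 (hg.semiconj_right (by omega) (by omega))) (ih (by omega))
    intro k l
    induction l with
    | zero => intro h; omega
    | succ l ih =>
      intro h1 h2
      by_cases e : k = l
      · subst e; exact base k h2
      · exact commute_conj (u := g (n + l))
          (hg.commute_right (by omega) (by omega) (by omega) (by omega))
          (hg.semiconj_right (by omega) (by omega)) (ih (by omega) (by omega))
  have diag : ∀ d b, b + 2 + d = n → Commute (twist n g b k) (twist n g (b + 1) l) := by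
    intro d
    induction d with
    | zero =>
      intro b hb
      have := key k l hkl hl
      rwa [show n - 2 = b by omega, show n - 1 = b + 1 by omega] at this
    | succ d ih =>
      intro b hb
      have h1 : Commute (g (b + 1)) (twist n g b k) :=
        hg.commute_left (by omega) (d + 2) b (b + 1) (by omega) (by omega) (by omega)
      have h2 : Commute (g b) (twist n g (b + 2) l) :=
        hg.commute_left (by omega) d (b + 2) b (by omega) (by omega) (by omega)
      exact commute_conj (u := g (b + 1) * g b)
        (SemiconjBy.mul_left h1 (semiconj_left g k (by omega)))
        ((semiconj_left g l (by omega)).mul_left h2) (ih (b + 1) (by omega))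
  obtain ⟨d, rfl⟩ : ∃ d, b = a + 1 + d := ⟨b - a - 1, by omega⟩
  induction d generalizing a with
  | zero => exact diag (n - a - 2) a (by omega)
  | succ d ih =>
    have e : a + 1 + (d + 1) = a + 1 + 1 + d := by omega
    rw [e]
    have h1 : Commute (g a) (twist n g (a + 1 + 1 + d) l) :=
      hg.commute_left (by omega) (n - 1 - (a + 1 + 1 + d)) _ a (by omega) (by omega) (by omega)
    exact commute_conj (semiconj_left g k (by omega)) h1
      (ih (a := a + 1) (by omega) (by omega))

end Twist

section Action

/-- Exchange the colours in the places `i` and `i + 1`. -/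
def exch (x : ℕ → Bool) (i : ℕ) : ℕ → Bool := fun j => x (Equiv.swap i (i + 1) j)

/-- The number of places `j < i` with colour `c`. -/
def numColour (c : Bool) (x : ℕ → Bool) : ℕ → ℕ
  | 0 => 0
  | i + 1 => numColour c x i + if x i = c then 1 else 0

theorem exch_same (x : ℕ → Bool) (i : ℕ) : exch x i i = x (i + 1) := by simp [exch]

theorem exch_next (x : ℕ → Bool) (i : ℕ) : exch x i (i + 1) = x i := by simp [exch]

theorem exch_other (x : ℕ → Bool) {i j : ℕ} (h : j ≠ i) (h' : j ≠ i + 1) :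
    exch x i j = x j := by simp [exch, Equiv.swap_apply_of_ne_of_ne h h']

theorem exch_exch (x : ℕ → Bool) (i : ℕ) : exch (exch x i) i = x := by
  funext j; simp [exch]

theorem numColour_exch_le (c : Bool) (x : ℕ → Bool) {i j : ℕ} (h : j ≤ i) :
    numColour c (exch x i) j = numColour c x j := by
  induction j with
  | zero => rfl
  | succ j ih => rw [numColour, numColour, ih (by omega), exch_other x (by omega) (by omega)]

theorem numColour_exch_ge (c : Bool) (x : ℕ → Bool) {i j : ℕ} (h : i + 2 ≤ j) :
    numColour c (exch x i) j = numColour c x j := by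
  induction j, h using Nat.le_induction with
  | base =>
    simp only [numColour, numColour_exch_le c x le_rfl, exch_same, exch_next]
    omega
  | succ j hj ih => rw [numColour, numColour, ih, exch_other x (by omega) (by omega)]

theorem numColour_mono (c : Bool) (x : ℕ → Bool) : Monotone (numColour c x) :=
  monotone_nat_of_le_succ fun i => by simp [numColour]

theorem numColour_add (x : ℕ → Bool) (i : ℕ) :
    numColour false x i + numColour true x i = i := by
  induction i with
  | zero => rfl
  | succ i ih => simp only [numColour]; cases x i <;> simp <;> omega

/-- A colouring of the `n + m` places with `n` places of colour `false`. -/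
abbrev Colouring (n m : ℕ) : Type := {x : ℕ → Bool // numColour false x (n + m) = n}

variable {n m : ℕ} {G : Type*} [Group G]

/-- The element of the mixed braid group by which `σ_i` acts on the summand of the induced module
that belongs to the colouring `x`. -/
def cocycle (n : ℕ) (g : ℕ → G) (x : ℕ → Bool) (i : ℕ) : G :=
  match x i, x (i + 1) with
  | false, false => g (numColour false x i)
  | true, true => g (n + numColour true x i)
  | false, true => 1
  | true, false => twist n g (numColour false x i) (numColour true x i)

/-- The action of `σ_i` on pairs of a colouring and an element of `G`. -/
def stepPerm (n m : ℕ) (g : ℕ → G) (i : ℕ) : Equiv.Perm (Colouring n m × G) :=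
  if h : i + 1 < n + m then
    { toFun := fun p => (⟨exch p.1.1 i, by
        rw [numColour_exch_ge _ _ (by omega)]; exact p.1.2⟩, cocycle n g p.1.1 i * p.2)
      invFun := fun p => (⟨exch p.1.1 i, by
        rw [numColour_exch_ge _ _ (by omega)]; exact p.1.2⟩,
          (cocycle n g (exch p.1.1 i) i)⁻¹ * p.2)
      left_inv := fun p => by ext1 <;> simp [exch_exch]
      right_inv := fun p => by ext1 <;> simp [exch_exch] }
  else 1

theorem stepPerm_fst (g : ℕ → G) {i : ℕ} (h : i + 1 < n + m) (p : Colouring n m × G) :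
    (stepPerm n m g i p).1.1 = exch p.1.1 i := by simp [stepPerm, h]

theorem stepPerm_snd (g : ℕ → G) {i : ℕ} (h : i + 1 < n + m) (p : Colouring n m × G) :
    (stepPerm n m g i p).2 = cocycle n g p.1.1 i * p.2 := by simp [stepPerm, h]

theorem colouring_bound (x : Colouring n m) {i : ℕ} (h : i ≤ n + m) :
    numColour false x.1 i ≤ n ∧ numColour true x.1 i ≤ m := by
  have h1 := numColour_mono false x.1 h
  have h2 := numColour_mono true x.1 h
  have h3 := numColour_add x.1 (n + m)
  have h4 := x.2
  omega

theorem cocycle_congr (g : ℕ → G) {x y : ℕ → Bool} {i : ℕ} (h0 : x i = y i)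
    (h1 : x (i + 1) = y (i + 1)) (hf : numColour false x i = numColour false y i) :
    cocycle n g x i = cocycle n g y i := by
  have ht : numColour true x i = numColour true y i := by
    have := numColour_add x i
    have := numColour_add y i
    omega
  simp only [cocycle, h0, h1, hf, ht]

theorem cocycle_comm {g : ℕ → G} (hg : MixedBraidRelations n m g) (x : Colouring n m) {i j : ℕ}
    (h : i + 1 < j) (hj : j + 1 < n + m) :
    Commute (cocycle n g x.1 i) (cocycle n g x.1 j) := by
  have b2 := colouring_bound x (show j + 2 ≤ n + m by omega)
  have mf := numColour_mono false x.1 (show i + 2 ≤ j by omega)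
  have mt := numColour_mono true x.1 (show i + 2 ≤ j by omega)
  simp only [numColour] at b2 mf mt
  unfold cocycle
  rcases hi0 : x.1 i <;> rcases hi1 : x.1 (i + 1) <;> rcases hj0 : x.1 j <;>
    rcases hj1 : x.1 (j + 1) <;> simp only [hi0, hi1, hj0, hj1] at b2 mf mt ⊢ <;>
    simp only [if_true, reduceCtorEq, if_false, add_zero] at b2 mf mt <;>
    first
      | exact Commute.one_left _
      | exact Commute.one_right _
      | exact hg.commute (by omega) (by omega) (by omega)
      | exact hg.commute_twist (by omega) (by omega) (by omega) (by omega)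
      | exact hg.commute_right (by omega) (by omega) (by omega) (by omega)
      | exact (hg.commute_right (by omega) (by omega) (by omega) (by omega)).symm
      | exact hg.commute_left (by omega) (n - 1 - numColour false x.1 j) _ _ (by omega) (by omega)
          (by omega)
      | exact (hg.commute_left (by omega) (n - 1 - numColour false x.1 i) _ _ (by omega)
          (by omega) (by omega)).symm

theorem exch_braid (x : ℕ → Bool) (i : ℕ) :
    exch (exch (exch x i) (i + 1)) i = exch (exch (exch x (i + 1)) i) (i + 1) := by
  funext j
  simp only [exch]
  congr 1
  simp only [Equiv.swap_apply_def]
  split_ifs <;> omega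

theorem exch_comm (x : ℕ → Bool) {i j : ℕ} (h : i + 1 < j) :
    exch (exch x j) i = exch (exch x i) j := by
  funext l
  simp only [exch]
  congr 1
  simp only [Equiv.swap_apply_def]
  split_ifs <;> omega

theorem cocycle_braid {g : ℕ → G} (hg : MixedBraidRelations n m g) (x : Colouring n m) {i : ℕ}
    (h : i + 2 < n + m) :
    cocycle n g (exch (exch x.1 i) (i + 1)) i * cocycle n g (exch x.1 i) (i + 1) *
        cocycle n g x.1 i =
      cocycle n g (exch (exch x.1 (i + 1)) i) (i + 1) * cocycle n g (exch x.1 (i + 1)) i *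
        cocycle n g x.1 (i + 1) := by
  have b := colouring_bound x (show i + 3 ≤ n + m by omega)
  have e1 : exch (exch x.1 i) (i + 1) i = x.1 (i + 1) := by
    rw [exch_other _ (by omega) (by omega), exch_same]
  have e2 : exch (exch x.1 i) (i + 1) (i + 1) = x.1 (i + 2) := by
    rw [exch_same, exch_other _ (by omega) (by omega)]
  have e3 : exch x.1 i (i + 1 + 1) = x.1 (i + 2) := by
    rw [exch_other _ (by omega) (by omega)]
  have e4 : exch (exch x.1 (i + 1)) i (i + 1) = x.1 i := by
    rw [exch_next, exch_other _ (by omega) (by omega)]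
  have e5 : exch (exch x.1 (i + 1)) i (i + 1 + 1) = x.1 (i + 1) := by
    rw [exch_other _ (by omega) (by omega), exch_next]
  have e6 : exch x.1 (i + 1) i = x.1 i := exch_other _ (by omega) (by omega)
  have e7 : exch (exch x.1 (i + 1)) i i = x.1 (i + 2) := by rw [exch_same, exch_same]
  have n1 : ∀ c, numColour c (exch (exch x.1 i) (i + 1)) i = numColour c x.1 i := fun c => by
    rw [numColour_exch_le _ _ (by omega), numColour_exch_le _ _ le_rfl]
  have n2 : ∀ c, numColour c (exch x.1 i) i = numColour c x.1 i := fun c =>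
    numColour_exch_le _ _ le_rfl
  have n3 : ∀ c, numColour c (exch (exch x.1 (i + 1)) i) i = numColour c x.1 i := fun c => by
    rw [numColour_exch_le _ _ (by omega), numColour_exch_le _ _ (by omega)]
  have n4 : ∀ c, numColour c (exch x.1 (i + 1)) i = numColour c x.1 i := fun c =>
    numColour_exch_le _ _ (by omega)
  simp only [numColour] at b
  simp only [cocycle, e1, e2, e3, e4, e5, e6, e7, exch_same, exch_next, n1, n2, n3, n4, numColour]
  rcases h0 : x.1 i <;> rcases h1 : x.1 (i + 1) <;> rcases h2 : x.1 (i + 2) <;>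
    simp only [h0, h1, h2, if_true, reduceCtorEq, if_false, add_zero, one_mul, mul_one] at b ⊢
  · exact hg.braid _ (by omega) (by omega)
  · exact (semiconj_left g _ (by omega)).eq.symm
  · have h4 := hg.four_left (k := numColour true x.1 i) (by omega)
      (n - 2 - numColour false x.1 i) (numColour false x.1 i) (by omega)
    rw [twist_left g _ (show numColour false x.1 i + 1 < n by omega)]
    simp only [← mul_assoc, inv_mul_cancel_right]
    rw [h4]
    simp [mul_assoc]
  · exact (hg.semiconj_right (by omega) (by omega)).eq
  · have h4 := hg.four_right (a := numColour false x.1 i) (k := numColour true x.1 i) (by omega)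
      (by omega)
    have h5 := (hg.semiconj_right (a := numColour false x.1 i) (k := numColour true x.1 i)
      (by omega) (by omega)).eq
    rw [mul_assoc, ← h5, ← mul_assoc]
    apply mul_right_cancel (b := g (n + numColour true x.1 i))
    rw [h4, mul_assoc _ (twist n g _ (_ + 1)), ← h5, ← mul_assoc]
  · have := hg.braid (n + numColour true x.1 i) (by omega) (by omega)
    simpa only [add_assoc] using this

/-- The action of the braid group `B_{n+m}` on pairs of a colouring and an element of `G`. -/
def colourAction {g : ℕ → G} (hg : MixedBraidRelations n m g) :
    BraidGroup (n + m) →* Equiv.Perm (Colouring n m × G) :=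
  braidLift (stepPerm n m g)
    (fun i j h hj => by
      have hi : i + 1 < n + m := by omega
      ext1 p
      refine Prod.ext (Subtype.ext ?_) ?_
      · simp only [Equiv.Perm.mul_apply, stepPerm_fst g hi, stepPerm_fst g hj]
        exact exch_comm _ h
      · simp only [Equiv.Perm.mul_apply, stepPerm_fst g hi, stepPerm_fst g hj,
          stepPerm_snd g hi, stepPerm_snd g hj, ← mul_assoc]
        rw [cocycle_congr (n := n) g (x := exch p.1.1 j) (y := p.1.1) (i := i)
            (exch_other _ (by omega) (by omega)) (exch_other _ (by omega) (by omega))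
            (numColour_exch_le _ _ (by omega)),
          cocycle_congr (n := n) g (x := exch p.1.1 i) (y := p.1.1) (i := j)
            (exch_other _ (by omega) (by omega)) (exch_other _ (by omega) (by omega))
            (numColour_exch_ge _ _ (by omega)), (cocycle_comm hg p.1 h hj).eq])
    (fun i h => by
      have h0 : i + 1 < n + m := by omega
      have h1 : i + 1 + 1 < n + m := by omega
      ext1 p
      refine Prod.ext (Subtype.ext ?_) ?_
      · simp only [Equiv.Perm.mul_apply, stepPerm_fst g h0, stepPerm_fst g h1]
        exact exch_braid _ _
      · simp only [Equiv.Perm.mul_apply, stepPerm_fst g h0, stepPerm_fst g h1,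
          stepPerm_snd g h0, stepPerm_snd g h1, ← mul_assoc]
        rw [cocycle_braid hg p.1 h])

theorem colourAction_gen {g : ℕ → G} (hg : MixedBraidRelations n m g) {i : ℕ}
    (h : i + 1 < n + m) : colourAction hg (braidGen (n + m) i) = stepPerm n m g i :=
  braidLift_gen _ _ _ h

theorem colourAction_mul {g : ℕ → G} (hg : MixedBraidRelations n m g) (b : BraidGroup (n + m)) :
    ∀ (x : Colouring n m) (u v : G), colourAction hg b (x, u * v) =
      ((colourAction hg b (x, u)).1, (colourAction hg b (x, u)).2 * v) := by
  induction b using braid_induction with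
  | h1 => simp
  | hg i h =>
    intro x u v
    rw [colourAction_gen hg h]
    refine Prod.ext (Subtype.ext ?_) ?_
    · simp only [stepPerm_fst g h]
    · simp only [stepPerm_snd g h, mul_assoc]
  | hm a b iha ihb =>
    intro x u v
    simp only [map_mul, Equiv.Perm.mul_apply]
    rw [ihb, iha]
  | hi a ih =>
    intro x u v
    rw [map_inv, Equiv.Perm.inv_eq_iff_eq, ih]
    simp

theorem colourAction_place {g : ℕ → G} (hg : MixedBraidRelations n m g)
    (b : BraidGroup (n + m)) : ∀ p : Colouring n m × G,
      (∀ j : Fin (n + m), (colourAction hg b p).1.1 (braidPerm (n + m) b j) = p.1.1 j) ∧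
      (∀ j, n + m ≤ j → (colourAction hg b p).1.1 j = p.1.1 j) := by
  induction b using braid_induction with
  | h1 => simp
  | hg i h =>
    intro p
    rw [colourAction_gen hg h, braidPerm_gen h, stepPerm_fst g h]
    refine ⟨fun j => ?_, fun j hj => exch_other _ (by omega) (by omega)⟩
    rw [placeSwap_val h, exch, Equiv.swap_apply_self]
  | hm a b iha ihb =>
    intro p
    simp only [map_mul, Equiv.Perm.mul_apply]
    refine ⟨fun j => ?_, fun j hj => ?_⟩
    · rw [(iha _).1, (ihb _).1]
    · rw [(iha _).2 j hj, (ihb _).2 j hj]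
  | hi a ih =>
    intro p
    have := ih (colourAction hg a⁻¹ p)
    have e : colourAction hg a (colourAction hg a⁻¹ p) = p := by simp
    rw [e] at this
    refine ⟨fun j => ?_, fun j hj => (this.2 j hj).symm⟩
    rw [← this.1]
    simp

/-- The colouring of the first `n` places by `false` and of all others by `true`. -/
def baseColouring (n m : ℕ) : Colouring n m :=
  ⟨fun j => decide (n ≤ j), by
    have h : ∀ i, numColour false (fun j => decide (n ≤ j)) i = min n i := by
      intro i
      induction i with
      | zero => simp [numColour]
      | succ i ih =>
        rw [numColour, ih]
        by_cases h : n ≤ i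
        · simp [h]; omega
        · simp [h]; omega
    rw [h]; omega⟩

theorem baseColouring_num (c : Bool) (i : ℕ) :
    numColour c (baseColouring n m).1 i = if c then i - n else min n i := by
  have h : ∀ i, numColour false (baseColouring n m).1 i = min n i := by
    intro i
    induction i with
    | zero => simp [numColour]
    | succ i ih =>
      rw [numColour, ih]
      by_cases h : n ≤ i
      · simp [h, baseColouring]; omega
      · simp [h, baseColouring]; omega
  have h2 := numColour_add (baseColouring n m).1 i
  have h3 := h i
  cases c
  · simpa using h3
  · simp; omega

theorem colourAction_base {g : ℕ → G} (hg : MixedBraidRelations n m g)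
    {b : BraidGroup (n + m)} (hb : b ∈ mixedBraidGroup n m) (u : G) :
    (colourAction hg b (baseColouring n m, u)).1 = baseColouring n m := by
  obtain ⟨h1, h2⟩ := colourAction_place hg b (baseColouring n m, u)
  apply Subtype.ext
  funext j
  by_cases hj : j < n + m
  · have h3 := h1 ((braidPerm (n + m) b)⁻¹ ⟨j, hj⟩)
    have h4 := hb ((braidPerm (n + m) b)⁻¹ ⟨j, hj⟩)
    have e : braidPerm (n + m) b ((braidPerm (n + m) b)⁻¹ ⟨j, hj⟩) = ⟨j, hj⟩ := by simp
    rw [e] at h3 h4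
    refine h3.trans ?_
    simp only [baseColouring, decide_eq_decide]
    simp only at h4
    omega
  · exact h2 j (by omega)

/-- Elements of a group `G` that satisfy the relations of the mixed braid group `B_{n,m}` define
a homomorphism `B_{n,m} → G`. (It is read off from the induced action of `B_{n+m}`; its values on
the generators are computed below.) -/
def mixedBraidLift {g : ℕ → G} (hg : MixedBraidRelations n m g) : mixedBraidGroup n m →* G where
  toFun b := (colourAction hg b (baseColouring n m, 1)).2
  map_one' := by simp
  map_mul' a b := by
    have h := colourAction_base hg b.2 1
    have e : colourAction hg b (baseColouring n m, 1) =
        (baseColouring n m, 1 * (colourAction hg b (baseColouring n m, 1)).2) :=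
      Prod.ext h (by simp)
    rw [Subgroup.coe_mul, map_mul, Equiv.Perm.mul_apply, e, colourAction_mul]
    simp

theorem braidGen_mem {i : ℕ} (h : i + 1 < n + m) (hi : i + 1 ≠ n) :
    braidGen (n + m) i ∈ mixedBraidGroup n m := by
  intro x
  rw [braidPerm_gen h, placeSwap_val h, Equiv.swap_apply_def]
  split_ifs <;> omega

theorem braidGen_sq_mem {i : ℕ} (h : i + 1 < n + m) :
    braidGen (n + m) i ^ 2 ∈ mixedBraidGroup n m := by
  intro x
  rw [pow_two, map_mul, Equiv.Perm.mul_apply, braidPerm_gen h, placeSwap_val h, placeSwap_val h,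
    Equiv.swap_apply_self]

/-- `σ_i ↦ g i` if the places `i` and `i + 1` have the same colour. -/
theorem mixedBraidLift_gen {g : ℕ → G} (hg : MixedBraidRelations n m g) {i : ℕ}
    (h : i + 1 < n + m) (hi : i + 1 ≠ n) :
    mixedBraidLift hg ⟨braidGen (n + m) i, braidGen_mem h hi⟩ = g i := by
  change (colourAction hg (braidGen (n + m) i) (baseColouring n m, 1)).2 = g i
  rw [colourAction_gen hg h, stepPerm_snd g h, mul_one, cocycle]
  by_cases h1 : n ≤ i
  · have e1 : (baseColouring n m).1 i = true := by simp [baseColouring, h1]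
    have e2 : (baseColouring n m).1 (i + 1) = true := by simp [baseColouring]; omega
    simp only [e1, e2, baseColouring_num]
    congr 1; simp; omega
  · have e1 : (baseColouring n m).1 i = false := by simp [baseColouring]; omega
    have e2 : (baseColouring n m).1 (i + 1) = false := by simp [baseColouring]; omega
    simp only [e1, e2, baseColouring_num]
    congr 1; simp; omega

/-- `τ_n = σ_{n-1}² ↦ g (n - 1)` (places counted from `0`). -/
theorem mixedBraidLift_twist {g : ℕ → G} (hg : MixedBraidRelations n m g) {i : ℕ}
    (h : i + 1 < n + m) (hi : i + 1 = n) :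
    mixedBraidLift hg ⟨braidGen (n + m) i ^ 2, braidGen_sq_mem h⟩ = g i := by
  change (colourAction hg (braidGen (n + m) i ^ 2) (baseColouring n m, 1)).2 = g i
  have e1 : (baseColouring n m).1 i = false := by simp [baseColouring]; omega
  have e2 : (baseColouring n m).1 (i + 1) = true := by simp [baseColouring]; omega
  rw [pow_two, map_mul, Equiv.Perm.mul_apply, colourAction_gen hg h, stepPerm_snd g h,
    stepPerm_snd g h, stepPerm_fst g h]
  simp only [cocycle, exch_same, exch_next, e1, e2, numColour_exch_le _ _ le_rfl,
    baseColouring_num]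
  subst hi
  simp [twist, twistAux, lastTwist]

end Action

section TensorHelpers

variable {k : Type u} [Field k]
variable {A B A' B' : Type u} [AddCommGroup A] [Module k A] [AddCommGroup B] [Module k B]
  [AddCommGroup A'] [Module k A'] [AddCommGroup B'] [Module k B']

/-- `f ⊗ id` on `A ⊗ B ⊗ C`, with tensor products bracketed to the right.
(The map `id ⊗ g` is Mathlib's `LinearMap.lTensor`.) -/
def tensorId (C : Type u) [AddCommGroup C] [Module k C]
    (f : A ⊗[k] B →ₗ[k] A' ⊗[k] B') : A ⊗[k] (B ⊗[k] C) →ₗ[k] A' ⊗[k] (B' ⊗[k] C) :=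
  (TensorProduct.assoc k A' B' C).toLinearMap ∘ₗ f.rTensor C ∘ₗ
    (TensorProduct.assoc k A B C).symm.toLinearMap

/-- `f ⊗ id` as an isomorphism. -/
def tensorIdEquiv (C : Type u) [AddCommGroup C] [Module k C]
    (f : A ⊗[k] B ≃ₗ[k] A' ⊗[k] B') : A ⊗[k] (B ⊗[k] C) ≃ₗ[k] A' ⊗[k] (B' ⊗[k] C) :=
  (TensorProduct.assoc k A B C).symm ≪≫ₗ f.rTensor C ≪≫ₗ TensorProduct.assoc k A' B' C

end TensorHelpers

/-- The tensor product `Y b₁ ⊗ (Y b₂ ⊗ (⋯ ⊗ k))` along a word `[b₁, b₂, …]` in two letters. -/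
def wordTensorObj (k : Type u) [Field k] (Y : Bool → Type u) [∀ b, AddCommGroup (Y b)]
    [∀ b, Module k (Y b)] : List Bool → ModuleCat.{u} k
  | [] => ModuleCat.of k k
  | b :: l => ModuleCat.of k (Y b ⊗[k] wordTensorObj k Y l)

/-- The underlying vector space of `wordTensorObj`. -/
abbrev WordTensor (k : Type u) [Field k] (Y : Bool → Type u) [∀ b, AddCommGroup (Y b)]
    [∀ b, Module k (Y b)] (l : List Bool) : Type u := wordTensorObj k Y l

section WordTensor

variable {k : Type u} [Field k] {Y : Bool → Type u} [∀ b, AddCommGroup (Y b)]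
  [∀ b, Module k (Y b)]

/-- Concatenation of tensors. -/
def concat : ∀ l l' : List Bool,
    WordTensor k Y l ⊗[k] WordTensor k Y l' →ₗ[k] WordTensor k Y (l ++ l')
  | [], l' => (TensorProduct.lid k (WordTensor k Y l')).toLinearMap
  | b :: l, l' => ((concat l l').lTensor (Y b) ∘ₗ
      (TensorProduct.assoc k (Y b) (WordTensor k Y l) (WordTensor k Y l')).toLinearMap :)

/-- Exchange the letters in places `i` and `i + 1` (counted from `0`). -/
def swapAt : ℕ → List Bool → List Bool
  | 0, [] => []
  | 0, [a] => [a]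
  | 0, a :: b :: l => b :: a :: l
  | _ + 1, [] => []
  | i + 1, a :: l => a :: swapAt i l

/-- `id ⊗ R ⊗ id`, with `R` in the places `i` and `i + 1`. -/
def crossAt (R : ∀ a b, Y a ⊗[k] Y b →ₗ[k] Y b ⊗[k] Y a) :
    ∀ (i : ℕ) (l : List Bool), WordTensor k Y l →ₗ[k] WordTensor k Y (swapAt i l)
  | 0, [] => LinearMap.id
  | 0, [_] => LinearMap.id
  | 0, a :: b :: l => (tensorId (WordTensor k Y l) (R a b) :)
  | _ + 1, [] => LinearMap.id
  | i + 1, a :: l => ((crossAt R i l).lTensor (Y a) :)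

/-- `id ⊗ f ⊗ id`, with `f` in the places `i` and `i + 1`. -/
def opAt (f : ∀ a b, Y a ⊗[k] Y b ≃ₗ[k] Y a ⊗[k] Y b) :
    ∀ (_ : ℕ) (l : List Bool), WordTensor k Y l ≃ₗ[k] WordTensor k Y l
  | 0, [] => LinearEquiv.refl k _
  | 0, [_] => LinearEquiv.refl k _
  | 0, a :: b :: l => (tensorIdEquiv (WordTensor k Y l) (f a b) :)
  | _ + 1, [] => LinearEquiv.refl k _
  | i + 1, a :: l => ((opAt f i l).lTensor (Y a) :)

/-- The effect of the braid word `σ_{i₁} σ_{i₂} ⋯` on colours of strands (the last letter acts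
first). -/
def wordSwap : List ℕ → List Bool → List Bool
  | [], l => l
  | i :: w, l => swapAt i (wordSwap w l)

/-- The action of the braid word `σ_{i₁} σ_{i₂} ⋯` (the last letter acts first). -/
def wordCross (R : ∀ a b, Y a ⊗[k] Y b →ₗ[k] Y b ⊗[k] Y a) :
    ∀ (w : List ℕ) (l : List Bool), WordTensor k Y l →ₗ[k] WordTensor k Y (wordSwap w l)
  | [], _ => LinearMap.id
  | i :: w, l => crossAt R i (wordSwap w l) ∘ₗ wordCross R w l

end WordTensor

/-- The letter `false` stands for `V` and the letter `true` for `W`. -/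
abbrev Two (V W : Type u) : Bool → Type u
  | false => V
  | true => W

instance instTwoGroup (V W : Type u) [AddCommGroup V] [AddCommGroup W] :
    ∀ b, AddCommGroup (Two V W b)
  | false => inferInstanceAs (AddCommGroup V)
  | true => inferInstanceAs (AddCommGroup W)

instance instTwoModule (k V W : Type u) [Field k] [AddCommGroup V] [AddCommGroup W] [Module k V]
    [Module k W] : ∀ b, Module k (Two V W b)
  | false => inferInstanceAs (Module k V)
  | true => inferInstanceAs (Module k W)

/-- A mixed-braided vector space: braidings `σV`, `σW` on `V`, `W` and a mixed braiding `τ`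
of `V ⊗ W`. -/
structure MixedBraided (k V W : Type u) [Field k] [AddCommGroup V] [Module k V] [AddCommGroup W]
    [Module k W] where
  σV : V ⊗[k] V ≃ₗ[k] V ⊗[k] V
  σW : W ⊗[k] W ≃ₗ[k] W ⊗[k] W
  τ : V ⊗[k] W ≃ₗ[k] V ⊗[k] W
  braidV : tensorId V σV.toLinearMap ∘ₗ σV.toLinearMap.lTensor V ∘ₗ tensorId V σV.toLinearMap =
    σV.toLinearMap.lTensor V ∘ₗ tensorId V σV.toLinearMap ∘ₗ σV.toLinearMap.lTensor V
  braidW : tensorId W σW.toLinearMap ∘ₗ σW.toLinearMap.lTensor W ∘ₗ tensorId W σW.toLinearMap =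
    σW.toLinearMap.lTensor W ∘ₗ tensorId W σW.toLinearMap ∘ₗ σW.toLinearMap.lTensor W
  /-- on `V ⊗ V ⊗ W` -/
  mixedV : tensorId W σV.toLinearMap ∘ₗ τ.toLinearMap.lTensor V ∘ₗ
      tensorId W σV.toLinearMap ∘ₗ τ.toLinearMap.lTensor V =
    τ.toLinearMap.lTensor V ∘ₗ tensorId W σV.toLinearMap ∘ₗ
      τ.toLinearMap.lTensor V ∘ₗ tensorId W σV.toLinearMap
  /-- on `V ⊗ W ⊗ W` -/
  mixedW : tensorId W τ.toLinearMap ∘ₗ σW.toLinearMap.lTensor V ∘ₗ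
      tensorId W τ.toLinearMap ∘ₗ σW.toLinearMap.lTensor V =
    σW.toLinearMap.lTensor V ∘ₗ tensorId W τ.toLinearMap ∘ₗ
      σW.toLinearMap.lTensor V ∘ₗ tensorId W τ.toLinearMap
  /-- on `V ⊗ V ⊗ W ⊗ W` -/
  mixedVW : (tensorId (W ⊗[k] W) σV.toLinearMap ∘ₗ (tensorId W τ.toLinearMap).lTensor V ∘ₗ
      tensorId (W ⊗[k] W) σV.symm.toLinearMap) ∘ₗ
      ((σW.toLinearMap.lTensor V).lTensor V ∘ₗ (tensorId W τ.toLinearMap).lTensor V ∘ₗ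
      (σW.symm.toLinearMap.lTensor V).lTensor V) =
    ((σW.toLinearMap.lTensor V).lTensor V ∘ₗ (tensorId W τ.toLinearMap).lTensor V ∘ₗ
      (σW.symm.toLinearMap.lTensor V).lTensor V) ∘ₗ
      (tensorId (W ⊗[k] W) σV.toLinearMap ∘ₗ (tensorId W τ.toLinearMap).lTensor V ∘ₗ
      tensorId (W ⊗[k] W) σV.symm.toLinearMap)

section Tensor

variable {k : Type u} [Field k]
variable {A B C D : Type u} [AddCommGroup A] [Module k A] [AddCommGroup B] [Module k B]
  [AddCommGroup C] [Module k C] [AddCommGroup D] [Module k D]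

theorem coe_tensorIdEquiv {A' B' : Type u} [AddCommGroup A'] [Module k A'] [AddCommGroup B']
    [Module k B'] (f : A ⊗[k] B ≃ₗ[k] A' ⊗[k] B') :
    (tensorIdEquiv C f).toLinearMap = tensorId C f.toLinearMap := rfl

theorem tensorId_comp {A' B' A'' B'' : Type u} [AddCommGroup A'] [Module k A'] [AddCommGroup B']
    [Module k B'] [AddCommGroup A''] [Module k A''] [AddCommGroup B''] [Module k B'']
    (f : A' ⊗[k] B' →ₗ[k] A'' ⊗[k] B'') (g : A ⊗[k] B →ₗ[k] A' ⊗[k] B') :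
    tensorId C (f ∘ₗ g) = tensorId C f ∘ₗ tensorId C g := by
  ext x; simp [tensorId, LinearMap.rTensor_comp]

theorem tensorId_neg {A' B' : Type u} [AddCommGroup A'] [Module k A'] [AddCommGroup B']
    [Module k B'] (f : A ⊗[k] B →ₗ[k] A' ⊗[k] B') : tensorId C (-f) = -tensorId C f := by
  ext x; simp [tensorId, LinearMap.rTensor_neg]

/-- `f ⊗ id` compatibly with bracketing, on `A ⊗ B ⊗ (C ⊗ D)`. -/
theorem tensorId_tensorId (f : A ⊗[k] B →ₗ[k] A ⊗[k] B) :
    tensorId (C ⊗[k] D) f ∘ₗ ((TensorProduct.assoc k B C D).toLinearMap.lTensor A ∘ₗ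
      (TensorProduct.assoc k A (B ⊗[k] C) D).toLinearMap) =
    ((TensorProduct.assoc k B C D).toLinearMap.lTensor A ∘ₗ
      (TensorProduct.assoc k A (B ⊗[k] C) D).toLinearMap) ∘ₗ (tensorId C f).rTensor D := by
  ext a b c d
  simp only [tensorId, TensorProduct.AlgebraTensorModule.curry_apply, TensorProduct.curry_apply,
    LinearMap.coe_restrictScalars, LinearMap.comp_apply, LinearEquiv.coe_coe,
    TensorProduct.assoc_tmul, LinearMap.lTensor_tmul, LinearMap.rTensor_tmul,
    TensorProduct.assoc_symm_tmul]
  induction f (a ⊗ₜ b) using TensorProduct.induction_on with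
  | zero => simp
  | tmul x y => simp
  | add x y hx hy => simp only [TensorProduct.add_tmul, map_add, hx, hy]

theorem lTensor_tensorId (f : B ⊗[k] C →ₗ[k] B ⊗[k] C) :
    (tensorId D f).lTensor A ∘ₗ ((TensorProduct.assoc k B C D).toLinearMap.lTensor A ∘ₗ
      (TensorProduct.assoc k A (B ⊗[k] C) D).toLinearMap) =
    ((TensorProduct.assoc k B C D).toLinearMap.lTensor A ∘ₗ
      (TensorProduct.assoc k A (B ⊗[k] C) D).toLinearMap) ∘ₗ (f.lTensor A).rTensor D := by
  ext a b c d
  simp only [tensorId, TensorProduct.AlgebraTensorModule.curry_apply, TensorProduct.curry_apply,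
    LinearMap.coe_restrictScalars, LinearMap.comp_apply, LinearEquiv.coe_coe,
    TensorProduct.assoc_tmul, LinearMap.lTensor_tmul, LinearMap.rTensor_tmul,
    TensorProduct.assoc_symm_tmul]

/-- Transport of automorphisms along an isomorphism. -/
def conjHom (e : A ≃ₗ[k] B) : (A ≃ₗ[k] A) →* (B ≃ₗ[k] B) where
  toFun h := e.symm ≪≫ₗ h ≪≫ₗ e
  map_one' := by
    ext x
    change e (e.symm x) = x
    exact e.apply_symm_apply x
  map_mul' f g := by
    ext x
    change e (f (g (e.symm x))) = e (f (e.symm (e (g (e.symm x)))))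
    rw [e.symm_apply_apply]

/-- `id ⊗ h` as a homomorphism of automorphism groups. -/
def idTensorHom (A : Type u) [AddCommGroup A] [Module k A] :
    (B ≃ₗ[k] B) →* ((A ⊗[k] B) ≃ₗ[k] (A ⊗[k] B)) where
  toFun h := h.lTensor A
  map_one' := by
    apply LinearEquiv.toLinearMap_injective
    exact LinearMap.lTensor_id _ _
  map_mul' f g := by
    apply LinearEquiv.toLinearMap_injective
    exact LinearMap.lTensor_comp A f.toLinearMap g.toLinearMap

/-- `h ⊗ id` as a homomorphism of automorphism groups. -/
def tensorIdHom (D : Type u) [AddCommGroup D] [Module k D] :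
    (A ≃ₗ[k] A) →* ((A ⊗[k] D) ≃ₗ[k] (A ⊗[k] D)) where
  toFun h := h.rTensor D
  map_one' := by
    apply LinearEquiv.toLinearMap_injective
    exact LinearMap.rTensor_id _ _
  map_mul' f g := by
    apply LinearEquiv.toLinearMap_injective
    exact LinearMap.rTensor_comp D f.toLinearMap g.toLinearMap

/-- The action of an automorphism of `A ⊗ B ⊗ C` on `A ⊗ B ⊗ C ⊗ D`. -/
def extend3 (D : Type u) [AddCommGroup D] [Module k D] :
    ((A ⊗[k] (B ⊗[k] C)) ≃ₗ[k] (A ⊗[k] (B ⊗[k] C))) →*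
      ((A ⊗[k] (B ⊗[k] (C ⊗[k] D))) ≃ₗ[k] (A ⊗[k] (B ⊗[k] (C ⊗[k] D)))) :=
  (conjHom (TensorProduct.assoc k A (B ⊗[k] C) D ≪≫ₗ
    (TensorProduct.assoc k B C D).lTensor A)).comp (tensorIdHom D)

theorem conjHom_eq {e : A ≃ₗ[k] B} {f : A ≃ₗ[k] A} {g : B ≃ₗ[k] B}
    (h : g.toLinearMap ∘ₗ e.toLinearMap = e.toLinearMap ∘ₗ f.toLinearMap) :
    conjHom e f = g := by
  ext x
  have := LinearMap.congr_fun h (e.symm x)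
  refine this.symm.trans ?_
  change g (e (e.symm x)) = g x
  rw [e.apply_symm_apply]

theorem extend3_left (f : A ⊗[k] B ≃ₗ[k] A ⊗[k] B) :
    extend3 D (tensorIdEquiv C f) = tensorIdEquiv (C ⊗[k] D) f :=
  conjHom_eq (tensorId_tensorId (C := C) (D := D) f.toLinearMap)

theorem extend3_right (f : B ⊗[k] C ≃ₗ[k] B ⊗[k] C) :
    extend3 D (f.lTensor A) = (tensorIdEquiv D f).lTensor A :=
  conjHom_eq (lTensor_tensorId (A := A) (D := D) f.toLinearMap)

/-- The action of an automorphism of `A ⊗ B ⊗ C ⊗ D` on `A ⊗ B ⊗ C ⊗ D ⊗ T`. -/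
def extend4 (T : Type u) [AddCommGroup T] [Module k T] :
    ((A ⊗[k] (B ⊗[k] (C ⊗[k] D))) ≃ₗ[k] (A ⊗[k] (B ⊗[k] (C ⊗[k] D)))) →*
      ((A ⊗[k] (B ⊗[k] (C ⊗[k] (D ⊗[k] T)))) ≃ₗ[k] (A ⊗[k] (B ⊗[k] (C ⊗[k] (D ⊗[k] T))))) :=
  (conjHom (((TensorProduct.assoc k C D T).lTensor B).lTensor A)).comp
    (extend3 (A := A) (B := B) (C := C ⊗[k] D) T)

theorem conjHom_lTensor (e : B ≃ₗ[k] C) (f : B ≃ₗ[k] B) :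
    conjHom (e.lTensor A) (f.lTensor A) = (conjHom e f).lTensor A := by
  apply conjHom_eq
  ext a b
  simp [conjHom]

variable {T : Type u} [AddCommGroup T] [Module k T]

theorem extend4_left (f : A ⊗[k] B ≃ₗ[k] A ⊗[k] B) :
    extend4 T (tensorIdEquiv (C ⊗[k] D) f) = tensorIdEquiv (C ⊗[k] (D ⊗[k] T)) f := by
  rw [extend4, MonoidHom.comp_apply, extend3_left]
  apply conjHom_eq
  ext a b x
  simp only [coe_tensorIdEquiv, tensorId, TensorProduct.AlgebraTensorModule.curry_apply,
    TensorProduct.curry_apply, LinearMap.coe_restrictScalars, LinearMap.comp_apply,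
    LinearEquiv.coe_coe, LinearEquiv.lTensor_tmul, TensorProduct.assoc_symm_tmul,
    LinearMap.rTensor_tmul]
  induction f (a ⊗ₜ b) using TensorProduct.induction_on with
  | zero => simp
  | tmul x y => simp
  | add x y hx hy => simp only [TensorProduct.add_tmul, map_add, hx, hy]

theorem extend4_middle (f : B ⊗[k] C ≃ₗ[k] B ⊗[k] C) :
    extend4 T ((tensorIdEquiv D f).lTensor A) = (tensorIdEquiv (D ⊗[k] T) f).lTensor A := by
  rw [extend4, MonoidHom.comp_apply, extend3_right, conjHom_lTensor, ← extend3_left]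
  rfl

theorem extend4_right (f : C ⊗[k] D ≃ₗ[k] C ⊗[k] D) :
    extend4 T ((f.lTensor B).lTensor A) = ((tensorIdEquiv T f).lTensor B).lTensor A := by
  rw [extend4, MonoidHom.comp_apply, extend3_right, conjHom_lTensor, ← extend3_right]
  rfl

end Tensor

section Representation

variable {k : Type u} [Field k]

theorem tensorIdEquiv_comm {A B T : Type u} [AddCommGroup A] [Module k A] [AddCommGroup B]
    [Module k B] [AddCommGroup T] [Module k T] (f : A ⊗[k] B ≃ₗ[k] A ⊗[k] B) (h : T ≃ₗ[k] T) :
    tensorIdEquiv T f * (h.lTensor B).lTensor A = (h.lTensor B).lTensor A * tensorIdEquiv T f := by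
  apply LinearEquiv.toLinearMap_injective
  change tensorId T f.toLinearMap ∘ₗ ((h.toLinearMap.lTensor B).lTensor A) =
    ((h.toLinearMap.lTensor B).lTensor A) ∘ₗ tensorId T f.toLinearMap
  ext x y z
  simp only [tensorId, TensorProduct.AlgebraTensorModule.curry_apply,
    TensorProduct.curry_apply, LinearMap.coe_restrictScalars,
    LinearMap.comp_apply, LinearEquiv.coe_coe, LinearMap.lTensor_tmul,
    TensorProduct.assoc_symm_tmul, LinearMap.rTensor_tmul]
  induction f (x ⊗ₜ y) using TensorProduct.induction_on with
  | zero => simp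
  | tmul x y => simp
  | add x y hx hy => simp only [TensorProduct.add_tmul, map_add, hx, hy]

section Words

variable {Y : Bool → Type u} [∀ b, AddCommGroup (Y b)] [∀ b, Module k (Y b)]
  (f : ∀ a b, Y a ⊗[k] Y b ≃ₗ[k] Y a ⊗[k] Y b)

theorem opAt_comm : ∀ (i j : ℕ) (l : List Bool), i + 1 < j →
      opAt f i l * opAt f j l = opAt f j l * opAt f i l := by
  intro i
  induction i with
  | zero =>
    rintro (_ | _ | j) l h
    · omega
    · omega
    · rcases l with _ | ⟨a, _ | ⟨b, l⟩⟩
      · rfl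
      · rfl
      · exact tensorIdEquiv_comm (f a b) (opAt f j l)
  | succ i ih =>
    rintro (_ | j) l h
    · omega
    · rcases l with _ | ⟨a, l⟩
      · rfl
      · exact (map_mul (idTensorHom (Y a)) _ _).symm.trans
          ((congrArg (idTensorHom (Y a)) (ih j l (by omega))).trans (map_mul _ _ _))

/-- The action of automorphisms on the factors from place `i` on. -/
def dropHom (k : Type u) [Field k] (Y : Bool → Type u) [∀ b, AddCommGroup (Y b)]
    [∀ b, Module k (Y b)] : ∀ (i : ℕ) (l : List Bool),
    (WordTensor k Y (l.drop i) ≃ₗ[k] WordTensor k Y (l.drop i)) →*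
      (WordTensor k Y l ≃ₗ[k] WordTensor k Y l)
  | 0, _ => MonoidHom.id _
  | _ + 1, [] => MonoidHom.id _
  | i + 1, a :: l => ((idTensorHom (Y a)).comp (dropHom k Y i l) :)

theorem dropHom_opAt : ∀ (i j : ℕ) (l : List Bool),
    dropHom k Y i l (opAt f j (l.drop i)) = opAt f (i + j) l := by
  intro i
  induction i with
  | zero => intro j l; rw [zero_add]; rfl
  | succ i ih =>
    rintro j (_ | ⟨a, l⟩)
    · rw [show i + 1 + j = i + j + 1 by omega]
      cases j <;> rfl
    · rw [show i + 1 + j = i + j + 1 by omega]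
      exact congrArg (idTensorHom (Y a)) (ih j l)

theorem opAt_braid (i : ℕ) (l l' : List Bool) (a : Bool) (h : l.drop i = a :: a :: a :: l')
    (hf : tensorIdEquiv (Y a) (f a a) * (f a a).lTensor (Y a) * tensorIdEquiv (Y a) (f a a) =
      (f a a).lTensor (Y a) * tensorIdEquiv (Y a) (f a a) * (f a a).lTensor (Y a)) :
    opAt f i l * opAt f (i + 1) l * opAt f i l =
      opAt f (i + 1) l * opAt f i l * opAt f (i + 1) l := by
  have key : opAt f 0 (l.drop i) * opAt f 1 (l.drop i) * opAt f 0 (l.drop i) =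
      opAt f 1 (l.drop i) * opAt f 0 (l.drop i) * opAt f 1 (l.drop i) := by
    rw [h]
    have := congrArg (extend3 (WordTensor k Y l')) hf
    simp only [map_mul, extend3_left, extend3_right] at this
    exact this
  have := congrArg (dropHom k Y i l) key
  simp only [map_mul, dropHom_opAt] at this
  exact this

theorem opAt_four (i : ℕ) (l l' : List Bool) (a b c : Bool) (h : l.drop i = a :: b :: c :: l')
    (hf : tensorIdEquiv (Y c) (f a b) * (f b c).lTensor (Y a) * tensorIdEquiv (Y c) (f a b) *
        (f b c).lTensor (Y a) =
      (f b c).lTensor (Y a) * tensorIdEquiv (Y c) (f a b) * (f b c).lTensor (Y a) *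
        tensorIdEquiv (Y c) (f a b)) :
    opAt f i l * opAt f (i + 1) l * opAt f i l * opAt f (i + 1) l =
      opAt f (i + 1) l * opAt f i l * opAt f (i + 1) l * opAt f i l := by
  have key : opAt f 0 (l.drop i) * opAt f 1 (l.drop i) * opAt f 0 (l.drop i) *
        opAt f 1 (l.drop i) =
      opAt f 1 (l.drop i) * opAt f 0 (l.drop i) * opAt f 1 (l.drop i) * opAt f 0 (l.drop i) := by
    rw [h]
    have := congrArg (extend3 (WordTensor k Y l')) hf
    simp only [map_mul, extend3_left, extend3_right] at this
    exact this
  have := congrArg (dropHom k Y i l) key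
  simp only [map_mul, dropHom_opAt] at this
  exact this

theorem opAt_mixed (i : ℕ) (l l' : List Bool) (a b c d : Bool)
    (h : l.drop i = a :: b :: c :: d :: l')
    (hf : Commute (tensorIdEquiv (Y c ⊗[k] Y d) (f a b) *
        (tensorIdEquiv (Y d) (f b c)).lTensor (Y a) *
        (tensorIdEquiv (Y c ⊗[k] Y d) (f a b))⁻¹)
      (((f c d).lTensor (Y b)).lTensor (Y a) * (tensorIdEquiv (Y d) (f b c)).lTensor (Y a) *
        (((f c d).lTensor (Y b)).lTensor (Y a))⁻¹)) :
    Commute (opAt f i l * opAt f (i + 1) l * (opAt f i l)⁻¹)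
      (opAt f (i + 2) l * opAt f (i + 1) l * (opAt f (i + 2) l)⁻¹) := by
  have key : Commute (opAt f 0 (l.drop i) * opAt f 1 (l.drop i) * (opAt f 0 (l.drop i))⁻¹)
      (opAt f 2 (l.drop i) * opAt f 1 (l.drop i) * (opAt f 2 (l.drop i))⁻¹) := by
    rw [h]
    have := hf.map (extend4 (WordTensor k Y l'))
    simp only [map_mul, map_inv, extend4_left, extend4_middle, extend4_right] at this
    exact this
  have := key.map (dropHom k Y i l)
  simp only [map_mul, map_inv, dropHom_opAt] at this
  exact this

end Words

variable {V W : Type u} [AddCommGroup V] [Module k V] [AddCommGroup W] [Module k W]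

/-- The automorphisms `σV`, `τ`, `σW` by which the generators of the mixed braid group act
(on `W ⊗ V`, which does not occur, the identity). -/
def MixedBraided.op (B : MixedBraided k V W) :
    ∀ a b, Two V W a ⊗[k] Two V W b ≃ₗ[k] Two V W a ⊗[k] Two V W b
  | false, false => B.σV
  | false, true => B.τ
  | true, true => B.σW
  | true, false => LinearEquiv.refl k _

/-- The word `V ⋯ V W ⋯ W` with `n` letters `V` and `m` letters `W`. -/
def baseWord (n m : ℕ) : List Bool := List.replicate n false ++ List.replicate m true

/-- The vector space `V^{⊗ n} ⊗ W^{⊗ m}`. -/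
abbrev BaseTensor (k V W : Type u) [Field k] [AddCommGroup V] [Module k V] [AddCommGroup W]
    [Module k W] (n m : ℕ) : Type u := WordTensor k (Two V W) (baseWord n m)

theorem baseWord_drop (n m i : ℕ) :
    (baseWord n m).drop i = baseWord (n - i) (m - (i - n)) := by
  simp [baseWord, List.drop_append]

theorem MixedBraided.relations (B : MixedBraided k V W) (n m : ℕ) :
    MixedBraidRelations n m (fun i => opAt B.op i (baseWord n m)) where
  comm i j h _ := opAt_comm _ i j _ h
  braid i h h' := by
    rcases h' with h' | h'
    · refine opAt_braid _ i _ (baseWord (n - i - 3) m) false ?_ ?_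
      · rw [baseWord_drop]
        obtain ⟨j, rfl⟩ : ∃ j, n = i + 3 + j := ⟨n - i - 3, by omega⟩
        rw [show i + 3 + j - i = j + 1 + 1 + 1 by omega, show m - (i - (i + 3 + j)) = m by omega]
        rfl
      · exact LinearEquiv.toLinearMap_injective B.braidV
    · refine opAt_braid _ i _ (baseWord 0 (m - (i - n) - 3)) true ?_ ?_
      · rw [baseWord_drop, show n - i = 0 by omega]
        obtain ⟨j, hj⟩ : ∃ j, m - (i - n) = j + 1 + 1 + 1 := ⟨m - (i - n) - 3, by omega⟩
        rw [hj]
        rfl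
      · exact LinearEquiv.toLinearMap_injective B.braidW
  left i h h' := by
    refine opAt_four _ i _ (baseWord 0 (m - 1)) false false true ?_ ?_
    · subst h
      obtain ⟨j, rfl⟩ : ∃ j, m = j + 1 := ⟨m - 1, by omega⟩
      rw [baseWord_drop, show i + 2 - i = 2 by omega, show j + 1 - (i - (i + 2)) = j + 1 by omega]
      rfl
    · exact LinearEquiv.toLinearMap_injective B.mixedV
  right i h h' := by
    refine opAt_four _ i _ (baseWord 0 (m - 2)) false true true ?_ ?_
    · subst h
      obtain ⟨j, rfl⟩ : ∃ j, m = j + 1 + 1 := ⟨m - 2, by omega⟩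
      rw [baseWord_drop, show i + 1 - i = 1 by omega,
        show j + 1 + 1 - (i - (i + 1)) = j + 1 + 1 by omega]
      rfl
    · exact LinearEquiv.toLinearMap_injective B.mixedW
  mixed i h h' := by
    refine opAt_mixed _ i _ (baseWord 0 (m - 2)) false false true true ?_ ?_
    · subst h
      obtain ⟨j, rfl⟩ : ∃ j, m = j + 1 + 1 := ⟨m - 2, by omega⟩
      rw [baseWord_drop, show i + 2 - i = 2 by omega,
        show j + 1 + 1 - (i - (i + 2)) = j + 1 + 1 by omega]
      rfl
    · exact LinearEquiv.toLinearMap_injective B.mixedVW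

/-- The representation of the mixed braid group `B_{n,m}` on `V^{⊗ n} ⊗ W^{⊗ m}`. -/
def MixedBraided.rep (B : MixedBraided k V W) (n m : ℕ) :
    Representation k (mixedBraidGroup n m) (BaseTensor k V W n m) :=
  (LinearEquiv.automorphismGroup.toLinearMapMonoidHom (R := k)
    (M := BaseTensor k V W n m)).comp (mixedBraidLift (B.relations n m))

/-- `σ_i` acts by `σV` or `σW` in the places `i` and `i + 1`, if they have the same colour. -/
theorem MixedBraided.rep_gen (B : MixedBraided k V W) {n m i : ℕ} (h : i + 1 < n + m)
    (hi : i + 1 ≠ n) : B.rep n m ⟨braidGen (n + m) i, braidGen_mem h hi⟩ =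
      (opAt B.op i (baseWord n m)).toLinearMap :=
  congrArg LinearEquiv.toLinearMap (mixedBraidLift_gen (B.relations n m) h hi)

/-- `τ_n = σ_{n-1}²` acts by `τ` in the places `n - 1` and `n`. -/
theorem MixedBraided.rep_twist (B : MixedBraided k V W) {n m i : ℕ} (h : i + 1 < n + m)
    (hi : i + 1 = n) : B.rep n m ⟨braidGen (n + m) i ^ 2, braidGen_sq_mem h⟩ =
      (opAt B.op i (baseWord n m)).toLinearMap :=
  congrArg LinearEquiv.toLinearMap (mixedBraidLift_twist (B.relations n m) h hi)

end Representation

section Separable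

variable {k V W : Type u} [Field k] [AddCommGroup V] [Module k V] [AddCommGroup W] [Module k W]

/-- `φ` is a separated braiding of the (left-braided) vector space underlying `B`. -/
structure MixedBraided.IsSeparatedBraiding (B : MixedBraided k V W)
    (φ : V ⊗[k] W ≃ₗ[k] W ⊗[k] V) : Prop where
  /-- on `V ⊗ V ⊗ W` -/
  braid : B.σV.toLinearMap.lTensor W ∘ₗ tensorId V φ.toLinearMap ∘ₗ φ.toLinearMap.lTensor V =
    tensorId V φ.toLinearMap ∘ₗ φ.toLinearMap.lTensor V ∘ₗ tensorId W B.σV.toLinearMap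
  /-- on `V ⊗ V ⊗ W` -/
  twist : tensorId V B.τ.toLinearMap ∘ₗ φ.toLinearMap.lTensor V =
    φ.toLinearMap.lTensor V ∘ₗ tensorId W B.σV.toLinearMap ∘ₗ B.τ.toLinearMap.lTensor V ∘ₗ
      tensorId W B.σV.symm.toLinearMap

/-- The compatibility equation
`(id ⊗ τ) (φ ⊗ id) = (φ ⊗ id) (id ⊗ σW) (τ ⊗ id) (id ⊗ σW⁻¹)` on `V ⊗ W ⊗ W`. -/
def MixedBraided.Compatible (B : MixedBraided k V W) (φ : V ⊗[k] W ≃ₗ[k] W ⊗[k] V) : Prop :=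
  B.τ.toLinearMap.lTensor W ∘ₗ tensorId W φ.toLinearMap =
    tensorId W φ.toLinearMap ∘ₗ B.σW.toLinearMap.lTensor V ∘ₗ tensorId W B.τ.toLinearMap ∘ₗ
      B.σW.symm.toLinearMap.lTensor V

/-- `-f` as an isomorphism. -/
def negEquiv {A B : Type u} [AddCommGroup A] [Module k A] [AddCommGroup B] [Module k B]
    (f : A ≃ₗ[k] B) : A ≃ₗ[k] B := f ≪≫ₗ LinearEquiv.neg k

theorem coe_negEquiv {A B : Type u} [AddCommGroup A] [Module k A] [AddCommGroup B] [Module k B]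
    (f : A ≃ₗ[k] B) : (negEquiv f).toLinearMap = -f.toLinearMap := by
  ext x; simp [negEquiv]

theorem coe_negEquiv_symm {A B : Type u} [AddCommGroup A] [Module k A] [AddCommGroup B]
    [Module k B] (f : A ≃ₗ[k] B) : (negEquiv f).symm.toLinearMap = -f.symm.toLinearMap := by
  ext x; simp [negEquiv]

/-- The twist by the sign: `(V_ε, W_ε, τ)` with the braidings `-σV` and `-σW`. -/
def MixedBraided.signTwist (B : MixedBraided k V W) : MixedBraided k V W where
  σV := negEquiv B.σV
  σW := negEquiv B.σW
  τ := B.τ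
  braidV := by
    simp only [coe_negEquiv, tensorId_neg, LinearMap.lTensor_neg, LinearMap.neg_comp,
      LinearMap.comp_neg, B.braidV]
  braidW := by
    simp only [coe_negEquiv, tensorId_neg, LinearMap.lTensor_neg, LinearMap.neg_comp,
      LinearMap.comp_neg, B.braidW]
  mixedV := by
    simp only [coe_negEquiv, tensorId_neg, LinearMap.neg_comp, LinearMap.comp_neg, B.mixedV]
  mixedW := by
    simp only [coe_negEquiv, LinearMap.lTensor_neg, LinearMap.neg_comp, LinearMap.comp_neg,
      B.mixedW]
  mixedVW := by
    simp only [coe_negEquiv, coe_negEquiv_symm, tensorId_neg, LinearMap.lTensor_neg,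
      LinearMap.neg_comp, LinearMap.comp_neg, B.mixedVW]

end Separable

section Shuffles

/-- The `(p,q)`-shuffles: permutations preserving the order on the first `p` and on the last `q`
elements. -/
def shuffles (p q : ℕ) : Finset (Equiv.Perm (Fin (p + q))) :=
  Finset.univ.filter fun γ =>
    (∀ x y : Fin (p + q), x < y → (y : ℕ) < p → γ x < γ y) ∧
    (∀ x y : Fin (p + q), x < y → p ≤ (x : ℕ) → γ x < γ y)

/-- The `((p,h),q,j)`-shuffles: those that send `p + j` to `h + j` (counted from `0`). -/
def shufflesLeft (p h q j : ℕ) : Finset (Equiv.Perm (Fin (p + q))) :=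
  (shuffles p q).filter fun γ => ∀ x : Fin (p + q), (x : ℕ) = p + j → (γ x : ℕ) = h + j

/-- The `(p,(q,h),j)`-shuffles: those that send `j` to `j + h` (counted from `0`). -/
def shufflesRight (p q h j : ℕ) : Finset (Equiv.Perm (Fin (p + q))) :=
  (shuffles p q).filter fun γ => ∀ x : Fin (p + q), (x : ℕ) = j → (γ x : ℕ) = j + h

/-- The lift of a `(p,q)`-shuffle to a (positive) braid word, which moves the right `q` strands in
front of the left `p` strands. -/
def shuffleWord (p q : ℕ) (γ : Equiv.Perm (Fin (p + q))) : List ℕ :=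
  liftWord p (List.ofFn fun x : Fin q => (γ (Fin.natAdd p x) : ℕ))

end Shuffles

section Algebra

variable {k V W : Type u} [Field k] [AddCommGroup V] [Module k V] [AddCommGroup W] [Module k W]

/-- `Graded k V W false = ⨁_{n ≥ 0} V^{⊗ n}` (the words without letter `W`) and
`Graded k V W true = ⨁_{j, r ≥ 0} V^{⊗ j} ⊗ W ⊗ V^{⊗ r}` (the words with one letter `W`): the
underlying vector spaces of the quantum shuffle algebra `𝔄` and of the bimodule `𝔐`. -/
abbrev Graded (k V W : Type u) [Field k] [AddCommGroup V] [Module k V] [AddCommGroup W]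
    [Module k W] (b : Bool) : Type u :=
  ⨁ c : {c : List Bool // c.count true = b.toNat}, WordTensor k (Two V W) c.1

/-- The part of degree `d`. -/
def gradedPart (k V W : Type u) [Field k] [AddCommGroup V] [Module k V] [AddCommGroup W]
    [Module k W] (b : Bool) (d : ℕ) : Submodule k (Graded k V W b) :=
  Submodule.span k {x | ∃ c y, c.1.length = d ∧
    x = DirectSum.lof k {c : List Bool // c.count true = b.toNat}
      (fun c => WordTensor k (Two V W) c.1) c y}

/-- The action of a crossing: `σV` on `V ⊗ V`, `φ` on `V ⊗ W` and `τ φ⁻¹` on `W ⊗ V`. (Two letters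
`W` never cross below.) -/
def MixedBraided.crossing (B : MixedBraided k V W) (φ : V ⊗[k] W ≃ₗ[k] W ⊗[k] V) :
    ∀ a b, Two V W a ⊗[k] Two V W b →ₗ[k] Two V W b ⊗[k] Two V W a
  | false, false => B.σV.toLinearMap
  | false, true => φ.toLinearMap
  | true, false => B.τ.toLinearMap ∘ₗ φ.symm.toLinearMap
  | true, true => B.σW.toLinearMap

theorem swapAt_perm : ∀ (i : ℕ) (l : List Bool), (swapAt i l).Perm l
  | 0, [] => List.Perm.refl _
  | 0, [_] => List.Perm.refl _
  | 0, _ :: _ :: _ => List.Perm.swap _ _ _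
  | _ + 1, [] => List.Perm.refl _
  | i + 1, a :: l => (swapAt_perm i l).cons a

theorem wordSwap_perm (w : List ℕ) (l : List Bool) : (wordSwap w l).Perm l := by
  induction w with
  | nil => exact List.Perm.refl _
  | cons i w ih => exact (swapAt_perm _ _).trans ih

theorem wordSwap_count {a b : Bool} (h : (a && b) = false) (w : List ℕ)
    {c c' : List Bool} (hc : c.count true = a.toNat) (hc' : c'.count true = b.toNat) :
    (wordSwap w (c ++ c')).count true = (a || b).toNat := by
  rw [(wordSwap_perm w _).count_eq, List.count_append, hc, hc']
  revert h; cases a <;> cases b <;> simp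

/-- The quantum shuffle product: the product of `𝔄` if `a = b = false`, and the left and right
multiplication of `𝔄` on `𝔐` if one of `a`, `b` is `true`:
`x ⋆ y = ∑ γ̃ (x | y)` over all `(p,q)`-shuffles `γ`, for `x`, `y` of degrees `p`, `q`. -/
def MixedBraided.shuffleMul (B : MixedBraided k V W) (φ : V ⊗[k] W ≃ₗ[k] W ⊗[k] V) (a b : Bool)
    (h : (a && b) = false) :
    Graded k V W a →ₗ[k] Graded k V W b →ₗ[k] Graded k V W (a || b) :=
  DirectSum.toModule k _ _ fun c => LinearMap.flip (DirectSum.toModule k _ _ fun c' =>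
    LinearMap.flip (∑ γ ∈ shuffles c.1.length c'.1.length, TensorProduct.curry
      (DirectSum.lof k {c : List Bool // c.count true = (a || b).toNat}
          (fun c => WordTensor k (Two V W) c.1)
          ⟨wordSwap (shuffleWord _ _ γ) (c.1 ++ c'.1), wordSwap_count h _ c.2 c'.2⟩ ∘ₗ
        wordCross (B.crossing φ) (shuffleWord _ _ γ) (c.1 ++ c'.1) ∘ₗ concat c.1 c'.1)))

theorem MixedBraided.shuffleMul_lof (B : MixedBraided k V W) (φ : V ⊗[k] W ≃ₗ[k] W ⊗[k] V)
    {a b : Bool} (h : (a && b) = false) (c : {c : List Bool // c.count true = a.toNat})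
    (c' : {c : List Bool // c.count true = b.toNat}) (x : WordTensor k (Two V W) c.1)
    (y : WordTensor k (Two V W) c'.1) :
    B.shuffleMul φ a b h (DirectSum.lof k _ (fun c => WordTensor k (Two V W) c.1) c x)
      (DirectSum.lof k _ (fun c => WordTensor k (Two V W) c.1) c' y) =
      ∑ γ ∈ shuffles c.1.length c'.1.length,
        DirectSum.lof k {c : List Bool // c.count true = (a || b).toNat}
          (fun c => WordTensor k (Two V W) c.1)
          ⟨wordSwap (shuffleWord _ _ γ) (c.1 ++ c'.1), wordSwap_count h _ c.2 c'.2⟩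
          (wordCross (B.crossing φ) (shuffleWord _ _ γ) (c.1 ++ c'.1)
            (concat c.1 c'.1 (x ⊗ₜ y))) := by
  simp only [shuffleMul, DirectSum.toModule_lof, LinearMap.flip_apply, LinearMap.sum_apply,
    TensorProduct.curry_apply, LinearMap.comp_apply]

theorem MixedBraided.shuffleMul_mem (B : MixedBraided k V W) (φ : V ⊗[k] W ≃ₗ[k] W ⊗[k] V)
    {a b : Bool} (h : (a && b) = false) {d e : ℕ} {x : Graded k V W a} {y : Graded k V W b}
    (hx : x ∈ gradedPart k V W a d) (hy : y ∈ gradedPart k V W b e) :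
    B.shuffleMul φ a b h x y ∈ gradedPart k V W (a || b) (d + e) := by
  have := Submodule.apply_mem_map₂ (B.shuffleMul φ a b h) hx hy
  rw [gradedPart, gradedPart, Submodule.map₂_span_span] at this
  refine Submodule.span_le.2 ?_ this
  rintro _ ⟨_, ⟨c, x, hc, rfl⟩, _, ⟨c', y, hc', rfl⟩, rfl⟩
  simp only [SetLike.mem_coe]
  rw [B.shuffleMul_lof φ h]
  refine Submodule.sum_mem _ fun γ _ => Submodule.subset_span ⟨_, _, ?_, rfl⟩
  simp only [(wordSwap_perm _ _).length_eq, List.length_append, hc, hc']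

/-- The augmentation ideal `𝔍` of `𝔄`: the elements of positive degree. -/
def augmentationIdeal (k V W : Type u) [Field k] [AddCommGroup V] [Module k V] [AddCommGroup W]
    [Module k W] : Submodule k (Graded k V W false) :=
  ⨆ d : ℕ, gradedPart k V W false (d + 1)

theorem MixedBraided.mul_mem_augmentationIdeal (B : MixedBraided k V W)
    (φ : V ⊗[k] W ≃ₗ[k] W ⊗[k] V) {x y : Graded k V W false}
    (hx : x ∈ augmentationIdeal k V W) (hy : y ∈ augmentationIdeal k V W) :
    B.shuffleMul φ false false rfl x y ∈ augmentationIdeal k V W := by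
  have := Submodule.apply_mem_map₂ (B.shuffleMul φ false false rfl) hx hy
  rw [augmentationIdeal, Submodule.map₂_iSup_left] at this
  simp only [Submodule.map₂_iSup_right] at this
  refine (iSup_le fun d => iSup_le fun e => ?_ : (_ : Submodule k (Graded k V W false)) ≤
    augmentationIdeal k V W) this
  refine Submodule.map₂_le.2 fun x hx y hy => ?_
  have h := B.shuffleMul_mem φ (a := false) (b := false) rfl hx hy
  exact Submodule.mem_iSup_of_mem (d + e + 1) (by
    rwa [show d + 1 + (e + 1) = d + e + 1 + 1 by omega] at h)

end Algebra

section ColumnComplex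

variable {k : Type u} [Field k] {Y : Bool → Type u} [∀ b, AddCommGroup (Y b)]
  [∀ b, Module k (Y b)]

/-- Merge the letters in the places `i` and `i + 1`. -/
def mergeAt : ℕ → List Bool → List Bool
  | 0, [] => []
  | 0, [a] => [a]
  | 0, a :: b :: l => (a || b) :: l
  | _ + 1, [] => []
  | i + 1, a :: l => a :: mergeAt i l

/-- Multiply the factors in the places `i` and `i + 1`. -/
def mulAt (μ : ∀ a b, Y a →ₗ[k] Y b →ₗ[k] Y (a || b)) :
    ∀ (i : ℕ) (l : List Bool), WordTensor k Y l →ₗ[k] WordTensor k Y (mergeAt i l)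
  | 0, [] => LinearMap.id
  | 0, [_] => LinearMap.id
  | 0, a :: b :: l => ((TensorProduct.lift (μ a b)).rTensor (WordTensor k Y l) ∘ₗ
      (TensorProduct.assoc k (Y a) (Y b) (WordTensor k Y l)).symm.toLinearMap :)
  | _ + 1, [] => LinearMap.id
  | i + 1, a :: l => ((mulAt μ i l).lTensor (Y a) :)

/-- The arrangements of `q` tensor factors, `m` of which (the letters `true`) are bimodules. -/
abbrev Arrangement (m : ℕ) (q : ℤ) : Type :=
  {l : List Bool // (l.length : ℤ) = q ∧ l.count true = m}

/-- `F_q((M, …, M), A)` for `m` copies of `M = Y true` and for `A = Y false`: the direct sum of the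
tensor products of `q` factors of which `m` are `M` and all others are `A`. -/
abbrev ColumnComplex (k : Type u) [Field k] (Y : Bool → Type u) [∀ b, AddCommGroup (Y b)]
    [∀ b, Module k (Y b)] (m : ℕ) (q : ℤ) : Type u :=
  ⨁ l : Arrangement m q, WordTensor k Y l.1

/-- The inclusion of a summand (`0` if there is no such summand). -/
def columnIncl (k : Type u) [Field k] (Y : Bool → Type u) [∀ b, AddCommGroup (Y b)]
    [∀ b, Module k (Y b)] (m : ℕ) (q : ℤ) (l : List Bool) :
    WordTensor k Y l →ₗ[k] ColumnComplex k Y m q :=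
  if h : (l.length : ℤ) = q ∧ l.count true = m then
    DirectSum.lof k (Arrangement m q) (fun l => WordTensor k Y l.1) ⟨l, h⟩ else 0

/-- The differential `d = ∑ (-1)^i d_i` (`i` counted from `0`) from degree `q` to degree `s`
(to be used for `s = q - 1`; otherwise it is `0`), where `d_i` multiplies the factors `i` and
`i + 1`, with the product of two bimodule elements taken to be `0`. -/
def columnD (μ : ∀ a b, Y a →ₗ[k] Y b →ₗ[k] Y (a || b)) (m : ℕ) (q s : ℤ) :
    ColumnComplex k Y m q →ₗ[k] ColumnComplex k Y m s :=
  DirectSum.toModule k _ _ fun l => ∑ i ∈ Finset.range (l.1.length - 1),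
    (-1 : k) ^ i • (columnIncl k Y m s (mergeAt i l.1) ∘ₗ mulAt μ i l.1)

/-- Pure tensors of homogeneous elements, of total degree `N`. -/
def IsHomogeneousPure (g : ∀ b, ℕ → Submodule k (Y b)) :
    ∀ (l : List Bool), ℕ → WordTensor k Y l → Prop
  | [], N, _ => N = 0
  | b :: l, N, x => ∃ d e, d + e = N ∧ ∃ y ∈ g b d, ∃ z : WordTensor k Y l,
      IsHomogeneousPure g l e z ∧ x = (y ⊗ₜ[k] z : Y b ⊗[k] WordTensor k Y l)

/-- `F_{q,N}((M, …, M), A)`: the part of degree `N`. -/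
def columnPart (g : ∀ b, ℕ → Submodule k (Y b)) (m : ℕ) (q : ℤ) (N : ℕ) :
    Submodule k (ColumnComplex k Y m q) :=
  Submodule.span k {x | ∃ (l : Arrangement m q) (y : WordTensor k Y l.1),
    IsHomogeneousPure g l.1 N y ∧
      x = DirectSum.lof k (Arrangement m q) (fun l => WordTensor k Y l.1) l y}

theorem mulAt_homogeneous {g : ∀ b, ℕ → Submodule k (Y b)}
    {μ : ∀ a b, Y a →ₗ[k] Y b →ₗ[k] Y (a || b)}
    (hμ : ∀ a b d e, ∀ x ∈ g a d, ∀ y ∈ g b e, μ a b x y ∈ g (a || b) (d + e)) :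
    ∀ (i : ℕ) (l : List Bool) (N : ℕ) (x : WordTensor k Y l), IsHomogeneousPure g l N x →
      IsHomogeneousPure g (mergeAt i l) N (mulAt μ i l x)
  | 0, [], _, _, h => h
  | 0, [_], _, _, h => h
  | 0, a :: b :: l, N, x, h => by
    obtain ⟨d, e, rfl, y, hy, _, ⟨d', e', rfl, y', hy', z, hz, rfl⟩, rfl⟩ := h
    exact ⟨d + d', e', by omega, μ a b y y', hμ a b d d' y hy y' hy', z, hz, rfl⟩
  | _ + 1, [], _, _, h => h
  | i + 1, a :: l, N, x, h => by
    obtain ⟨d, e, rfl, y, hy, z, hz, rfl⟩ := h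
    exact ⟨d, e, rfl, y, hy, _, mulAt_homogeneous hμ i l e z hz, rfl⟩

theorem columnD_mem {g : ∀ b, ℕ → Submodule k (Y b)}
    {μ : ∀ a b, Y a →ₗ[k] Y b →ₗ[k] Y (a || b)}
    (hμ : ∀ a b d e, ∀ x ∈ g a d, ∀ y ∈ g b e, μ a b x y ∈ g (a || b) (d + e))
    (m : ℕ) (q s : ℤ) (N : ℕ) : ∀ x ∈ columnPart g m q N,
      columnD μ m q s x ∈ columnPart g m s N := by
  intro x hx
  refine (Submodule.span_le (p := (columnPart g m s N).comap (columnD μ m q s))).2 ?_ hx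
  rintro _ ⟨l, y, hy, rfl⟩
  simp only [Submodule.comap_coe, Set.mem_preimage, SetLike.mem_coe, columnD,
    DirectSum.toModule_lof, LinearMap.sum_apply, LinearMap.smul_apply, LinearMap.comp_apply]
  refine Submodule.sum_mem _ fun i _ => Submodule.smul_mem _ _ ?_
  unfold columnIncl
  split_ifs with h
  · exact Submodule.subset_span ⟨_, _, mulAt_homogeneous hμ i l.1 N y hy, rfl⟩
  · simp

end ColumnComplex

section ShuffleComplex

variable {k V W : Type u} [Field k] [AddCommGroup V] [Module k V] [AddCommGroup W] [Module k W]

/-- The factors of `F_*((𝔐, …, 𝔐), 𝔍)`: the augmentation ideal `𝔍` and the bimodule `𝔐`. -/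
abbrev Factor (k V W : Type u) [Field k] [AddCommGroup V] [Module k V] [AddCommGroup W]
    [Module k W] : Bool → Type u
  | false => augmentationIdeal k V W
  | true => Graded k V W true

instance instFactorGroup (k V W : Type u) [Field k] [AddCommGroup V] [Module k V]
    [AddCommGroup W] [Module k W] : ∀ b, AddCommGroup (Factor k V W b)
  | false => inferInstanceAs (AddCommGroup (augmentationIdeal k V W))
  | true => inferInstanceAs (AddCommGroup (Graded k V W true))

instance instFactorModule (k V W : Type u) [Field k] [AddCommGroup V] [Module k V]
    [AddCommGroup W] [Module k W] : ∀ b, Module k (Factor k V W b)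
  | false => inferInstanceAs (Module k (augmentationIdeal k V W))
  | true => inferInstanceAs (Module k (Graded k V W true))

/-- The grading of the factors. -/
def factorPart (k V W : Type u) [Field k] [AddCommGroup V] [Module k V] [AddCommGroup W]
    [Module k W] : ∀ b, ℕ → Submodule k (Factor k V W b)
  | false, d => (gradedPart k V W false d).comap (augmentationIdeal k V W).subtype
  | true, d => gradedPart k V W true d

/-- The product of `𝔄`, restricted to `𝔍`. -/
def MixedBraided.augmentationMul (B : MixedBraided k V W) (φ : V ⊗[k] W ≃ₗ[k] W ⊗[k] V) :
    augmentationIdeal k V W →ₗ[k] augmentationIdeal k V W →ₗ[k] augmentationIdeal k V W :=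
  LinearMap.mk₂ k (fun x y => ⟨B.shuffleMul φ false false rfl x y,
      B.mul_mem_augmentationIdeal φ x.2 y.2⟩)
    (fun x x' y => Subtype.ext (by simp)) (fun r x y => Subtype.ext (by simp))
    (fun x y y' => Subtype.ext (by simp)) (fun r x y => Subtype.ext (by simp))

/-- The product of `𝔍` and its left and right actions on `𝔐`; products of two elements of `𝔐`
are `0`. -/
def MixedBraided.factorMul (B : MixedBraided k V W) (φ : V ⊗[k] W ≃ₗ[k] W ⊗[k] V) :
    ∀ a b, Factor k V W a →ₗ[k] Factor k V W b →ₗ[k] Factor k V W (a || b)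
  | false, false => B.augmentationMul φ
  | false, true => (B.shuffleMul φ false true rfl ∘ₗ (augmentationIdeal k V W).subtype :)
  | true, false => ((B.shuffleMul φ true false rfl).compl₂ (augmentationIdeal k V W).subtype :)
  | true, true => 0

theorem MixedBraided.factorMul_mem (B : MixedBraided k V W) (φ : V ⊗[k] W ≃ₗ[k] W ⊗[k] V) :
    ∀ a b d e, ∀ x ∈ factorPart k V W a d, ∀ y ∈ factorPart k V W b e,
      B.factorMul φ a b x y ∈ factorPart k V W (a || b) (d + e)
  | false, false, _, _, _, hx, _, hy => B.shuffleMul_mem φ (a := false) (b := false) rfl hx hy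
  | false, true, _, _, _, hx, _, hy => B.shuffleMul_mem φ (a := false) (b := true) rfl hx hy
  | true, false, _, _, _, hx, _, hy => B.shuffleMul_mem φ (a := true) (b := false) rfl hx hy
  | true, true, _, _, _, _, _, _ => Submodule.zero_mem _

/-- `F_{q,N}((𝔐, …, 𝔐), 𝔍)` with `m` copies of `𝔐`. (As a vector space it depends on `V`, `W`
only.) -/
abbrev ShuffleComplex (k V W : Type u) [Field k] [AddCommGroup V] [Module k V] [AddCommGroup W]
    [Module k W] (m N : ℕ) (q : ℤ) : Type u :=
  columnPart (factorPart k V W) m q N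

/-- The differential of `F_{*,N}((𝔐, …, 𝔐), 𝔍)` from degree `q` to degree `s` (to be used for
`s = q - 1`), where `𝔄 ⊇ 𝔍` and `𝔐` are built from `B` and `φ`. -/
def MixedBraided.shuffleD (B : MixedBraided k V W) (φ : V ⊗[k] W ≃ₗ[k] W ⊗[k] V) (m N : ℕ)
    (q s : ℤ) : ShuffleComplex k V W m N q →ₗ[k] ShuffleComplex k V W m N s :=
  (columnD (B.factorMul φ) m q s).restrict (columnD_mem (B.factorMul_mem φ) m q s N)

end ShuffleComplex

section FoxNeuwirth

/-- A column of a cell: `size` points, with `mark = some j` if the column contains a puncture, which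
then counts as one of its points and has `j` points below it, and `mark = none` otherwise. -/
structure Column where
  size : ℕ
  mark : Option ℕ

/-- The overall positions (counted from `0`) of the punctures in a list of columns, if `s` points
precede them: `s + j + ∑ (sizes of the previous columns)`. -/
def positions : ℕ → List Column → List ℕ
  | _, [] => []
  | s, c :: C => (match c.mark with
      | none => []
      | some j => [s + j]) ++ positions (s + c.size) C

/-- The conditions on a list `C` of columns to be a generator `(λ, I, J)` of `D(n,m)_r`: the sizes
form a composition `λ` of `n + m` of length `r - n + m`, there are `m` columns with a puncture
(those indexed by `I`) and `0 ≤ j_k ≤ λ_{i_k} - 1`. -/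
def IsCell (n m : ℕ) (r : ℤ) (C : List Column) : Prop :=
  (∀ c ∈ C, 0 < c.size) ∧ (C.map Column.size).sum = n + m ∧ (C.length : ℤ) = r - n + m ∧
    C.countP (fun c => c.mark.isSome) = m ∧ ∀ c ∈ C, ∀ j ∈ c.mark, j < c.size

/-- The generators of `D(n,m)_r`. -/
abbrev Cell (n m : ℕ) (r : ℤ) : Type := {C : List Column // IsCell n m r C}

/-- The set `𝓘` of the overall positions of the punctures. -/
def positionSet (N : ℕ) (C : List Column) : Finset (Fin N) :=
  Finset.univ.filter fun x => (x : ℕ) ∈ positions 0 C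

theorem positions_spec : ∀ (C : List Column) (s : ℕ), (∀ c ∈ C, ∀ j ∈ c.mark, j < c.size) →
    (∀ x ∈ positions s C, s ≤ x ∧ x < s + (C.map Column.size).sum) ∧ (positions s C).Nodup ∧
      (positions s C).length = C.countP (fun c => c.mark.isSome)
  | [], s, _ => by simp [positions]
  | ⟨p, none⟩ :: C, s, h => by
    obtain ⟨h1, h2, h3⟩ := positions_spec C (s + p) fun c hc => h c (List.mem_cons_of_mem _ hc)
    simp only [positions, List.nil_append, List.map_cons, List.sum_cons]
    refine ⟨fun x hx => ?_, h2, by simp [h3]⟩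
    have := h1 x hx
    omega
  | ⟨p, some j⟩ :: C, s, h => by
    obtain ⟨h1, h2, h3⟩ := positions_spec C (s + p) fun c hc => h c (List.mem_cons_of_mem _ hc)
    have hj : j < p := h _ List.mem_cons_self j rfl
    simp only [positions, List.singleton_append, List.map_cons, List.sum_cons]
    refine ⟨fun x hx => ?_, List.nodup_cons.2 ⟨fun hx => ?_, h2⟩, by simp [h3]⟩
    · rcases List.mem_cons.1 hx with rfl | hx
      · omega
      · have := h1 x hx
        omega
    · have := h1 _ hx
      omega

theorem Cell.card_positionSet {n m : ℕ} {r : ℤ} (C : Cell n m r) :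
    (positionSet (n + m) C.1).card = m := by
  obtain ⟨C, _, hs, _, hm, hj⟩ := C
  obtain ⟨h1, h2, h3⟩ := positions_spec C 0 hj
  have : (positionSet (n + m) C).map Fin.valEmbedding = (positions 0 C).toFinset := by
    ext x
    simp only [positionSet, Finset.mem_map, Finset.mem_filter, Finset.mem_univ, true_and,
      List.mem_toFinset, Fin.valEmbedding_apply]
    constructor
    · rintro ⟨y, hy, rfl⟩; exact hy
    · intro hx
      have := h1 x hx
      exact ⟨⟨x, by omega⟩, hx, rfl⟩
  rw [← Finset.card_map Fin.valEmbedding, this, List.toFinset_card_of_nodup h2, h3, hm]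

/-- The sum, over the ways to merge two neighbouring columns `a`, `b` into one column `c` by a
shuffle `γ`, of the terms `f c γ`. If one column contains a puncture, `h` is the number of points of
the other one that end below it; two columns with punctures do not merge. -/
def mergeSum {M : Type*} [AddCommMonoid M] (a b : Column)
    (f : Column → Equiv.Perm (Fin (a.size + b.size)) → M) : M :=
  match a.mark, b.mark with
  | none, none => ∑ γ ∈ shuffles a.size b.size, f ⟨a.size + b.size, none⟩ γ
  | none, some j => ∑ h ∈ Finset.range (a.size + 1), ∑ γ ∈ shufflesLeft a.size h b.size j,
      f ⟨a.size + b.size, some (j + h)⟩ γ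
  | some j, none => ∑ h ∈ Finset.range (b.size + 1), ∑ γ ∈ shufflesRight a.size b.size h j,
      f ⟨a.size + b.size, some (j + h)⟩ γ
  | some _, some _ => 0

/-- The lift `γ̃` of a shuffle of the `p + q` strands that follow the first `s` ones. -/
def localLift (N s p q : ℕ) (γ : Equiv.Perm (Fin (p + q))) : BraidGroup N :=
  wordBraid N ((shuffleWord p q γ).map (s + ·))

variable {k : Type u} [Field k] {n m : ℕ} {L : Type u} [AddCommGroup L] [Module k L]

/-- The vector space `D(n,m)_r ⊗ L`; `(λ, I, J) ⊗ ℓ` is `Finsupp.single (λ, I, J) ℓ`. -/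
abbrev CellComplex (n m : ℕ) (L : Type u) [AddCommGroup L] (r : ℤ) : Type u := Cell n m r →₀ L

/-- `ℓ ↦ C ⊗ ℓ` (`0` if `C` is not a generator of `D(n,m)_r`). -/
def cellIncl (k : Type u) [Field k] (n m : ℕ) (L : Type u) [AddCommGroup L] [Module k L] (r : ℤ)
    (C : List Column) : L →ₗ[k] CellComplex n m L r :=
  open Classical in if h : IsCell n m r C then Finsupp.lsingle ⟨C, h⟩ else 0

/-- The differential of `D(n,m)_* ⊗ L` from degree `r` to degree `s` (to be used for `s = r - 1`;
otherwise it is `0`), for a representation `ρ` of the mixed braid group on `L`: the sum over all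
`i` (counted from `0`) of `(-1)^i` times
`∑ (-1)^{|γ|} (C with the columns i and i + 1 merged) ⊗ η_𝓘(γ̃)(ℓ)`. -/
def cellD (ρ : Representation k (mixedBraidGroup n m) L) (r s : ℤ) :
    CellComplex n m L r →ₗ[k] CellComplex n m L s :=
  Finsupp.lsum k fun C => ∑ i : Fin (C.1.length - 1),
    mergeSum (C.1[(i : ℕ)]'(by omega)) (C.1[(i : ℕ) + 1]'(by omega)) fun c γ =>
      ((-1 : k) ^ (i : ℕ) * ((Equiv.Perm.sign γ : ℤ) : k)) •
        (cellIncl k n m L s (C.1.take i ++ c :: C.1.drop (i + 2)) ∘ₗ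
          ρ (eta (positionSet (n + m) C.1) C.card_positionSet
            (localLift (n + m) ((C.1.take i).map Column.size).sum _ _ γ)))

end FoxNeuwirth
end
end QuantumShuffle

/-! A triple `(λ, I, J)` is the same thing as a word with `n` letters `V` and `m` letters `W`, cut
into blocks of sizes `λ_i > 0` with at most one `W` in each: the `k`-th `W` stands in block `i_k`
with `j_k` letters before it. The part of `F_q` of total degree `n + m` is the direct sum, over the
same cut words with `q` blocks, of the tensor products of `V` and `W` along the word: a block
without `W` lies in `𝔍`, a block with one `W` lies in `𝔐`.

To compare the coefficients, carry the factors of `V^{⊗ n} ⊗ W^{⊗ m}` to their places in the word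
`l`, using `φ` each time a `W` passes in front of a `V`. This is `arrange`; it is the action of the
lift `α̃_𝓘`, and it is bijective because `φ` is. The isomorphism `cellMap` sends `(λ, I, J) ⊗ ℓ` to
the arranged tensor of `ℓ`, cut into blocks by `blocks`. Injectivity comes from the partial inverse
`unblock` (`cellCoeff_cellMap`), surjectivity from the fact that cut words span (`range_cellMap`).

Compatibility with the faces: multiplying two neighbouring blocks is the sum of the lifts of all
shuffles, acting by the signed crossings (`mergeT_blocks`). Each crossing carries a factor `-1`,
which together give `(-1)^{|γ|}`. The core is `crossT_arrangeT`: a crossing in the places `i, i + 1`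
of an arranged tensor equals the arrangement along the exchanged word after an element of the mixed
braid group, and this element is the cocycle of the module induced from `B_{n,m}` to `B_{n+m}`. For
`V V` it is a generator acting by `σV`, for `V W` it is `1` by construction of `arrange`, and for `W
V`, where the crossing is `τ φ⁻¹`, it is the twist of one strand `V` around one strand `W`. The
equations for `φ` say how these elements behave when a `W` is moved to the front: the braid equation
for `σV` (`front_false`), the twist equation for twists around the `W` that is moved
(`front_twist`), the compatibility equation for twists around a later `W` (`front_twist_succ`).
Along a braid word the cocycles multiply up to `η_𝓘`, since `α̃_𝓘` consists of crossings `V W` only,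
whose cocycle is `1` (`mixedBraidLift_eta`). Finally the sums over `h` and the restricted shuffles
are sums over all shuffles, sorted by the new place of the puncture (`mergeSum_eq`).

That `d² = 0` on `F_*` is associativity of the quantum shuffle product. It is proved for any
sequence in a ring that satisfies Artin's relations (`shuffleSum_assoc`), hence for the crossings,
which satisfy the Yang-Baxter equation (`yangBaxter`). There the crossing of two letters `W` is
replaced by `0`, which is harmless because a block with two letters `W` lies in no factor. On
`D(n,m)_*` the statement follows by transport along the isomorphism.

All maps are written as maps between the direct sums `Tens` over all words, so that equalities of
words need not be transported between the summands. -/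

namespace QuantumShuffle
noncomputable section

/-! ### Tensor products along a word: maps on the first letters and behind them -/

section Words

variable {k : Type u} [Field k] {Y : Bool → Type u} [∀ b, AddCommGroup (Y b)]
  [∀ b, Module k (Y b)] {M : Type*} [AddCommGroup M] [Module k M]

/-- Put a vector in front of a tensor. -/
def consW (a : Bool) (l : List Bool) :
    Y a →ₗ[k] WordTensor k Y l →ₗ[k] WordTensor k Y (a :: l) :=
  (TensorProduct.mk k (Y a) (WordTensor k Y l) :)

/-- The unit of `WordTensor k Y []`. -/
def nilW (k : Type u) [Field k] (Y : Bool → Type u) [∀ b, AddCommGroup (Y b)]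
    [∀ b, Module k (Y b)] : WordTensor k Y [] := (1 : k)

theorem wordTensor_nil (x : WordTensor k Y []) : ∃ t : k, x = t • nilW k Y :=
  ⟨x, (@mul_one k _ x).symm⟩

theorem wordTensor_cons_ext {a : Bool} {l : List Bool} {f g : WordTensor k Y (a :: l) →ₗ[k] M}
    (h : ∀ v x, f (consW a l v x) = g (consW a l v x)) : f = g :=
  TensorProduct.ext' (R := k) (M := Y a) (N := WordTensor k Y l) h

theorem wordTensor_cons_induction {a : Bool} {l : List Bool}
    {p : WordTensor k Y (a :: l) → Prop} (h : ∀ v x, p (consW a l v x)) (h0 : p 0)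
    (ha : ∀ x y, p x → p y → p (x + y)) (x : WordTensor k Y (a :: l)) : p x :=
  TensorProduct.induction_on (R := k) (M := Y a) (N := WordTensor k Y l) (motive := p) x h0 h ha

/-- A map out of `WordTensor k Y (a :: l)` from a bilinear map. -/
def liftW {a : Bool} {l : List Bool} (f : Y a →ₗ[k] WordTensor k Y l →ₗ[k] M) :
    WordTensor k Y (a :: l) →ₗ[k] M :=
  (TensorProduct.lift f :)

theorem liftW_cons {a : Bool} {l : List Bool} (f : Y a →ₗ[k] WordTensor k Y l →ₗ[k] M)
    (v : Y a) (x : WordTensor k Y l) : liftW f (consW a l v x) = f v x :=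
  TensorProduct.lift.tmul _ _

/-- `id ⊗ f` behind the first letter. -/
def tailMap (a : Bool) {l l' : List Bool} (f : WordTensor k Y l →ₗ[k] WordTensor k Y l') :
    WordTensor k Y (a :: l) →ₗ[k] WordTensor k Y (a :: l') :=
  (f.lTensor (Y a) :)

theorem tailMap_cons (a : Bool) {l l' : List Bool}
    (f : WordTensor k Y l →ₗ[k] WordTensor k Y l') (v : Y a) (x : WordTensor k Y l) :
    tailMap a f (consW a l v x) = consW a l' v (f x) := rfl

theorem tailMap_comp (a : Bool) {l l' l'' : List Bool}
    (f : WordTensor k Y l' →ₗ[k] WordTensor k Y l'')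
    (g : WordTensor k Y l →ₗ[k] WordTensor k Y l') :
    tailMap a (f ∘ₗ g) = tailMap a f ∘ₗ tailMap a g :=
  LinearMap.lTensor_comp _ f g

/-- Put a tensor of two vectors in front. -/
def cons2 (a b : Bool) (l : List Bool) :
    (Y a ⊗[k] Y b) →ₗ[k] WordTensor k Y l →ₗ[k] WordTensor k Y (a :: b :: l) :=
  TensorProduct.lift (LinearMap.mk₂ k (fun v w => (consW a (b :: l) v) ∘ₗ consW b l w)
    (fun _ _ _ => by ext; simp) (fun _ _ _ => by ext; simp) (fun _ _ _ => by ext; simp)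
    (fun _ _ _ => by ext; simp))

theorem cons2_tmul (a b : Bool) (l : List Bool) (v : Y a) (w : Y b) (x : WordTensor k Y l) :
    cons2 a b l (v ⊗ₜ w) x = consW a (b :: l) v (consW b l w x) := rfl

/-- Put a tensor of three vectors in front. -/
def cons3 (a b c : Bool) (l : List Bool) :
    (Y a ⊗[k] (Y b ⊗[k] Y c)) →ₗ[k] WordTensor k Y l →ₗ[k] WordTensor k Y (a :: b :: c :: l) :=
  TensorProduct.lift (LinearMap.mk₂ k (fun v w => (consW a (b :: c :: l) v) ∘ₗ cons2 b c l w)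
    (fun _ _ _ => by ext; simp) (fun _ _ _ => by ext; simp) (fun _ _ _ => by ext; simp)
    (fun _ _ _ => by ext; simp))

theorem cons3_tmul (a b c : Bool) (l : List Bool) (v : Y a) (w : Y b ⊗[k] Y c)
    (x : WordTensor k Y l) :
    cons3 a b c l (v ⊗ₜ w) x = consW a (b :: c :: l) v (cons2 b c l w x) := rfl

theorem cons2_ext {a b : Bool} {l : List Bool} {f g : WordTensor k Y (a :: b :: l) →ₗ[k] M}
    (h : ∀ t x, f (cons2 a b l t x) = g (cons2 a b l t x)) : f = g := by
  refine wordTensor_cons_ext fun v x => ?_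
  have : f ∘ₗ consW a (b :: l) v = g ∘ₗ consW a (b :: l) v :=
    wordTensor_cons_ext fun w y => h (v ⊗ₜ w) y
  exact LinearMap.congr_fun this x

theorem cons3_ext {a b c : Bool} {l : List Bool}
    {f g : WordTensor k Y (a :: b :: c :: l) →ₗ[k] M}
    (h : ∀ t x, f (cons3 a b c l t x) = g (cons3 a b c l t x)) : f = g := by
  refine wordTensor_cons_ext fun v x => ?_
  have : f ∘ₗ consW a (b :: c :: l) v = g ∘ₗ consW a (b :: c :: l) v :=
    cons2_ext fun w y => h (v ⊗ₜ w) y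
  exact LinearMap.congr_fun this x

/-- `f ⊗ id` in the first two places. -/
def headMap {a b a' b' : Bool} (f : Y a ⊗[k] Y b →ₗ[k] Y a' ⊗[k] Y b') (l : List Bool) :
    WordTensor k Y (a :: b :: l) →ₗ[k] WordTensor k Y (a' :: b' :: l) :=
  (tensorId (WordTensor k Y l) f :)

/-- The value of `f` on a pure tensor need not be pure. Keeping the first two factors as one tensor
`t` makes the action of `f` computable without a choice of summands. -/
theorem headMap_cons2 {a b a' b' : Bool} (f : Y a ⊗[k] Y b →ₗ[k] Y a' ⊗[k] Y b') (l : List Bool)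
    (t : Y a ⊗[k] Y b) (x : WordTensor k Y l) :
    headMap f l (cons2 a b l t x) = cons2 a' b' l (f t) x := by
  have key : ∀ s : Y a' ⊗[k] Y b', (TensorProduct.assoc k (Y a') (Y b') (WordTensor k Y l))
      (s ⊗ₜ x) = cons2 a' b' l s x := by
    intro s
    induction s using TensorProduct.induction_on with
    | zero => simp; rfl
    | tmul v w => rfl
    | add s t hs ht => rw [TensorProduct.add_tmul, map_add, hs, ht, map_add]; rfl
  induction t using TensorProduct.induction_on with
  | zero => simp
  | tmul v w => exact key (f (v ⊗ₜ w))
  | add s t hs ht => simp only [map_add, LinearMap.add_apply, hs, ht]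

theorem headMap_comp {a b a' b' a'' b'' : Bool} (f : Y a' ⊗[k] Y b' →ₗ[k] Y a'' ⊗[k] Y b'')
    (g : Y a ⊗[k] Y b →ₗ[k] Y a' ⊗[k] Y b') (l : List Bool) :
    headMap (f ∘ₗ g) l = headMap f l ∘ₗ headMap g l :=
  cons2_ext fun t x => by simp only [headMap_cons2, LinearMap.comp_apply]

theorem headMap_neg {a b a' b' : Bool} (f : Y a ⊗[k] Y b →ₗ[k] Y a' ⊗[k] Y b') (l : List Bool) :
    headMap (-f) l = -headMap f l :=
  cons2_ext fun t x => by
    rw [LinearMap.neg_apply, headMap_cons2, headMap_cons2, LinearMap.neg_apply, map_neg]; rfl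

/-- Together with `tailMap_headMap_cons3` this carries an operator equation on three tensor factors,
such as the braid equation, over to the first three letters of any word. -/
theorem headMap_cons3 {a b c a' b' : Bool} (f : Y a ⊗[k] Y b →ₗ[k] Y a' ⊗[k] Y b')
    (l : List Bool) (t : Y a ⊗[k] (Y b ⊗[k] Y c)) (x : WordTensor k Y l) :
    headMap f (c :: l) (cons3 a b c l t x) = cons3 a' b' c l (tensorId (Y c) f t) x := by
  have key : ∀ (a b : Bool) (s : Y a ⊗[k] Y b) (z : Y c),
      cons3 a b c l (TensorProduct.assoc k (Y a) (Y b) (Y c) (s ⊗ₜ z)) x =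
        cons2 a b (c :: l) s (consW c l z x) := by
    intro a b s z
    induction s using TensorProduct.induction_on with
    | zero => simp
    | tmul v w => rfl
    | add s t hs ht => simp only [TensorProduct.add_tmul, map_add, LinearMap.add_apply, hs, ht]
  have : ∀ s : (Y a ⊗[k] Y b) ⊗[k] Y c,
      headMap f (c :: l) (cons3 a b c l (TensorProduct.assoc k (Y a) (Y b) (Y c) s) x) =
        cons3 a' b' c l (TensorProduct.assoc k (Y a') (Y b') (Y c) (f.rTensor (Y c) s)) x := by
    intro s
    induction s using TensorProduct.induction_on with
    | zero => simp
    | tmul s z => rw [key, headMap_cons2, LinearMap.rTensor_tmul, key]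
    | add s t hs ht => simp only [map_add, LinearMap.add_apply, hs, ht]
  have h := this ((TensorProduct.assoc k (Y a) (Y b) (Y c)).symm t)
  rw [LinearEquiv.apply_symm_apply] at h
  exact h

theorem tailMap_headMap_cons3 {a b c b' c' : Bool} (f : Y b ⊗[k] Y c →ₗ[k] Y b' ⊗[k] Y c')
    (l : List Bool) (t : Y a ⊗[k] (Y b ⊗[k] Y c)) (x : WordTensor k Y l) :
    tailMap a (headMap f l) (cons3 a b c l t x) = cons3 a b' c' l (f.lTensor (Y a) t) x := by
  induction t using TensorProduct.induction_on with
  | zero => simp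
  | tmul v w => rw [cons3_tmul, tailMap_cons, headMap_cons2, LinearMap.lTensor_tmul, cons3_tmul]
  | add s t hs ht => simp only [map_add, LinearMap.add_apply, hs, ht]

theorem tailMap_tailMap_cons2 (a b : Bool) {l l' : List Bool}
    (g : WordTensor k Y l →ₗ[k] WordTensor k Y l') (t : Y a ⊗[k] Y b) (x : WordTensor k Y l) :
    tailMap a (tailMap b g) (cons2 a b l t x) = cons2 a b l' t (g x) := by
  induction t using TensorProduct.induction_on with
  | zero => simp
  | tmul v w => rfl
  | add s t hs ht => simp only [map_add, LinearMap.add_apply, hs, ht]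

theorem headMap_tailMap {a b a' b' : Bool} (f : Y a ⊗[k] Y b →ₗ[k] Y a' ⊗[k] Y b')
    {l l' : List Bool} (g : WordTensor k Y l →ₗ[k] WordTensor k Y l') :
    headMap f l' ∘ₗ tailMap a (tailMap b g) = tailMap a' (tailMap b' g) ∘ₗ headMap f l :=
  cons2_ext fun t x => by
    simp only [LinearMap.comp_apply, tailMap_tailMap_cons2, headMap_cons2]

theorem concat_cons (a : Bool) (l l' : List Bool) (v : Y a) (x : WordTensor k Y l)
    (y : WordTensor k Y l') :
    concat (a :: l) l' (consW a l v x ⊗ₜ y) = consW a (l ++ l') v (concat l l' (x ⊗ₜ y)) := rfl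

theorem concat_nil (l' : List Bool) (t : k) (y : WordTensor k Y l') :
    concat [] l' ((t • nilW k Y) ⊗ₜ y) = t • y := by
  change (TensorProduct.lid k (WordTensor k Y l')) ((t • (1 : k)) ⊗ₜ y) = t • y
  simp

end Words

/-! ### The sum over all words as a tensor algebra -/

section Tens

/-- The direct sum of all `WordTensor k Y l`: the tensor algebra of `Y false ⊕ Y true`. -/
abbrev Tens (k : Type u) [Field k] (Y : Bool → Type u) [∀ b, AddCommGroup (Y b)]
    [∀ b, Module k (Y b)] : Type u := ⨁ l : List Bool, WordTensor k Y l

variable {k : Type u} [Field k] {Y : Bool → Type u} [∀ b, AddCommGroup (Y b)]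
  [∀ b, Module k (Y b)] {M : Type*} [AddCommGroup M] [Module k M]

/-- The inclusion of a summand. -/
def ofW (l : List Bool) : WordTensor k Y l →ₗ[k] Tens k Y :=
  DirectSum.lof k (List Bool) (fun l => WordTensor k Y l) l

/-- A linear map given on all summands. -/
def ofWords (f : ∀ l, WordTensor k Y l →ₗ[k] M) : Tens k Y →ₗ[k] M :=
  DirectSum.toModule k (List Bool) M f

theorem ofWords_ofW (f : ∀ l, WordTensor k Y l →ₗ[k] M) (l : List Bool) (x : WordTensor k Y l) :
    ofWords f (ofW l x) = f l x := DirectSum.toModule_lof ..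

theorem tens_ext_ofW {f g : Tens k Y →ₗ[k] M} (h : ∀ l x, f (ofW l x) = g (ofW l x)) : f = g :=
  DirectSum.linearMap_ext _ fun l => LinearMap.ext (h l)

/-- The empty tensor. -/
def oneT (k : Type u) [Field k] (Y : Bool → Type u) [∀ b, AddCommGroup (Y b)]
    [∀ b, Module k (Y b)] : Tens k Y := ofW [] (nilW k Y)

/-- Put a vector in front. -/
def consT (a : Bool) : Y a →ₗ[k] Tens k Y →ₗ[k] Tens k Y :=
  LinearMap.flip (ofWords fun l => LinearMap.flip ((consW a l).compr₂ (ofW (a :: l))))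

theorem consT_ofW (a : Bool) (v : Y a) (l : List Bool) (x : WordTensor k Y l) :
    consT a v (ofW l x) = ofW (a :: l) (consW a l v x) := by
  rw [consT, LinearMap.flip_apply, ofWords_ofW]; rfl

/-- Every tensor is a sum of tensors built letter by letter from the empty one, so an identity of
linear maps can be proved by induction on the letters. -/
theorem tens_ext {f g : Tens k Y →ₗ[k] M} (h1 : f (oneT k Y) = g (oneT k Y))
    (hc : ∀ a v X, f X = g X → f (consT a v X) = g (consT a v X)) : f = g := by
  refine tens_ext_ofW fun l => ?_
  induction l with
  | nil =>
    intro x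
    obtain ⟨t, rfl⟩ := wordTensor_nil x
    rw [map_smul, map_smul, map_smul]
    exact congrArg _ h1
  | cons a l ih =>
    refine LinearMap.congr_fun (f := f ∘ₗ ofW (a :: l)) (g := g ∘ₗ ofW (a :: l))
      (wordTensor_cons_ext fun v x => ?_)
    rw [LinearMap.comp_apply, LinearMap.comp_apply, ← consT_ofW]
    exact hc a v _ (ih x)

/-- Let `f` act behind the first letter. -/
def shiftT (f : Tens k Y →ₗ[k] Tens k Y) : Tens k Y →ₗ[k] Tens k Y :=
  ofWords fun l => match l with
    | [] => 0
    | a :: l => liftW ((consT a).compl₂ (f ∘ₗ ofW l))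

theorem shiftT_one (f : Tens k Y →ₗ[k] Tens k Y) : shiftT f (oneT k Y) = 0 := by
  rw [shiftT, oneT, ofWords_ofW]; rfl

theorem shiftT_cons (f : Tens k Y →ₗ[k] Tens k Y) (a : Bool) (v : Y a) (X : Tens k Y) :
    shiftT f (consT a v X) = consT a v (f X) := by
  refine LinearMap.congr_fun (f := shiftT f ∘ₗ consT a v) (g := consT a v ∘ₗ f)
    (tens_ext_ofW fun l x => ?_) X
  rw [LinearMap.comp_apply, consT_ofW, shiftT, ofWords_ofW]
  exact liftW_cons _ _ _

/-- The tensor product of two tensors, as a map of the first one. -/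
def mulL : ∀ l : List Bool, WordTensor k Y l →ₗ[k] Tens k Y →ₗ[k] Tens k Y
  | [] => (LinearMap.toSpanSingleton k _ (LinearMap.id : Tens k Y →ₗ[k] Tens k Y) :)
  | a :: l => liftW (LinearMap.mk₂ k (fun v x => consT a v ∘ₗ mulL l x)
    (fun _ _ _ => by simp [LinearMap.add_comp]) (fun _ _ _ => by simp [LinearMap.smul_comp])
    (fun _ _ _ => by simp [LinearMap.comp_add]) (fun _ _ _ => by simp [LinearMap.comp_smul]))

/-- The tensor product of two tensors. -/
def mulT : Tens k Y →ₗ[k] Tens k Y →ₗ[k] Tens k Y := ofWords mulL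

theorem mulT_one (Z : Tens k Y) : mulT (oneT k Y) Z = Z := by
  rw [mulT, oneT, ofWords_ofW]
  change (1 : k) • Z = Z
  rw [one_smul]

theorem mulT_cons (a : Bool) (v : Y a) (X Z : Tens k Y) :
    mulT (consT a v X) Z = consT a v (mulT X Z) := by
  refine LinearMap.congr_fun (f := mulT.flip Z ∘ₗ consT a v) (g := consT a v ∘ₗ mulT.flip Z)
    (tens_ext_ofW fun l x => ?_) X
  rw [LinearMap.comp_apply, consT_ofW, LinearMap.comp_apply, LinearMap.flip_apply,
    LinearMap.flip_apply, mulT, ofWords_ofW, ofWords_ofW, mulL, liftW_cons]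
  rfl

theorem mulT_assoc (X X' Z : Tens k Y) : mulT (mulT X X') Z = mulT X (mulT X' Z) := by
  refine LinearMap.congr_fun (f := mulT.flip Z ∘ₗ mulT.flip X') (g := mulT.flip (mulT X' Z))
    (tens_ext ?_ ?_) X
  · simp only [LinearMap.comp_apply, LinearMap.flip_apply, mulT_one]
  · intro a v X h
    simp only [LinearMap.comp_apply, LinearMap.flip_apply, mulT_cons] at h ⊢
    rw [h]

theorem mulT_ofW : ∀ (l l' : List Bool) (x : WordTensor k Y l) (y : WordTensor k Y l'),
    mulT (ofW l x) (ofW l' y) = ofW (l ++ l') (concat l l' (x ⊗ₜ y)) := by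
  intro l l' x y
  induction l with
  | nil =>
    obtain ⟨t, rfl⟩ := wordTensor_nil x
    rw [concat_nil, map_smul, map_smul, map_smul, LinearMap.smul_apply]
    exact congrArg _ (mulT_one _)
  | cons a l ih =>
    refine wordTensor_cons_induction
      (p := fun x => mulT (ofW (a :: l) x) (ofW l' y) =
        ofW (a :: l ++ l') (concat (a :: l) l' (x ⊗ₜ y))) (fun v x => ?_) ?_ ?_ x
    · rw [← consT_ofW, mulT_cons, ih, concat_cons, consT_ofW]; rfl
    · simp
    · intro x x' h h'
      rw [map_add, map_add, LinearMap.add_apply, h, h', TensorProduct.add_tmul, map_add, map_add]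

/-- Split off the first `p` letters. -/
def splitT : ℕ → (Tens k Y →ₗ[k] Tens k Y ⊗[k] Tens k Y)
  | 0 => TensorProduct.mk k _ _ (oneT k Y)
  | p + 1 => ofWords fun l => match l with
    | [] => 0
    | a :: l => liftW (LinearMap.mk₂ k
        (fun v x => (consT a v).rTensor (Tens k Y) (splitT p (ofW l x)))
        (fun _ _ _ => by simp [LinearMap.rTensor_add])
        (fun _ _ _ => by simp [LinearMap.rTensor_smul])
        (fun _ _ _ => by simp) (fun _ _ _ => by simp))

theorem splitT_cons (p : ℕ) (a : Bool) (v : Y a) (X : Tens k Y) :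
    splitT (p + 1) (consT a v X) = (consT a v).rTensor (Tens k Y) (splitT p X) := by
  refine LinearMap.congr_fun (f := splitT (p + 1) ∘ₗ consT a v)
    (g := (consT a v).rTensor (Tens k Y) ∘ₗ splitT p) (tens_ext_ofW fun l x => ?_) X
  rw [LinearMap.comp_apply, consT_ofW, splitT, ofWords_ofW]
  exact liftW_cons _ _ _

theorem splitT_mulT : ∀ (l : List Bool) (x : WordTensor k Y l) (Z : Tens k Y),
    splitT l.length (mulT (ofW l x) Z) = ofW l x ⊗ₜ Z := by
  intro l x Z
  induction l with
  | nil =>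
    obtain ⟨t, rfl⟩ := wordTensor_nil x
    rw [map_smul, map_smul, LinearMap.smul_apply, map_smul, ← TensorProduct.smul_tmul']
    refine congrArg _ ?_
    exact (congrArg (splitT (k := k) (Y := Y) 0) (mulT_one Z)).trans rfl
  | cons a l ih =>
    refine wordTensor_cons_induction
      (p := fun x => splitT (a :: l).length (mulT (ofW (a :: l) x) Z) = ofW (a :: l) x ⊗ₜ Z)
      (fun v x => ?_) ?_ ?_ x
    · rw [← consT_ofW, mulT_cons, List.length_cons, splitT_cons, ih, LinearMap.rTensor_tmul]
    · simp
    · intro x x' h h'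
      rw [map_add, map_add, LinearMap.add_apply, map_add, h, h', TensorProduct.add_tmul]

/-- Tensors on a concatenation of words are sums of products. -/
theorem ofW_append_induction (l l' : List Bool) {p : Tens k Y → Prop}
    (h : ∀ x z, p (mulT (ofW l x) (ofW l' z))) (h0 : p 0)
    (ha : ∀ x y, p x → p y → p (x + y)) (x : WordTensor k Y (l ++ l')) :
    p (ofW (l ++ l') x) := by
  induction l generalizing p with
  | nil =>
    have := h (nilW k Y) x
    rwa [show ofW [] (nilW k Y) = oneT k Y from rfl, mulT_one] at this
  | cons a l ih =>
    refine wordTensor_cons_induction (p := fun x => p (ofW (a :: l ++ l') x)) (fun v x => ?_) ?_ ?_ x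
    · change p (ofW (a :: (l ++ l')) (consW a (l ++ l') v x))
      rw [← consT_ofW]
      refine ih (p := fun X => p (consT a v X)) (fun x z => ?_) ?_ ?_ x
      · have := h (consW a l v x) z
        rwa [← consT_ofW, mulT_cons] at this
      · simpa using h0
      · intro x y hx hy
        rw [map_add]; exact ha _ _ hx hy
    · simpa using h0
    · intro x y hx hy
      rw [map_add]; exact ha _ _ hx hy

/-- The span of the words of length `N` with `m` letters `true`. -/
def supp (k : Type u) [Field k] (Y : Bool → Type u) [∀ b, AddCommGroup (Y b)]
    [∀ b, Module k (Y b)] (N m : ℕ) : Submodule k (Tens k Y) :=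
  Submodule.span k {X | ∃ l x, l.length = N ∧ l.count true = m ∧ X = ofW l x}

theorem ofW_mem_supp (l : List Bool) (x : WordTensor k Y l) :
    ofW l x ∈ supp k Y l.length (l.count true) := Submodule.subset_span ⟨l, x, rfl, rfl, rfl⟩

/-- A scalar multiple of `ofW l x` is `ofW l` of another tensor, so the span is already the additive
span, and no case for scalars is needed. -/
theorem supp_induction {N m : ℕ} {p : Tens k Y → Prop}
    (h : ∀ l x, l.length = N → l.count true = m → p (ofW l x)) (h0 : p 0)
    (ha : ∀ x y, p x → p y → p (x + y)) {X : Tens k Y} (hX : X ∈ supp k Y N m) : p X := by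
  have : X ∈ Submodule.span k {X | ∃ l x, l.length = N ∧ l.count true = m ∧
      X = ofW (k := k) (Y := Y) l x} := hX
  clear hX
  induction this using Submodule.closure_induction with
  | zero => exact h0
  | add x y _ _ hx hy => exact ha x y hx hy
  | smul_mem r x hx =>
    obtain ⟨l, x, h1, h2, rfl⟩ := hx
    rw [← map_smul]
    exact h l _ h1 h2

theorem consT_mem_supp {N m : ℕ} {X : Tens k Y} (hX : X ∈ supp k Y N m) (a : Bool) (v : Y a) :
    consT a v X ∈ supp k Y (N + 1) (m + a.toNat) := by
  refine supp_induction (p := fun X => consT a v X ∈ supp k Y (N + 1) (m + a.toNat))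
    ?_ (by simp) ?_ hX
  · rintro l x rfl rfl
    rw [consT_ofW]
    convert ofW_mem_supp (a :: l) (consW a l v x) using 1
    cases a <;> simp
  · intro x y hx hy
    rw [map_add]; exact Submodule.add_mem _ hx hy

end Tens

/-! ### Sums of shuffle lifts in a ring, and associativity -/

section ShuffleSum

variable {A : Type*} [Ring A]

/-- A sequence of elements satisfying Artin's relations. -/
structure IsBraidSeq (σ : ℕ → A) : Prop where
  comm : ∀ i j, i + 1 < j → σ i * σ j = σ j * σ i
  braid : ∀ i, σ i * σ (i + 1) * σ i = σ (i + 1) * σ i * σ (i + 1)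

/-- The product spelled by a word. -/
def wordProd (σ : ℕ → A) (w : List ℕ) : A := (w.map σ).prod

/-- The sum of the lifts of all `(p,q)`-shuffles, by recursion on the element in the first place. -/
def shuffleSum (σ : ℕ → A) : ℕ → ℕ → A
  | 0, _ => 1
  | _ + 1, 0 => 1
  | p + 1, q + 1 => shuffleSum (fun i => σ (i + 1)) p (q + 1) +
      shuffleSum (fun i => σ (i + 1)) (p + 1) q * wordProd σ (List.range' 0 (p + 1))
termination_by p q => p + q

theorem shuffleSum_zero_left (σ : ℕ → A) (q : ℕ) : shuffleSum σ 0 q = 1 := by rw [shuffleSum]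

theorem shuffleSum_zero_right (σ : ℕ → A) (p : ℕ) : shuffleSum σ p 0 = 1 := by
  cases p <;> rw [shuffleSum]

theorem wordProd_append (σ : ℕ → A) (w w' : List ℕ) :
    wordProd σ (w ++ w') = wordProd σ w * wordProd σ w' := by simp [wordProd]

theorem wordProd_shift (σ : ℕ → A) (s : ℕ) (w : List ℕ) :
    wordProd (fun i => σ (i + s)) w = wordProd σ (w.map (s + ·)) := by
  simp [wordProd, Function.comp_def, add_comm]

theorem wordProd_intertwine {σ σ' : ℕ → A} {x : A} (w : List ℕ)
    (h : ∀ j ∈ w, x * σ j = σ' j * x) : x * wordProd σ w = wordProd σ' w * x := by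
  induction w with
  | nil => simp [wordProd]
  | cons i w ih =>
    have h1 := h i List.mem_cons_self
    have h2 := ih fun j hj => h j (List.mem_cons_of_mem _ hj)
    simp only [wordProd, List.map_cons, List.prod_cons] at h2 ⊢
    rw [← mul_assoc, h1, mul_assoc, h2, mul_assoc]

/-- Only the first `p + q - 1` elements of the sequence occur. With `σ' = σ` this is commutation
with something far away, with `σ'` a shift of `σ` it slides a shuffle past a strand or a block. -/
theorem shuffleSum_intertwine {σ σ' : ℕ → A} {x : A} {p q : ℕ}
    (h : ∀ j, j + 1 < p + q → x * σ j = σ' j * x) :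
    x * shuffleSum σ p q = shuffleSum σ' p q * x := by
  obtain ⟨N, hN⟩ : ∃ N, p + q = N := ⟨_, rfl⟩
  induction N generalizing σ σ' p q with
  | zero =>
    obtain ⟨rfl, rfl⟩ : p = 0 ∧ q = 0 := by omega
    simp [shuffleSum_zero_left]
  | succ N ih =>
    rcases p with _ | p
    · simp [shuffleSum_zero_left]
    rcases q with _ | q
    · simp [shuffleSum_zero_right]
    rw [shuffleSum, shuffleSum, mul_add, add_mul, ← mul_assoc,
      ih (σ' := fun i => σ' (i + 1)) (fun j hj => h (j + 1) (by omega)) (by omega),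
      ih (σ' := fun i => σ' (i + 1)) (fun j hj => h (j + 1) (by omega)) (by omega),
      mul_assoc, wordProd_intertwine (σ' := σ') _ (fun j hj => h j (by
        simp only [List.mem_range'_1] at hj; omega)), mul_assoc]

theorem IsBraidSeq.shift {σ : ℕ → A} (h : IsBraidSeq σ) (s : ℕ) :
    IsBraidSeq fun i => σ (i + s) where
  comm i j hij := h.comm _ _ (by omega)
  braid i := by
    have := h.braid (i + s)
    rwa [show i + s + 1 = i + 1 + s by omega] at this

/-- The element `σ_0 ⋯ σ_n` carries one strand across `n + 1` others, which all move up by one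
place. A crossing among the others may take place before or after, with its index raised by one. -/
theorem IsBraidSeq.range_mul {σ : ℕ → A} (h : IsBraidSeq σ) {n j : ℕ} (hj : j < n) :
    wordProd σ (List.range' 0 (n + 1)) * σ j = σ (j + 1) * wordProd σ (List.range' 0 (n + 1)) := by
  have step : ∀ n, wordProd σ (List.range' 0 (n + 1)) =
      wordProd σ (List.range' 0 n) * σ n := by
    intro n
    rw [List.range'_concat, wordProd_append]
    simp [wordProd]
  induction n with
  | zero => omega
  | succ n ih =>
    rcases Nat.lt_succ_iff_lt_or_eq.1 hj with hj | rfl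
    · rw [step, mul_assoc, ← h.comm j (n + 1) (by omega), ← mul_assoc, ih hj, mul_assoc]
    -- For the last admissible `j` the product ends in `σ_j σ_{j+1}`, and one braid relation does
    -- it; the remaining factors `σ_0 ⋯ σ_{j-1}` commute with `σ_{j+1}`.
    · have hc : σ (j + 1) * wordProd σ (List.range' 0 j) =
          wordProd σ (List.range' 0 j) * σ (j + 1) :=
        wordProd_intertwine _ fun i hi => by
          simp only [List.mem_range'_1] at hi
          exact (h.comm i (j + 1) (by omega)).symm
      rw [step, step]
      calc wordProd σ (List.range' 0 j) * σ j * σ (j + 1) * σ j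
          = wordProd σ (List.range' 0 j) * (σ j * σ (j + 1) * σ j) := by simp only [mul_assoc]
        _ = wordProd σ (List.range' 0 j) * σ (j + 1) * (σ j * σ (j + 1)) := by
          rw [h.braid]; simp only [mul_assoc]
        _ = _ := by rw [← hc]; simp only [mul_assoc]

/-- Associativity of the quantum shuffle product, for the sums of lifts. -/
theorem IsBraidSeq.shuffleSum_assoc {σ : ℕ → A} (h : IsBraidSeq σ) (p q r : ℕ) :
    shuffleSum σ (p + q) r * shuffleSum σ p q =
      shuffleSum σ p (q + r) * shuffleSum (fun i => σ (i + p)) q r := by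
  obtain ⟨N, hN⟩ : ∃ N, p + q + r = N := ⟨_, rfl⟩
  induction N using Nat.strong_induction_on generalizing σ p q r with
  | _ N ih =>
    rcases p with _ | p
    · simp [shuffleSum_zero_left]
    rcases q with _ | q
    · simp [shuffleSum_zero_left, shuffleSum_zero_right]
    rcases r with _ | r
    · simp [shuffleSum_zero_right]
    have hs := h.shift 1
    -- The three induction hypotheses belong to the three blocks that can supply the element in the
    -- first place; the other elements are shuffled in the places after it.
    have i1 := ih _ (by omega) hs p (q + 1) (r + 1) rfl
    have i2 := ih _ (by omega) hs (p + 1) q (r + 1) rfl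
    have i3 := ih _ (by omega) hs (p + 1) (q + 1) r rfl
    -- Bringing the first strand of the third block to the front crosses both other blocks, so their
    -- shuffle may be done afterwards, one place further up.
    have n1 : wordProd σ (List.range' 0 (p + 1 + q + 1)) * shuffleSum σ (p + 1) (q + 1) =
        shuffleSum (fun i => σ (i + 1)) (p + 1) (q + 1) *
          wordProd σ (List.range' 0 (p + 1 + q + 1)) :=
      shuffleSum_intertwine fun j hj => h.range_mul (by omega)
    -- Bringing the first strand of the second block to the front involves only the places up to
    -- that strand, hence commutes with the shuffles of what follows.
    have n2 : wordProd σ (List.range' 0 (p + 1)) *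
          shuffleSum (fun i => σ (i + (p + 1) + 1)) q (r + 1) =
        shuffleSum (fun i => σ (i + (p + 1) + 1)) q (r + 1) *
          wordProd σ (List.range' 0 (p + 1)) :=
      shuffleSum_intertwine fun j _ => (wordProd_intertwine _ fun i hi => by
        simp only [List.mem_range'_1] at hi
        exact (h.comm i _ (by omega)).symm).symm
    have n3 : wordProd σ (List.range' 0 (p + 1)) *
          shuffleSum (fun i => σ (i + (p + 1) + 1)) (q + 1) r =
        shuffleSum (fun i => σ (i + (p + 1) + 1)) (q + 1) r *
          wordProd σ (List.range' 0 (p + 1)) :=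
      shuffleSum_intertwine fun j _ => (wordProd_intertwine _ fun i hi => by
        simp only [List.mem_range'_1] at hi
        exact (h.comm i _ (by omega)).symm).symm
    -- A strand of the third block that crosses the second block and then the first crosses both.
    have n4 : wordProd σ (List.range' 0 (p + 1)) *
        wordProd (fun i => σ (i + (p + 1))) (List.range' 0 (q + 1)) =
          wordProd σ (List.range' 0 (p + 1 + q + 1)) := by
      rw [wordProd_shift, ← wordProd_append, List.map_add_range', add_zero, add_assoc _ q 1]
      congr 1
      have := List.range'_append_1 (s := 0) (m := p + 1) (n := q + 1)
      rwa [zero_add] at this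
    have e1 : shuffleSum σ (p + 1 + (q + 1)) (r + 1) =
        shuffleSum (fun i => σ (i + 1)) (p + (q + 1)) (r + 1) +
        shuffleSum (fun i => σ (i + 1)) (p + 1 + (q + 1)) r *
          wordProd σ (List.range' 0 (p + 1 + q + 1)) := by
      rw [show p + 1 + (q + 1) = p + (q + 1) + 1 by omega, shuffleSum,
        show p + (q + 1) + 1 = p + 1 + q + 1 by omega]
    have e2 : shuffleSum σ (p + 1) (q + 1 + (r + 1)) =
        shuffleSum (fun i => σ (i + 1)) p (q + 1 + (r + 1)) +
        shuffleSum (fun i => σ (i + 1)) (p + 1) (q + (r + 1)) *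
          wordProd σ (List.range' 0 (p + 1)) := by
      rw [show q + 1 + (r + 1) = q + (r + 1) + 1 by omega, shuffleSum]
    have e3 : shuffleSum σ (p + 1) (q + 1) = shuffleSum (fun i => σ (i + 1)) p (q + 1) +
        shuffleSum (fun i => σ (i + 1)) (p + 1) q * wordProd σ (List.range' 0 (p + 1)) := by
      rw [shuffleSum]
    have e4 : shuffleSum (fun i => σ (i + (p + 1))) (q + 1) (r + 1) =
        shuffleSum (fun i => σ (i + (p + 1) + 1)) q (r + 1) +
        shuffleSum (fun i => σ (i + (p + 1) + 1)) (q + 1) r *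
          wordProd (fun i => σ (i + (p + 1))) (List.range' 0 (q + 1)) := by
      rw [shuffleSum]
      simp only [show ∀ i, i + 1 + (p + 1) = i + (p + 1) + 1 by intro; omega]
    rw [show p + 1 + q = p + (q + 1) by omega] at i2
    rw [show q + 1 + r = q + (r + 1) by omega] at i3
    simp only [show ∀ i, i + p + 1 = i + (p + 1) by intro; omega] at i1
    have i1' := i1
    rw [e4] at i1'
    rw [e1, e2, add_mul, mul_assoc _ _ (shuffleSum σ (p + 1) (q + 1)), n1, ← mul_assoc, i3, e3,
      mul_add, ← mul_assoc, i1', i2, e4, add_mul, ← n4]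
    simp only [mul_add, mul_assoc]
    rw [n2, ← mul_assoc (wordProd σ _) (shuffleSum _ (q + 1) r), n3]
    simp only [mul_assoc]
    rw [add_assoc]

/-- The products for all faces of a list of block sizes: merge the blocks `i` and `i + 1`. -/
def faceSum : (ℕ → A) → ℕ → List ℕ → A
  | σ, 0, p :: q :: _ => shuffleSum σ p q
  | σ, i + 1, p :: l => faceSum (fun j => σ (j + p)) i l
  | _, _, _ => 0

/-- Add the sizes of the blocks `i` and `i + 1`. -/
def mergeSizes : ℕ → List ℕ → List ℕ
  | 0, p :: q :: l => (p + q) :: l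
  | i + 1, p :: l => p :: mergeSizes i l
  | _, l => l

theorem faceSum_intertwine {σ σ' : ℕ → A} {x : A} (h : ∀ j, x * σ j = σ' j * x) :
    ∀ (i : ℕ) (l : List ℕ), x * faceSum σ i l = faceSum σ' i l * x
  | 0, [] => by simp [faceSum]
  | 0, [_] => by simp [faceSum]
  | 0, p :: q :: l => by
    simp only [faceSum]
    exact shuffleSum_intertwine fun j _ => h j
  | i + 1, [] => by simp [faceSum]
  | i + 1, p :: l => by
    simp only [faceSum]
    exact faceSum_intertwine (fun j => h (j + p)) i l

theorem mergeSizes_length : ∀ (i : ℕ) (l : List ℕ), i + 1 < l.length →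
    (mergeSizes i l).length + 1 = l.length
  | 0, [], h => by simp at h
  | 0, [_], h => by simp at h
  | 0, p :: q :: l, _ => by simp [mergeSizes]
  | i + 1, [], h => by simp at h
  | i + 1, p :: l, h => by
    have := mergeSizes_length i l (by simpa using h)
    simp [mergeSizes, this]

theorem mergeSizes_sum : ∀ (i : ℕ) (l : List ℕ), (mergeSizes i l).sum = l.sum
  | 0, [] => rfl
  | 0, [_] => rfl
  | 0, p :: q :: l => by simp [mergeSizes, add_assoc]
  | i + 1, [] => rfl
  | i + 1, p :: l => by simp [mergeSizes, mergeSizes_sum i l]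

theorem mergeSizes_pos : ∀ (i : ℕ) (l : List ℕ), (∀ p ∈ l, 0 < p) → ∀ p ∈ mergeSizes i l, 0 < p
  | 0, [], h => h
  | 0, [_], h => h
  | 0, p :: q :: l, h => by
    simp only [mergeSizes, List.mem_cons, forall_eq_or_imp] at h ⊢
    exact ⟨by omega, h.2.2⟩
  | i + 1, [], h => h
  | i + 1, p :: l, h => by
    simp only [mergeSizes, List.mem_cons, forall_eq_or_imp] at h ⊢
    exact ⟨h.1, mergeSizes_pos i l h.2⟩

theorem mergeSizes_mergeSizes : ∀ (i j : ℕ) (l : List ℕ), i ≤ j → j + 2 < l.length →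
    mergeSizes j (mergeSizes i l) = mergeSizes i (mergeSizes (j + 1) l)
  | 0, 0, p :: q :: r :: l, _, _ => by simp [mergeSizes, add_assoc]
  | 0, j + 1, p :: q :: l, _, _ => by simp [mergeSizes]
  | i + 1, j + 1, p :: l, h, h' => by
    simp only [mergeSizes]
    rw [mergeSizes_mergeSizes i j l (by omega) (by simp at h'; omega)]

/-- These are the simplicial identities behind `d² = 0`. Merging three consecutive blocks in either
order is associativity; merging two disjoint pairs of blocks involves distant crossings, which
commute. -/
theorem IsBraidSeq.faceSum_faceSum : ∀ {σ : ℕ → A}, IsBraidSeq σ → ∀ (i j : ℕ) (l : List ℕ), i ≤ j →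
    j + 2 < l.length → faceSum σ j (mergeSizes i l) * faceSum σ i l =
      faceSum σ i (mergeSizes (j + 1) l) * faceSum σ (j + 1) l
  | σ, h, 0, 0, p :: q :: r :: l, _, _ => by
    simp only [mergeSizes, faceSum]
    exact h.shuffleSum_assoc p q r
  | σ, h, 0, j + 1, p :: q :: l, _, _ => by
    simp only [mergeSizes, faceSum]
    have : (fun i => σ (i + (p + q))) = fun i => σ (i + q + p) := by
      funext i; congr 1; omega
    rw [this]
    refine (shuffleSum_intertwine fun a ha => ?_)
    refine (faceSum_intertwine (fun b => ?_) j l).symm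
    exact h.comm _ _ (by omega)
  | σ, h, i + 1, j + 1, p :: l, hij, hl => by
    simp only [mergeSizes, faceSum]
    exact IsBraidSeq.faceSum_faceSum (h.shift p) i j l (by omega) (by simp at hl; omega)

end ShuffleSum

/-! ### Crossings as endomorphisms of the sum over all words -/

section CrossT

variable {k : Type u} [Field k] {Y : Bool → Type u} [∀ b, AddCommGroup (Y b)]
  [∀ b, Module k (Y b)] (R : ∀ a b, Y a ⊗[k] Y b →ₗ[k] Y b ⊗[k] Y a)

/-- The crossing in the places `i` and `i + 1`, on all tensors (`0` if there are no such
places). -/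
def crossT : ℕ → Module.End k (Tens k Y)
  | 0 => ofWords fun l => match l with
    | [] => 0
    | [_] => 0
    | a :: b :: l => ofW (b :: a :: l) ∘ₗ headMap (R a b) l
  | i + 1 => shiftT (crossT i)

theorem crossT_ofW : ∀ (i : ℕ) (l : List Bool) (x : WordTensor k Y l), i + 1 < l.length →
    crossT R i (ofW l x) = ofW (swapAt i l) (crossAt R i l x)
  | 0, [], _, h => by simp at h
  | 0, [_], _, h => by simp at h
  | 0, a :: b :: l, x, _ => by
    rw [crossT, ofWords_ofW]; rfl
  | i + 1, [], _, h => by simp at h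
  | i + 1, a :: l, x, h => by
    refine LinearMap.congr_fun (f := crossT R (i + 1) ∘ₗ ofW (a :: l))
      (g := ofW (swapAt (i + 1) (a :: l)) ∘ₗ crossAt R (i + 1) (a :: l))
      (wordTensor_cons_ext fun v x => ?_) x
    rw [LinearMap.comp_apply, ← consT_ofW, crossT, shiftT_cons,
      crossT_ofW i l x (by simpa using h), consT_ofW]
    rfl

theorem crossT_short : ∀ (i : ℕ) (l : List Bool) (x : WordTensor k Y l), l.length ≤ i + 1 →
    crossT R i (ofW l x) = 0
  | 0, [], _, _ => by rw [crossT, ofWords_ofW]; rfl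
  | 0, [_], _, _ => by rw [crossT, ofWords_ofW]; rfl
  | 0, _ :: _ :: _, _, h => by simp at h
  | i + 1, [], x, _ => by
    obtain ⟨t, rfl⟩ := wordTensor_nil x
    rw [map_smul, map_smul, crossT]
    exact (congrArg _ (shiftT_one _)).trans (smul_zero _)
  | i + 1, a :: l, x, h => by
    refine LinearMap.congr_fun (f := crossT R (i + 1) ∘ₗ ofW (a :: l))
      (g := 0) (wordTensor_cons_ext fun v x => ?_) x
    rw [LinearMap.comp_apply, ← consT_ofW, crossT, shiftT_cons,
      crossT_short i l x (by simpa using h), map_zero]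
    rfl

theorem crossT_cons (i : ℕ) (a : Bool) (v : Y a) (X : Tens k Y) :
    crossT R (i + 1) (consT a v X) = consT a v (crossT R i X) := shiftT_cons ..

theorem crossT_one (i : ℕ) : crossT R i (oneT k Y) = 0 :=
  crossT_short R i [] _ (by simp)

theorem crossT_ofW_cons {a : Bool} {i : ℕ} {l l' : List Bool}
    {g : WordTensor k Y l →ₗ[k] WordTensor k Y l'}
    (h : ∀ x, crossT R i (ofW l x) = ofW l' (g x)) (x : WordTensor k Y (a :: l)) :
    crossT R (i + 1) (ofW (a :: l) x) = ofW (a :: l') (tailMap a g x) := by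
  refine LinearMap.congr_fun (f := crossT R (i + 1) ∘ₗ ofW (a :: l))
    (g := ofW (a :: l') ∘ₗ tailMap a g) (wordTensor_cons_ext fun v x => ?_) x
  rw [LinearMap.comp_apply, ← consT_ofW, crossT_cons, h, consT_ofW]
  rfl

theorem crossT_zero (a b : Bool) (l : List Bool) (x : WordTensor k Y (a :: b :: l)) :
    crossT R 0 (ofW (a :: b :: l) x) = ofW (b :: a :: l) (headMap (R a b) l x) := by
  rw [crossT, ofWords_ofW]; rfl

-- On words that are long enough these are the Yang-Baxter equation and the commutation of maps on
-- disjoint factors. On shorter words both sides vanish thanks to the default value `0`; the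
-- identity as default would violate the braid relation at the end of a word.
variable {R} in
theorem crossT_isBraidSeq
    (hR : ∀ a b c, tensorId (Y a) (R b c) ∘ₗ (R a c).lTensor (Y b) ∘ₗ tensorId (Y c) (R a b) =
      (R a b).lTensor (Y c) ∘ₗ tensorId (Y b) (R a c) ∘ₗ (R b c).lTensor (Y a)) :
    IsBraidSeq (crossT R) where
  comm := by
    intro i
    induction i with
    | zero =>
      intro j hj
      obtain ⟨j, rfl⟩ : ∃ j', j = j' + 1 + 1 := ⟨j - 2, by omega⟩
      refine tens_ext_ofW fun l x => ?_
      simp only [Module.End.mul_apply]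
      rcases l with _ | ⟨a, _ | ⟨b, l⟩⟩
      · rw [crossT_short R _ [] x (by simp), crossT_short R _ [] x (by simp), map_zero, map_zero]
      · rw [crossT_short R _ _ x (by simp), crossT_short R _ _ x (by simp), map_zero, map_zero]
      · by_cases h : j + 1 < l.length
        · have e := fun x => crossT_ofW R j l x h
          rw [crossT_zero, crossT_ofW_cons R (crossT_ofW_cons R e),
            crossT_ofW_cons R (crossT_ofW_cons R e), crossT_zero]
          exact congrArg _ (LinearMap.congr_fun (headMap_tailMap (R a b) (crossAt R j l)) x)
        · rw [crossT_zero, crossT_short R _ _ _ (by simp; omega),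
            crossT_short R _ _ _ (by simp; omega), map_zero]
    | succ i ih =>
      intro j hj
      obtain ⟨j, rfl⟩ : ∃ j', j = j' + 1 := ⟨j - 1, by omega⟩
      refine tens_ext ?_ fun a v X _ => ?_
      · simp only [Module.End.mul_apply, crossT_one, map_zero]
      · simp only [Module.End.mul_apply, crossT_cons]
        exact congrArg _ (LinearMap.congr_fun (ih j (by omega)) X)
  braid := by
    intro i
    induction i with
    | zero =>
      refine tens_ext_ofW fun l x => ?_
      simp only [Module.End.mul_apply]
      rcases l with _ | ⟨a, _ | ⟨b, _ | ⟨c, l⟩⟩⟩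
      · simp only [crossT_short R _ [] x (by simp), map_zero]
      · simp only [crossT_short R _ [a] x (by simp), map_zero]
      · rw [crossT_zero, crossT_short R (0 + 1) [b, a] _ (by simp),
          crossT_short R (0 + 1) _ _ (by simp)]
        simp only [map_zero]
      · simp only [crossT_zero, crossT_ofW_cons R (crossT_zero R _ _ _)]
        refine congrArg _ ?_
        refine LinearMap.congr_fun (f := headMap (R b c) (a :: l) ∘ₗ
          tailMap b (headMap (R a c) l) ∘ₗ headMap (R a b) (c :: l))
          (g := tailMap c (headMap (R a b) l) ∘ₗ headMap (R a c) (b :: l) ∘ₗ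
            tailMap a (headMap (R b c) l)) (cons3_ext fun t x => ?_) x
        simp only [LinearMap.comp_apply, headMap_cons3, tailMap_headMap_cons3]
        exact congrArg (fun t => cons3 c b a l t x) (LinearMap.congr_fun (hR a b c) t)
    | succ i ih =>
      refine tens_ext ?_ fun a v X _ => ?_
      · simp only [Module.End.mul_apply, crossT_one, map_zero]
      · simp only [Module.End.mul_apply, crossT_cons]
        exact congrArg _ (LinearMap.congr_fun ih X)

theorem crossT_mem_supp (i : ℕ) {N m : ℕ} {X : Tens k Y} (hX : X ∈ supp k Y N m) :
    crossT R i X ∈ supp k Y N m := by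
  refine supp_induction (p := fun X => crossT R i X ∈ supp k Y N m) ?_ (by simp) ?_ hX
  · rintro l x rfl rfl
    by_cases h : i + 1 < l.length
    · rw [crossT_ofW R i l x h]
      have := ofW_mem_supp (swapAt i l) (crossAt R i l x)
      rwa [(swapAt_perm i l).length_eq, (swapAt_perm i l).count_eq] at this
    · rw [crossT_short R i l x (by omega)]
      exact Submodule.zero_mem _
  · intro x y hx hy
    rw [map_add]; exact Submodule.add_mem _ hx hy

theorem crossT_mulT_left (l : List Bool) (x : WordTensor k Y l) (i : ℕ) (Z : Tens k Y) :
    crossT R (i + l.length) (mulT (ofW l x) Z) = mulT (ofW l x) (crossT R i Z) := by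
  induction l with
  | nil =>
    obtain ⟨t, rfl⟩ := wordTensor_nil x
    simp only [map_smul, LinearMap.smul_apply]
    rw [show ofW [] (nilW k Y) = oneT k Y from rfl, mulT_one, mulT_one]; rfl
  | cons a l ih =>
    refine wordTensor_cons_induction
      (p := fun x => crossT R (i + (a :: l).length) (mulT (ofW (a :: l) x) Z) =
        mulT (ofW (a :: l) x) (crossT R i Z)) (fun v x => ?_) ?_ ?_ x
    · rw [← consT_ofW, mulT_cons, List.length_cons, ← add_assoc, crossT_cons, ih, mulT_cons]
    · simp
    · intro x x' h h'
      simp only [map_add, LinearMap.add_apply, h, h']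

theorem crossT_mulT_right : ∀ (i : ℕ) (l : List Bool) (x : WordTensor k Y l) (Z : Tens k Y),
    i + 1 < l.length → crossT R i (mulT (ofW l x) Z) = mulT (crossT R i (ofW l x)) Z
  | 0, [], _, _, h => by simp at h
  | 0, [_], _, _, h => by simp at h
  | 0, a :: b :: l, x, Z, _ => by
    refine LinearMap.congr_fun (f := crossT R 0 ∘ₗ mulT.flip Z ∘ₗ ofW (a :: b :: l))
      (g := mulT.flip Z ∘ₗ crossT R 0 ∘ₗ ofW (a :: b :: l)) (cons2_ext fun t x => ?_) x
    -- The operator that puts `t` in front is defined on words of all lengths. It commutes with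
    -- multiplication by `Z` from the right, and the crossing only replaces `t` by its image.
    have key : ∀ (a b : Bool) (t : Y a ⊗[k] Y b), mulT (ofW (a :: b :: l) (cons2 a b l t x)) Z =
        ofWords (fun l' => ofW (a :: b :: l') ∘ₗ cons2 a b l' t) (mulT (ofW l x) Z) := by
      intro a b t
      induction t using TensorProduct.induction_on with
      | zero =>
        simp only [map_zero, LinearMap.zero_apply, LinearMap.comp_zero]
        exact (LinearMap.congr_fun (f := ofWords (k := k) (Y := Y) _) (g := (0 : Tens k Y →ₗ[k] Tens k Y))
          (tens_ext_ofW fun l x => by rw [ofWords_ofW]; rfl) _).symm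
      | tmul v w =>
        rw [cons2_tmul, ← consT_ofW, ← consT_ofW, mulT_cons, mulT_cons]
        refine LinearMap.congr_fun (f := consT a v ∘ₗ consT b w) (g := ofWords (k := k) (Y := Y) _)
          (tens_ext_ofW fun l x => ?_) _
        rw [ofWords_ofW, LinearMap.comp_apply, consT_ofW, consT_ofW]; rfl
      | add s t hs ht =>
        simp only [map_add, LinearMap.add_apply, hs, ht]
        refine LinearMap.congr_fun (f := ofWords (k := k) (Y := Y) (M := Tens k Y) _ +
          ofWords (k := k) (Y := Y) (M := Tens k Y) _)
          (g := ofWords (k := k) (Y := Y) (M := Tens k Y) _)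
          (tens_ext_ofW fun l x => ?_) _
        simp only [LinearMap.add_apply, ofWords_ofW, LinearMap.comp_apply, map_add]
    simp only [LinearMap.comp_apply, LinearMap.flip_apply]
    rw [crossT_zero, headMap_cons2, key, key]
    refine LinearMap.congr_fun (f := crossT R 0 ∘ₗ ofWords (k := k) (Y := Y) _) (g := ofWords (k := k) (Y := Y) _)
      (tens_ext_ofW fun l x => ?_) _
    simp only [LinearMap.comp_apply, ofWords_ofW, crossT_zero, headMap_cons2]
  | i + 1, [], _, _, h => by simp at h
  | i + 1, a :: l, x, Z, h => by
    refine LinearMap.congr_fun (f := crossT R (i + 1) ∘ₗ mulT.flip Z ∘ₗ ofW (a :: l))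
      (g := mulT.flip Z ∘ₗ crossT R (i + 1) ∘ₗ ofW (a :: l))
      (wordTensor_cons_ext fun v x => ?_) x
    simp only [LinearMap.comp_apply, LinearMap.flip_apply]
    rw [← consT_ofW, mulT_cons, crossT_cons, crossT_cons, mulT_cons,
      crossT_mulT_right i l x Z (by simpa using h)]

theorem crossT_mulT {N m i : ℕ} (h : i + 1 < N) {X : Tens k Y} (hX : X ∈ supp k Y N m)
    (Z : Tens k Y) : crossT R i (mulT X Z) = mulT (crossT R i X) Z := by
  refine supp_induction (p := fun X => crossT R i (mulT X Z) = mulT (crossT R i X) Z) ?_ (by simp)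
    ?_ hX
  · rintro l x rfl -
    exact crossT_mulT_right R i l x Z h
  · intro x y hx hy
    simp only [map_add, LinearMap.add_apply, hx, hy]

theorem wordProd_crossT_mem_supp (w : List ℕ) {N m : ℕ} {X : Tens k Y} (hX : X ∈ supp k Y N m) :
    wordProd (crossT R) w X ∈ supp k Y N m := by
  induction w with
  | nil => simpa [wordProd] using hX
  | cons i w ih =>
    simp only [wordProd, List.map_cons, List.prod_cons, Module.End.mul_apply] at ih ⊢
    exact crossT_mem_supp R i ih

theorem wordProd_crossT_mulT (w : List ℕ) {N m : ℕ} (h : ∀ i ∈ w, i + 1 < N) {X : Tens k Y}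
    (hX : X ∈ supp k Y N m) (Z : Tens k Y) :
    wordProd (crossT R) w (mulT X Z) = mulT (wordProd (crossT R) w X) Z := by
  induction w with
  | nil => simp [wordProd]
  | cons i w ih =>
    have h1 := ih fun i hi => h i (List.mem_cons_of_mem _ hi)
    have h2 := wordProd_crossT_mem_supp R w hX
    simp only [wordProd, List.map_cons, List.prod_cons, Module.End.mul_apply] at h1 h2 ⊢
    rw [h1, crossT_mulT R (h i List.mem_cons_self) h2]

/-- Change the crossing of two letters `true` to `0`. -/
def noTrueCross : ∀ a b, Y a ⊗[k] Y b →ₗ[k] Y b ⊗[k] Y a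
  | true, true => 0
  | false, b => R false b
  | true, false => R true false

theorem crossAt_noTrueCross : ∀ (i : ℕ) (l : List Bool), l.count true ≤ 1 →
    crossAt (noTrueCross R) i l = crossAt R i l
  | 0, [], _ => rfl
  | 0, [_], _ => rfl
  | 0, true :: true :: l, h => by simp at h
  | 0, false :: _ :: _, _ => rfl
  | 0, true :: false :: _, _ => rfl
  | i + 1, [], _ => rfl
  | i + 1, a :: l, h => by
    have := crossAt_noTrueCross i l (by rw [List.count_cons] at h; omega)
    change tailMap a (crossAt _ i l) = tailMap a (crossAt _ i l)
    rw [this]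

/-- On words with at most one letter `true`, the crossing of two such letters does not matter. -/
theorem wordProd_noTrueCross (w : List ℕ) (l : List Bool) (h : ∀ i ∈ w, i + 1 < l.length)
    (hl : l.count true ≤ 1) (x : WordTensor k Y l) :
    wordProd (crossT (noTrueCross R)) w (ofW l x) = ofW (wordSwap w l) (wordCross R w l x) := by
  induction w with
  | nil => rfl
  | cons i w ih =>
    have h1 := ih fun i hi => h i (List.mem_cons_of_mem _ hi)
    simp only [wordProd, List.map_cons, List.prod_cons, Module.End.mul_apply] at h1 ⊢
    rw [h1, crossT_ofW _ _ _ _ (by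
      rw [(wordSwap_perm w l).length_eq]; exact h i List.mem_cons_self),
      crossAt_noTrueCross _ _ _ (by rw [(wordSwap_perm w l).count_eq]; exact hl)]
    rfl

theorem crossT_neg {R R' : ∀ a b, Y a ⊗[k] Y b →ₗ[k] Y b ⊗[k] Y a} (h : ∀ a b, R' a b = -R a b)
    (i : ℕ) : crossT R' i = -crossT R i := by
  induction i with
  | zero =>
    refine tens_ext_ofW fun l x => ?_
    rcases l with _ | ⟨a, _ | ⟨b, l⟩⟩
    · rw [LinearMap.neg_apply, crossT_short _ _ [] _ (by simp), crossT_short _ _ [] _ (by simp)]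
      simp
    · rw [LinearMap.neg_apply, crossT_short _ _ _ _ (by simp), crossT_short _ _ _ _ (by simp)]
      simp
    · rw [LinearMap.neg_apply, crossT_zero, crossT_zero, h, headMap_neg, LinearMap.neg_apply,
        map_neg]
  | succ i ih =>
    refine tens_ext ?_ fun a v X _ => ?_
    · rw [LinearMap.neg_apply, crossT_one, crossT_one, neg_zero]
    · rw [LinearMap.neg_apply, crossT_cons, crossT_cons, ih, LinearMap.neg_apply, map_neg]

/-- The source of the sign `(-1)^{|γ|}` in the differential of `D(n,m)_*`: every crossing of the
sign-twisted braiding contributes one factor `-1`. -/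
theorem wordProd_neg {A : Type*} [Ring A] {σ σ' : ℕ → A} (h : ∀ i, σ' i = -σ i) (w : List ℕ) :
    wordProd σ' w = (-1) ^ w.length * wordProd σ w := by
  induction w with
  | nil => simp [wordProd]
  | cons i w ih =>
    have : (-1 : A) ^ w.length * σ i = σ i * (-1) ^ w.length :=
      ((Commute.neg_one_left (σ i)).pow_left _).eq
    simp only [wordProd, List.map_cons, List.prod_cons, List.length_cons] at ih ⊢
    rw [ih, h, pow_succ, neg_mul, ← mul_assoc, ← this]
    simp [mul_assoc]

end CrossT

/-! ### Shuffles, the places of their last elements, and their lifts -/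

section ShufflePlaces

theorem liftWord_shift (l : List ℕ) : ∀ p, liftWord (p + 1) (l.map (1 + ·)) =
    (liftWord p l).map (1 + ·) := by
  induction l with
  | nil => intro p; rfl
  | cons i l ih =>
    intro p
    rw [List.map_cons, liftWord, liftWord, ih, List.map_append, List.map_add_range',
      show p + 1 - (1 + i) = p - i by omega]

theorem liftWord_bound (l : List ℕ) : ∀ p, ∀ j ∈ liftWord p l, j + 1 < p + l.length := by
  induction l with
  | nil => intro p j hj; simp [liftWord] at hj
  | cons i l ih =>
    intro p j hj
    rw [liftWord, List.mem_append, List.mem_range'_1] at hj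
    rw [List.length_cons]
    rcases hj with hj | hj
    · have := ih _ j hj; omega
    · omega

/-- The possible lists of the places to which a `(p,q)`-shuffle sends the last `q` elements. -/
def IsPlaces (p q : ℕ) (l : List ℕ) : Prop :=
  l.length = q ∧ l.Pairwise (· < ·) ∧ ∀ y ∈ l, y < p + q

theorem eq_of_pairwise_lt {l l' : List ℕ} (hl : l.Pairwise (· < ·)) (hl' : l'.Pairwise (· < ·))
    (hlen : l'.length ≤ l.length) (h : l ⊆ l') : l = l' := by
  have n1 : l.Nodup := hl.imp ne_of_lt
  exact ((List.subperm_of_subset n1 h).perm_of_length_le hlen).eq_of_pairwise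
    (fun a b _ _ h h' => absurd (lt_trans h h') (lt_irrefl a)) hl hl'

/-- The set of all these lists. -/
def shufflePlaces : ℕ → ℕ → Finset (List ℕ)
  | 0, q => {List.range q}
  | _ + 1, 0 => {[]}
  | p + 1, q + 1 => (shufflePlaces p (q + 1)).image (List.map (1 + ·)) ∪
      (shufflePlaces (p + 1) q).image (fun l => 0 :: l.map (1 + ·))
termination_by p q => p + q

theorem map_succ_pred {l : List ℕ} (h : ∀ y ∈ l, 0 < y) :
    (l.map (fun y => y - 1)).map (1 + ·) = l := by
  rw [List.map_map]
  conv_rhs => rw [← List.map_id l]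
  refine List.map_congr_left fun y hy => ?_
  have := h y hy
  simp only [Function.comp_apply, id]; omega

theorem mem_shufflePlaces (p q : ℕ) (l : List ℕ) : l ∈ shufflePlaces p q ↔ IsPlaces p q l := by
  obtain ⟨N, hN⟩ : ∃ N, p + q = N := ⟨_, rfl⟩
  induction N generalizing p q l with
  | zero =>
    obtain ⟨rfl, rfl⟩ : p = 0 ∧ q = 0 := by omega
    rw [shufflePlaces, Finset.mem_singleton, IsPlaces]
    constructor
    · rintro rfl; simp
    · intro h; simpa using h.1
  | succ N ih =>
    rcases p with _ | p
    · rw [shufflePlaces, Finset.mem_singleton, IsPlaces]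
      constructor
      · rintro rfl
        exact ⟨by simp, List.pairwise_lt_range, by simp⟩
      · rintro ⟨h1, h2, h3⟩
        exact eq_of_pairwise_lt h2 List.pairwise_lt_range (by simp [h1]) fun y hy => by
          simpa using h3 y hy
    rcases q with _ | q
    · rw [shufflePlaces, Finset.mem_singleton, IsPlaces]
      constructor
      · rintro rfl; simp
      · intro h; simpa using h.1
    rw [shufflePlaces, Finset.mem_union, Finset.mem_image, Finset.mem_image]
    constructor
    · rintro (⟨l, hl, rfl⟩ | ⟨l, hl, rfl⟩)
      · obtain ⟨h1, h2, h3⟩ := (ih p (q + 1) l (by omega)).1 hl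
        refine ⟨by simpa using h1, List.pairwise_map.2 (h2.imp (by intros; omega)), ?_⟩
        intro y hy
        obtain ⟨z, hz, rfl⟩ := List.mem_map.1 hy
        have := h3 z hz
        omega
      · obtain ⟨h1, h2, h3⟩ := (ih (p + 1) q l (by omega)).1 hl
        refine ⟨by simpa using h1, List.pairwise_cons.2 ⟨?_,
          List.pairwise_map.2 (h2.imp (by intros; omega))⟩, ?_⟩
        · intro y hy
          obtain ⟨z, hz, rfl⟩ := List.mem_map.1 hy
          omega
        · intro y hy
          rcases List.mem_cons.1 hy with rfl | hy
          · omega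
          obtain ⟨z, hz, rfl⟩ := List.mem_map.1 hy
          have := h3 z hz
          omega
    · rintro ⟨h1, h2, h3⟩
      -- Either the first place is taken by one of the first elements, and all entries can be
      -- lowered by one; or `0` occurs in `l`, necessarily as its head since `l` increases.
      by_cases h0 : ∀ y ∈ l, 0 < y
      · refine Or.inl ⟨l.map (fun y => y - 1), (ih p (q + 1) _ (by omega)).2 ⟨by simpa using h1,
          ?_, ?_⟩, map_succ_pred h0⟩
        · refine List.pairwise_map.2 (h2.imp_of_mem fun {a b} ha hb hab => ?_)
          have := h0 a ha
          omega
        · intro y hy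
          obtain ⟨z, hz, rfl⟩ := List.mem_map.1 hy
          have := h3 z hz
          have := h0 z hz
          omega
      · push Not at h0
        obtain ⟨z, hz, hz0⟩ := h0
        rcases l with _ | ⟨i, l⟩
        · simp at h1
        rw [List.pairwise_cons] at h2
        obtain rfl : i = 0 := by
          rcases List.mem_cons.1 hz with rfl | hz
          · omega
          · have := h2.1 z hz; omega
        refine Or.inr ⟨l.map (fun y => y - 1), (ih (p + 1) q _ (by omega)).2 ⟨by simpa using h1,
          ?_, ?_⟩, by rw [map_succ_pred h2.1]⟩
        · refine List.pairwise_map.2 (h2.2.imp_of_mem fun {a b} ha hb hab => ?_)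
          have := h2.1 a ha
          omega
        · intro y hy
          obtain ⟨z, hz, rfl⟩ := List.mem_map.1 hy
          have := h3 z (List.mem_cons_of_mem _ hz)
          have := h2.1 z hz
          omega

/-- Both sides obey the same recursion on the element in the first place: the summand for lists
beginning with `0` has the extra factor `σ_0 ⋯ σ_p`, which is the last piece of `liftWord`. -/
theorem shuffleSum_eq_places {A : Type*} [Ring A] (σ : ℕ → A) (p q : ℕ) :
    shuffleSum σ p q = ∑ l ∈ shufflePlaces p q, wordProd σ (liftWord p l) := by
  obtain ⟨N, hN⟩ : ∃ N, p + q = N := ⟨_, rfl⟩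
  -- For `p = 0` the strands are already in place, so nothing crosses.
  have hzero : ∀ q s, liftWord s (List.range' s q) = [] := by
    intro q
    induction q with
    | zero => intro s; rfl
    | succ q ih => intro s; simp [List.range'_succ, liftWord, ih]
  have inj : Function.Injective (List.map (1 + ·)) := List.map_injective_iff.2 fun a b h => by
    simpa using h
  induction N generalizing σ p q with
  | zero =>
    obtain ⟨rfl, rfl⟩ : p = 0 ∧ q = 0 := by omega
    simp [shufflePlaces, shuffleSum_zero_left, liftWord, wordProd]
  | succ N ih =>
    rcases p with _ | p
    · rw [shuffleSum_zero_left, shufflePlaces, Finset.sum_singleton, List.range_eq_range', hzero]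
      rfl
    rcases q with _ | q
    · rw [shuffleSum_zero_right, shufflePlaces, Finset.sum_singleton]
      rfl
    rw [shuffleSum, shufflePlaces, Finset.sum_union, Finset.sum_image (fun a _ b _ h => inj h),
      Finset.sum_image (fun a _ b _ h => inj (List.cons.inj h).2), ih _ p (q + 1) (by omega),
      ih _ (p + 1) q (by omega), Finset.sum_mul]
    · refine congrArg₂ _ (Finset.sum_congr rfl fun l _ => ?_) (Finset.sum_congr rfl fun l _ => ?_)
      · rw [liftWord_shift, wordProd_shift]
      · rw [liftWord, liftWord_shift, wordProd_append, wordProd_shift]; rfl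
    · rw [Finset.disjoint_left]
      rintro _ h1 h2
      obtain ⟨l, _, rfl⟩ := Finset.mem_image.1 h1
      obtain ⟨l', _, e⟩ := Finset.mem_image.1 h2
      have : 0 ∈ l.map (1 + ·) := e ▸ List.mem_cons_self
      obtain ⟨z, _, hz⟩ := List.mem_map.1 this
      omega

/-- The braid `σ_i ⋯ σ_{p-1}` carries the strand `p` to `i` and keeps the order of the strands
before it, which stay among the first `p + 1` places; so the claim for `p` reduces to that for `p +
1`. The strand now in place `i` is not moved any more, and the later ones end in the larger places
`l`. -/
theorem liftWord_perm_mono {N : ℕ} : ∀ (l : List ℕ) (p : ℕ), p + l.length = N →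
    l.Pairwise (· < ·) → (∀ y ∈ l, y < N) →
      (∀ x y : Fin N, x < y → (y : ℕ) < p → braidPerm N (wordBraid N (liftWord p l)) x <
        braidPerm N (wordBraid N (liftWord p l)) y) ∧
      (∀ x y : Fin N, x < y → p ≤ (x : ℕ) → braidPerm N (wordBraid N (liftWord p l)) x <
        braidPerm N (wordBraid N (liftWord p l)) y) := by
  intro l
  induction l with
  | nil =>
    intro p h _ _
    simp only [wordBraid, liftWord, List.map_nil, List.prod_nil, map_one, Equiv.Perm.one_apply]
    exact ⟨fun x y h _ => h, fun x y h _ => h⟩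
  | cons i l ih =>
    intro p h hl hlt
    simp only [List.length_cons] at h
    have hl' := List.pairwise_cons.1 hl
    have hlt' : ∀ y ∈ l, y < N := fun y hy => hlt y (List.mem_cons_of_mem _ hy)
    -- By counting: the `N - p` distinct entries of `i :: l` all lie between `i` and `N - 1`.
    have ip : i ≤ p := by
      by_contra hc
      have hs : (i :: l).toFinset ⊆ Finset.Ico i N := by
        intro y hy
        rw [List.mem_toFinset] at hy
        rw [Finset.mem_Ico]
        refine ⟨?_, hlt y hy⟩
        rcases List.mem_cons.1 hy with rfl | hy
        · exact le_rfl
        · exact (hl'.1 y hy).le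
      have := Finset.card_le_card hs
      rw [List.toFinset_card_of_nodup (hl.imp (fun h => ne_of_lt h))] at this
      simp only [List.length_cons, Nat.card_Ico] at this
      omega
    obtain ⟨h1, h2⟩ := ih (p + 1) (by omega) hl'.2 hlt'
    obtain ⟨f1, f2⟩ := liftWord_perm (N := N) l (p + 1) (by omega) hl'.2 hlt'
    have hr := range'_perm (N := N) (p - i) i (by omega)
    simp only [liftWord, wordBraid_append, map_mul, Equiv.Perm.mul_apply]
    constructor
    · intro x y hxy hy
      have hx' := hr x
      have hy' := hr y
      have hxy' : (x : ℕ) < y := hxy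
      refine h1 _ _ ?_ ?_
      · rw [Fin.lt_def, hx', hy']
        split_ifs <;> omega
      · rw [hy']
        split_ifs <;> omega
    · intro x y hxy hx
      have hx' := hr x
      have hy' := hr y
      have hxy' : (x : ℕ) < y := hxy
      rw [if_neg (by omega), if_neg (by omega)] at hy'
      have ey : braidPerm N (wordBraid N (List.range' i (p - i))) y = y := Fin.ext hy'
      rw [ey]
      rcases Nat.eq_or_lt_of_le hx with hx | hx
      · rw [if_pos (by omega)] at hx'
        rw [f1 _ (fun y hy => by rw [hx']; exact hl'.1 y hy) (by omega), Fin.lt_def, hx']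
        exact hl'.1 _ (f2 y (by omega))
      · rw [if_neg (by omega), if_neg (by omega)] at hx'
        have ex : braidPerm N (wordBraid N (List.range' i (p - i))) x = x := Fin.ext hx'
        rw [ex]
        exact h2 x y hxy (by omega)

/-- The places to which a permutation sends the last `q` elements. -/
def lastPlaces (p q : ℕ) (γ : Equiv.Perm (Fin (p + q))) : List ℕ :=
  List.ofFn fun x : Fin q => (γ (Fin.natAdd p x) : ℕ)

theorem lastPlaces_isPlaces {p q : ℕ} {γ : Equiv.Perm (Fin (p + q))} (h : γ ∈ shuffles p q) :
    IsPlaces p q (lastPlaces p q γ) := by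
  rw [shuffles, Finset.mem_filter] at h
  refine ⟨by simp [lastPlaces], List.pairwise_ofFn.2 fun i j hij => ?_, ?_⟩
  · exact h.2.2 _ _ (by simpa using hij) (by simp)
  · simp [lastPlaces, List.mem_ofFn]

/-- The places of the last `q` elements determine the set of places left for the first `p`, and an
order-preserving map from `p` elements is determined by its image. -/
theorem lastPlaces_injOn {p q : ℕ} {γ γ' : Equiv.Perm (Fin (p + q))} (h : γ ∈ shuffles p q)
    (h' : γ' ∈ shuffles p q) (e : lastPlaces p q γ = lastPlaces p q γ') : γ = γ' := by
  rw [shuffles, Finset.mem_filter] at h h'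
  have e1 : ∀ j : Fin q, γ (Fin.natAdd p j) = γ' (Fin.natAdd p j) := fun j =>
    Fin.ext (congrFun (List.ofFn_injective e) j)
  have range_eq : ∀ γ : Equiv.Perm (Fin (p + q)), Set.range (fun j : Fin p => γ (Fin.castAdd q j)) =
      (Set.range fun j : Fin q => γ (Fin.natAdd p j))ᶜ := by
    intro γ
    ext y
    simp only [Set.mem_range, Set.mem_compl_iff, not_exists]
    constructor
    · rintro ⟨j, rfl⟩ i hi
      have := congrArg Fin.val (γ.injective hi)
      simp at this
      omega
    · intro hy
      obtain ⟨x, rfl⟩ := γ.surjective y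
      induction x using Fin.addCases with
      | left j => exact ⟨j, rfl⟩
      | right j => exact absurd rfl (hy j)
  have e2 : (fun j : Fin p => γ (Fin.castAdd q j)) = fun j : Fin p => γ' (Fin.castAdd q j) := by
    have hm : StrictMono fun j : Fin p => γ (Fin.castAdd q j) := fun i j hij =>
      h.2.1 _ _ hij j.2
    have hm' : StrictMono fun j : Fin p => γ' (Fin.castAdd q j) := fun i j hij =>
      h'.2.1 _ _ hij j.2
    refine (hm.range_inj hm').1 ?_
    rw [range_eq, range_eq]
    simp only [e1]
  ext x
  induction x using Fin.addCases with
  | left j => exact congrArg Fin.val (congrFun e2 j)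
  | right j => exact congrArg Fin.val (e1 j)

theorem liftWord_perm_places {p q : ℕ} {l : List ℕ} (hl : IsPlaces p q l) :
    braidPerm (p + q) (wordBraid (p + q) (liftWord p l)) ∈ shuffles p q ∧
      lastPlaces p q (braidPerm (p + q) (wordBraid (p + q) (liftWord p l))) = l := by
  obtain ⟨h1, h2⟩ := liftWord_perm_mono (N := p + q) l p (by rw [hl.1]) hl.2.1 hl.2.2
  obtain ⟨f1, f2⟩ := liftWord_perm (N := p + q) l p (by rw [hl.1]) hl.2.1 hl.2.2
  have hs : braidPerm (p + q) (wordBraid (p + q) (liftWord p l)) ∈ shuffles p q := by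
    rw [shuffles, Finset.mem_filter]
    exact ⟨Finset.mem_univ _, h1, h2⟩
  refine ⟨hs, eq_of_pairwise_lt (lastPlaces_isPlaces hs).2.1 hl.2.1 (by simp [lastPlaces, hl.1]) ?_⟩
  intro y hy
  rw [lastPlaces, List.mem_ofFn] at hy
  obtain ⟨j, rfl⟩ := hy
  exact f2 _ (by simp)

/-- The lift is built from the places of the last elements, realises a shuffle with these places,
and there is only one such shuffle. -/
theorem braidPerm_shuffleWord {p q : ℕ} {γ : Equiv.Perm (Fin (p + q))} (h : γ ∈ shuffles p q) :
    braidPerm (p + q) (wordBraid (p + q) (shuffleWord p q γ)) = γ := by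
  obtain ⟨h1, h2⟩ := liftWord_perm_places (lastPlaces_isPlaces h)
  exact lastPlaces_injOn h1 h h2

/-- `shuffleSum` is the sum over all shuffles of the products spelled by their lifts. -/
theorem shuffleSum_eq {A : Type*} [Ring A] (σ : ℕ → A) (p q : ℕ) :
    shuffleSum σ p q = ∑ γ ∈ shuffles p q, wordProd σ (shuffleWord p q γ) := by
  rw [shuffleSum_eq_places]
  refine (Finset.sum_bij (fun γ _ => lastPlaces p q γ) (fun γ hγ => ?_) (fun γ hγ γ' hγ' e => ?_)
    (fun l hl => ?_) (fun γ _ => rfl)).symm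
  · exact (mem_shufflePlaces _ _ _).2 (lastPlaces_isPlaces hγ)
  · exact lastPlaces_injOn hγ hγ' e
  · obtain ⟨h1, h2⟩ := liftWord_perm_places ((mem_shufflePlaces _ _ _).1 hl)
    exact ⟨_, h1, h2⟩

theorem shuffleWord_bound {p q : ℕ} (γ : Equiv.Perm (Fin (p + q))) :
    ∀ i ∈ shuffleWord p q γ, i + 1 < p + q := by
  intro i hi
  have := liftWord_bound _ _ i hi
  simpa using this

theorem sign_wordBraid {N : ℕ} (w : List ℕ) (h : ∀ i ∈ w, i + 1 < N) :
    Equiv.Perm.sign (braidPerm N (wordBraid N w)) = (-1) ^ w.length := by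
  induction w with
  | nil => simp [wordBraid]
  | cons i w ih =>
    have h1 := ih fun i hi => h i (List.mem_cons_of_mem _ hi)
    have h2 := h i List.mem_cons_self
    have : wordBraid N (i :: w) = braidGen N i * wordBraid N w := by simp [wordBraid]
    rw [this, map_mul, Equiv.Perm.sign_mul, h1, braidPerm_gen h2, placeSwap, dif_pos h2,
      Equiv.Perm.sign_swap (by simp), List.length_cons, pow_succ, mul_comm]

theorem sign_shuffle {p q : ℕ} {γ : Equiv.Perm (Fin (p + q))} (h : γ ∈ shuffles p q) :
    Equiv.Perm.sign γ = (-1) ^ (shuffleWord p q γ).length := by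
  rw [← sign_wordBraid _ (shuffleWord_bound γ), braidPerm_shuffleWord h]

end ShufflePlaces

/-! ### Intertwining maps -/

section Intertwines

variable {k : Type u} [Field k] {L L' L'' : Type u} [AddCommGroup L] [Module k L]
  [AddCommGroup L'] [Module k L'] [AddCommGroup L''] [Module k L'']

/-- `P` intertwines the automorphisms `g` and `g'`. -/
def Intertwines (P : L →ₗ[k] L') (g : L ≃ₗ[k] L) (g' : L' ≃ₗ[k] L') : Prop :=
  P ∘ₗ g.toLinearMap = g'.toLinearMap ∘ₗ P

theorem Intertwines.mul {P : L →ₗ[k] L'} {g h : L ≃ₗ[k] L} {g' h' : L' ≃ₗ[k] L'}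
    (hg : Intertwines P g g') (hh : Intertwines P h h') : Intertwines P (g * h) (g' * h') := by
  ext x
  change P (g (h x)) = g' (h' (P x))
  rw [← show P (h x) = h' (P x) from LinearMap.congr_fun hh x]
  exact LinearMap.congr_fun hg (h x)

theorem Intertwines.inv {P : L →ₗ[k] L'} {g : L ≃ₗ[k] L} {g' : L' ≃ₗ[k] L'}
    (hg : Intertwines P g g') : Intertwines P g⁻¹ g'⁻¹ := by
  ext x
  change P (g.symm x) = g'.symm (P x)
  rw [LinearEquiv.eq_symm_apply]
  have : P (g (g.symm x)) = g' (P (g.symm x)) := LinearMap.congr_fun hg (g.symm x)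
  rw [← this, g.apply_symm_apply]

theorem Intertwines.conj {P : L →ₗ[k] L'} {g h : L ≃ₗ[k] L} {g' h' : L' ≃ₗ[k] L'}
    (hg : Intertwines P g g') (hh : Intertwines P h h') :
    Intertwines P (g * h * g⁻¹) (g' * h' * g'⁻¹) := (hg.mul hh).mul hg.inv

theorem Intertwines.comp {P : L →ₗ[k] L'} {Q : L' →ₗ[k] L''} {g : L ≃ₗ[k] L} {g' : L' ≃ₗ[k] L'}
    {g'' : L'' ≃ₗ[k] L''} (hQ : Intertwines Q g' g'') (hP : Intertwines P g g') :
    Intertwines (Q ∘ₗ P) g g'' := by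
  rw [Intertwines, LinearMap.comp_assoc, show P ∘ₗ g.toLinearMap = _ from hP,
    ← LinearMap.comp_assoc, show Q ∘ₗ g'.toLinearMap = _ from hQ, LinearMap.comp_assoc]

variable {Y : Bool → Type u} [∀ b, AddCommGroup (Y b)] [∀ b, Module k (Y b)]

/-- The action of automorphisms behind the first letter. -/
def tailHom (a : Bool) {l : List Bool} : (WordTensor k Y l ≃ₗ[k] WordTensor k Y l) →*
    (WordTensor k Y (a :: l) ≃ₗ[k] WordTensor k Y (a :: l)) :=
  (idTensorHom (k := k) (B := WordTensor k Y l) (Y a) :)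

theorem tailMap_id (a : Bool) (l : List Bool) :
    tailMap a (LinearMap.id : WordTensor k Y l →ₗ[k] WordTensor k Y l) = LinearMap.id :=
  wordTensor_cons_ext fun _ _ => rfl

theorem Intertwines.tail (a : Bool) {l l' : List Bool}
    {P : WordTensor k Y l →ₗ[k] WordTensor k Y l'} {g : WordTensor k Y l ≃ₗ[k] WordTensor k Y l}
    {g' : WordTensor k Y l' ≃ₗ[k] WordTensor k Y l'} (h : Intertwines P g g') :
    Intertwines (tailMap a P) (tailHom a g) (tailHom a g') := by
  change tailMap a P ∘ₗ tailMap a g.toLinearMap = tailMap a g'.toLinearMap ∘ₗ tailMap a P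
  rw [← tailMap_comp, ← tailMap_comp]
  exact congrArg _ h

theorem intertwines_headMap {a b a' b' : Bool} (r : Y a ⊗[k] Y b →ₗ[k] Y a' ⊗[k] Y b')
    {l : List Bool} (g : WordTensor k Y l ≃ₗ[k] WordTensor k Y l) :
    Intertwines (headMap r l) (tailHom a (tailHom b g)) (tailHom a' (tailHom b' g)) :=
  headMap_tailMap r g.toLinearMap

theorem intertwines_tail_tail (f : ∀ a b, Y a ⊗[k] Y b ≃ₗ[k] Y a ⊗[k] Y b) {a b : Bool}
    {l l' : List Bool} (P : WordTensor k Y l →ₗ[k] WordTensor k Y l') :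
    Intertwines (tailMap a (tailMap b P)) (opAt f 0 (a :: b :: l)) (opAt f 0 (a :: b :: l')) :=
  (headMap_tailMap (f a b).toLinearMap P).symm

end Intertwines

/-! ### Twists after adding a strand on the left -/

section TwistShift

variable {G G' : Type*} [Group G] [Group G']

theorem lastTwist_map {n : ℕ} (hn : 0 < n) {g : ℕ → G} {g' : ℕ → G'} {F : G →* G'}
    (h : ∀ j, g' (j + 1) = F (g j)) (k : ℕ) :
    lastTwist (n + 1) g' k = F (lastTwist n g k) := by
  induction k with
  | zero =>
    obtain ⟨n, rfl⟩ : ∃ n', n = n' + 1 := ⟨n - 1, by omega⟩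
    exact h n
  | succ k ih =>
    rw [lastTwist, lastTwist, ih, map_mul, map_mul, map_inv, ← h, show n + k + 1 = n + 1 + k by omega]

/-- A further strand on the left renumbers the generators, and the twist of a strand involves no
generator to the left of that strand. It is used with `F` the action behind a first letter. -/
theorem twist_map {n a : ℕ} (ha : a < n) {g : ℕ → G} {g' : ℕ → G'} {F : G →* G'}
    (h : ∀ j, g' (j + 1) = F (g j)) (k : ℕ) :
    twist (n + 1) g' (a + 1) k = F (twist n g a k) := by
  obtain ⟨d, hd⟩ : ∃ d, a + 1 + d = n := ⟨n - a - 1, by omega⟩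
  induction d generalizing a with
  | zero =>
    have e1 : a + 1 = n + 1 - 1 := by omega
    have e2 : a = n - 1 := by omega
    rw [e1, twist_last, e2, twist_last, lastTwist_map (by omega) h]
  | succ d ih =>
    rw [twist_left g' k (by omega), twist_left g k (by omega), ih (by omega) (by omega), h, map_mul,
      map_mul, map_inv]

end TwistShift

/-! ### Moving letters `W` to the left, and the arrangement of tensors along a word -/

section Front

variable {k : Type u} [Field k] {Y : Bool → Type u} [∀ b, AddCommGroup (Y b)]
  [∀ b, Module k (Y b)]

/-- `n` letters `false` in front of a word. -/
abbrev falseWord (n : ℕ) (u : List Bool) : List Bool := List.replicate n false ++ u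

/-- Move a letter `true` in front of `n` letters `false`. -/
def front (φ : Y false ⊗[k] Y true →ₗ[k] Y true ⊗[k] Y false) : ∀ (n : ℕ) (u : List Bool),
    WordTensor k Y (falseWord n (true :: u)) →ₗ[k] WordTensor k Y (true :: falseWord n u)
  | 0, _ => LinearMap.id
  | n + 1, u => (headMap φ (falseWord n u) ∘ₗ tailMap false (front φ n u) :)

/-- The equations for a separated braiding and the compatibility equation. -/
structure Separates (f : ∀ a b, Y a ⊗[k] Y b ≃ₗ[k] Y a ⊗[k] Y b)
    (φ : Y false ⊗[k] Y true →ₗ[k] Y true ⊗[k] Y false) : Prop where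
  braid : (f false false).toLinearMap.lTensor (Y true) ∘ₗ tensorId (Y false) φ ∘ₗ
      φ.lTensor (Y false) =
    tensorId (Y false) φ ∘ₗ φ.lTensor (Y false) ∘ₗ tensorId (Y true) (f false false).toLinearMap
  twist : tensorId (Y false) (f false true).toLinearMap ∘ₗ φ.lTensor (Y false) =
    φ.lTensor (Y false) ∘ₗ tensorId (Y true) (f false false).toLinearMap ∘ₗ
      (f false true).toLinearMap.lTensor (Y false) ∘ₗ
      tensorId (Y true) (f false false).symm.toLinearMap
  compatible : (f false true).toLinearMap.lTensor (Y true) ∘ₗ tensorId (Y true) φ =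
    tensorId (Y true) φ ∘ₗ (f true true).toLinearMap.lTensor (Y false) ∘ₗ
      tensorId (Y true) (f false true).toLinearMap ∘ₗ
      (f true true).symm.toLinearMap.lTensor (Y false)

variable {f : ∀ a b, Y a ⊗[k] Y b ≃ₗ[k] Y a ⊗[k] Y b}
  {φ : Y false ⊗[k] Y true →ₗ[k] Y true ⊗[k] Y false}

/-- A `W` that passes two adjacent `V` commutes with `σV` on them by the braid equation. All other
steps of its way take place on other factors. The index rises by one because the `W` now stands
before the letters `V`. -/
theorem front_false (h : Separates f φ) (u : List Bool) : ∀ (n a : ℕ), a + 2 ≤ n →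
    Intertwines (front φ n u) (opAt f a (falseWord n (true :: u)))
      (opAt f (a + 1) (true :: falseWord n u))
  | n + 2, 0, _ => by
    have h1 := intertwines_tail_tail f (a := false) (b := false) (front φ n u)
    -- The way of the `W` is split: past the last `n` letters, on which `σV` in the first two places
    -- has no effect, and then past the first two.
    have e : front φ (n + 2) u =
        (headMap φ (false :: falseWord n u) ∘ₗ tailMap false (headMap φ (falseWord n u))) ∘ₗ
          tailMap false (tailMap false (front φ n u)) :=
      congrArg (headMap φ (false :: falseWord n u) ∘ₗ ·) (tailMap_comp _ _ _)
    refine (congrArg (fun P => Intertwines P (opAt f 0 (falseWord (n + 2) (true :: u)))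
      (opAt f (0 + 1) (true :: falseWord (n + 2) u))) e).mpr
      (Intertwines.comp (g' := opAt f 0 (false :: false :: true :: falseWord n u)) ?_ h1)
    refine cons3_ext fun t x => ?_
    change headMap φ _ (tailMap false (headMap φ _) (headMap (f false false).toLinearMap _ _)) =
      tailMap true (headMap (f false false).toLinearMap _)
        (headMap φ _ (tailMap false (headMap φ _) _))
    rw [headMap_cons3, tailMap_headMap_cons3, headMap_cons3, tailMap_headMap_cons3, headMap_cons3,
      tailMap_headMap_cons3]
    exact congrArg (fun t => cons3 true false false _ t x) (LinearMap.congr_fun h.braid t).symm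
  | n + 1, a + 1, hn => by
    have h1 := (front_false h u n a (by omega)).tail false
    exact Intertwines.comp (intertwines_headMap φ (opAt f a (falseWord n u))) h1

theorem front_far (u : List Bool) : ∀ (n j : ℕ),
    Intertwines (front φ n u) (opAt f (n + j + 1) (falseWord n (true :: u)))
      (opAt f (n + j + 1) (true :: falseWord n u))
  | 0, j => rfl
  | n + 1, j => by
    have h1 := (front_far u n j).tail false
    rw [show n + 1 + j + 1 = (n + j + 1) + 1 by omega]
    exact Intertwines.comp (intertwines_headMap φ (opAt f (n + j) (falseWord n u))) h1

/-- Of two letters `W` the first is moved away. The last `V`, which wound around the second `W` by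
`σW τ σW⁻¹`, becomes its neighbour and winds around it by `τ`. At the first step past a `V` this is
the compatibility equation; the later steps do not touch the factors concerned. -/
theorem front_compatible (h : Separates f φ) (u : List Bool) : ∀ (n : ℕ),
    Intertwines (front φ (n + 1) (true :: u))
      (opAt f (n + 1) (falseWord (n + 1) (true :: true :: u)) *
        opAt f n (falseWord (n + 1) (true :: true :: u)) *
        (opAt f (n + 1) (falseWord (n + 1) (true :: true :: u)))⁻¹)
      (opAt f (n + 1) (true :: falseWord (n + 1) (true :: u)))
  | 0 => by
    refine cons3_ext fun t x => ?_
    have e : ∀ t, front φ (0 + 1) (true :: u) (cons3 false true true u t x) =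
        cons3 true false true u (tensorId (Y true) φ t) x := fun t =>
      (congrArg (headMap φ (true :: u)) (LinearMap.congr_fun (tailMap_id _ _) _)).trans
        (headMap_cons3 φ u t x)
    change front φ (0 + 1) (true :: u) (tailMap false (headMap (f true true).toLinearMap _)
      (headMap (f false true).toLinearMap _
        (tailMap false (headMap (f true true).symm.toLinearMap _) _))) =
      tailMap true (headMap (f false true).toLinearMap _) (front φ (0 + 1) (true :: u) _)
    rw [tailMap_headMap_cons3, headMap_cons3, tailMap_headMap_cons3, e, e, tailMap_headMap_cons3]
    exact congrArg (fun t => cons3 true false true _ t x) (LinearMap.congr_fun h.compatible t).symm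
  | n + 1 => by
    have h1 := (front_compatible h u n).tail false
    rw [map_mul, map_mul, map_inv] at h1
    exact Intertwines.comp
      (intertwines_headMap φ (opAt f n (falseWord (n + 1) (true :: u)))) h1

/-- The `W` is moved up to the first `V`, past the `n` others. Each `V` passed removes one
conjugation by a `σV` from the twist, by the twist equation, until `τ` on neighbours remains. -/
theorem front_twist (h : Separates f φ) (u : List Bool) : ∀ (n : ℕ),
    Intertwines (L := WordTensor k Y (falseWord (n + 1) (true :: u))) (tailMap false (front φ n u))
      (twist (n + 1) (fun j => opAt f j (falseWord (n + 1) (true :: u))) 0 0)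
      (opAt f 0 (false :: true :: falseWord n u))
  | 0 => by
    exact (congrArg (fun P => Intertwines P (opAt f 0 (false :: true :: u))
      (opAt f 0 (false :: true :: u))) (tailMap_id _ _)).mpr rfl
  | n + 1 => by
    -- The twist of the second `V` is that of the first `V` in the word without its first letter, so
    -- the induction applies behind this letter.
    have e1 : twist (n + 1 + 1) (fun j => opAt f j (falseWord (n + 1 + 1) (true :: u))) (0 + 1) 0 =
        tailHom false (twist (n + 1) (fun j => opAt f j (falseWord (n + 1) (true :: u))) 0 0) :=
      twist_map (n := n + 1) (a := 0)
        (g := fun j => opAt f j (falseWord (n + 1) (true :: u))) (F := tailHom false) (by omega)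
        (fun j => rfl) 0
    rw [twist_left _ _ (by omega), e1]
    have h0 := intertwines_tail_tail f (a := false) (b := false) (front φ n u)
    have h1 := h0.conj ((front_twist h u n).tail false)
    have e : tailMap false (front φ (n + 1) u) = tailMap false (headMap φ (falseWord n u)) ∘ₗ
      tailMap false (tailMap false (front φ n u)) := tailMap_comp _ _ _
    refine (congrArg (fun P => Intertwines P _ _) e).mpr (Intertwines.comp ?_ h1)
    refine cons3_ext fun t x => ?_
    change tailMap false (headMap φ _) (headMap (f false false).toLinearMap _
      (tailMap false (headMap (f false true).toLinearMap _)
        (headMap (f false false).symm.toLinearMap _ _))) =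
      headMap (f false true).toLinearMap _ (tailMap false (headMap φ _) _)
    rw [headMap_cons3, tailMap_headMap_cons3, headMap_cons3, tailMap_headMap_cons3,
      tailMap_headMap_cons3, headMap_cons3]
    exact congrArg (fun t => cons3 false true false _ t x) (LinearMap.congr_fun h.twist t).symm

/-- Once the first `W` is in front, the other letters `W` are counted from one less. The case of the
last `V` and the second `W` is `front_compatible`. From there `front_far` handles the conjugations
by `σW` that lead to later letters `W`, and `front_false` those by `σV` that lead to earlier letters
`V`. -/
theorem front_twist_succ (h : Separates f φ) (u : List Bool) {n a : ℕ} (ha : a < n) (k' : ℕ) :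
    Intertwines (front φ n (true :: u))
      (twist n (fun j => opAt f j (falseWord n (true :: true :: u))) a (k' + 1))
      (tailHom true (twist n (fun j => opAt f j (falseWord n (true :: u))) a k')) := by
  obtain ⟨d, hd⟩ : ∃ d, a + 1 + d = n := ⟨n - a - 1, by omega⟩
  induction d generalizing a with
  | zero =>
    obtain rfl : a = n - 1 := by omega
    rw [twist_last, twist_last]
    induction k' with
    | zero =>
      obtain ⟨n, rfl⟩ : ∃ n', n = n' + 1 := ⟨n - 1, by omega⟩
      exact front_compatible h u n
    | succ k' ih =>
      rw [lastTwist, lastTwist.eq_2 n (fun j => opAt f j (falseWord n (true :: u))), map_mul,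
        map_mul, map_inv]
      exact (front_far (true :: u) n k').conj ih
  | succ d ih =>
    rw [twist_left (n := n) (a := a) (fun j => opAt f j (falseWord n (true :: true :: u))) (k' + 1)
        (by omega),
      twist_left (n := n) (a := a) (fun j => opAt f j (falseWord n (true :: u))) k' (by omega),
      map_mul, map_mul, map_inv]
    exact (front_false h (true :: u) n a (by omega)).conj (ih (by omega) (by omega))

/-- The isomorphism of `V^{⊗ n} ⊗ W^{⊗ m}` with the tensor product along a word `l` in `n` letters
`false` and `m` letters `true` (`0` for other words). -/
def arrange (φ : Y false ⊗[k] Y true →ₗ[k] Y true ⊗[k] Y false) :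
    ∀ (l : List Bool) (n m : ℕ), WordTensor k Y (baseWord n m) →ₗ[k] WordTensor k Y l
  | [], 0, 0 => (LinearMap.id : WordTensor k Y [] →ₗ[k] WordTensor k Y [])
  | false :: l, n + 1, m => (tailMap false (arrange φ l n m) :)
  | true :: l, n, m + 1 => (tailMap true (arrange φ l n m) ∘ₗ front φ n (List.replicate m true) :)
  | _, _, _ => 0

/-- Let `g` act behind the letters `l₁`. -/
def dropMap : ∀ (l₁ : List Bool) {u u' : List Bool} (_ : WordTensor k Y u →ₗ[k] WordTensor k Y u'),
    WordTensor k Y (l₁ ++ u) →ₗ[k] WordTensor k Y (l₁ ++ u')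
  | [], _, _, g => g
  | a :: l₁, _, _, g => (tailMap a (dropMap l₁ g) :)

theorem dropMap_comp : ∀ (l₁ : List Bool) {u u' u'' : List Bool}
    (g' : WordTensor k Y u' →ₗ[k] WordTensor k Y u'')
    (g : WordTensor k Y u →ₗ[k] WordTensor k Y u'),
    dropMap l₁ (g' ∘ₗ g) = dropMap l₁ g' ∘ₗ dropMap l₁ g
  | [], _, _, _, _, _ => rfl
  | a :: l₁, _, _, _, g', g => by
    have := congrArg (tailMap a) (dropMap_comp l₁ g' g)
    rw [tailMap_comp] at this
    exact this

/-- Moving a letter `true` to the left past a letter `false`. -/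
theorem arrange_false_true : ∀ (l₁ u : List Bool) (n m : ℕ),
    dropMap l₁ (headMap φ u) ∘ₗ arrange φ (l₁ ++ false :: true :: u) n m =
      arrange φ (l₁ ++ true :: false :: u) n m
  | [], u, 0, 0 => LinearMap.comp_zero _
  | [], u, 0, m + 1 => by
    change headMap φ u ∘ₗ 0 = tailMap true (0 : WordTensor k Y (baseWord 0 m) →ₗ[k] _) ∘ₗ _
    have e : tailMap true (0 : WordTensor k Y (baseWord 0 m) →ₗ[k] WordTensor k Y (false :: u)) = 0 :=
      wordTensor_cons_ext fun v x => by rw [tailMap_cons]; simp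
    rw [e, LinearMap.comp_zero]; exact (LinearMap.zero_comp _).symm
  | [], u, n + 1, 0 => by
    change headMap φ u ∘ₗ tailMap false (0 : WordTensor k Y (baseWord n 0) →ₗ[k] _) = 0
    have e : tailMap false (0 : WordTensor k Y (baseWord n 0) →ₗ[k] WordTensor k Y (true :: u)) = 0 :=
      wordTensor_cons_ext fun v x => by rw [tailMap_cons]; simp
    rw [e]; exact LinearMap.comp_zero _
  | [], u, n + 1, m + 1 => by
    have e : tailMap false (arrange φ (true :: u) n (m + 1)) =
      tailMap false (tailMap true (arrange φ u n m)) ∘ₗ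
        tailMap false (front φ n (List.replicate m true)) := tailMap_comp _ _ _
    have h := headMap_tailMap φ (arrange φ u n m)
    have h2 := congrArg (· ∘ₗ tailMap false (front φ n (List.replicate m true))) h
    exact (congrArg (headMap φ u ∘ₗ ·) e).trans h2
  | false :: l₁, u, 0, m => LinearMap.comp_zero _
  | false :: l₁, u, n + 1, m => by
    have := congrArg (tailMap false) (arrange_false_true l₁ u n m)
    rw [tailMap_comp] at this
    exact this
  | true :: l₁, u, n, 0 => by cases n <;> exact LinearMap.comp_zero _
  | true :: l₁, u, n, m + 1 => by
    -- A first letter `W` contributes the same map `front` to both arrangements, applied before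
    -- everything else.
    have h := congrArg (tailMap true) (arrange_false_true l₁ u n m)
    rw [tailMap_comp] at h
    have h2 := congrArg (· ∘ₗ front φ n (List.replicate m true)) h
    cases n <;> exact h2

/-- The pair `V V` comes from the places of `V^{⊗ n}` counted by the letters `V` before it. Removing
letters of `l₁`, a `V` lowers the index by one, and a `W` is moved to the front, which is compatible
with `σV` by `front_false`. -/
theorem arrange_false_false (h : Separates f φ) : ∀ (l₁ u : List Bool) (n m : ℕ),
    (l₁ ++ false :: false :: u).count false = n →
    dropMap l₁ (headMap (f false false).toLinearMap u) ∘ₗ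
        arrange φ (l₁ ++ false :: false :: u) n m =
      arrange φ (l₁ ++ false :: false :: u) n m ∘ₗ
        (opAt f (l₁.count false) (baseWord n m)).toLinearMap
  | [], u, 0, m, hn => by simp at hn
  | [], u, 1, m, hn => by simp at hn
  | [], u, n + 2, m, hn => headMap_tailMap (f false false).toLinearMap (arrange φ u n m)
  | false :: l₁, u, 0, m, hn => by simp at hn
  | false :: l₁, u, n + 1, m, hn => by
    have h1 := congrArg (tailMap false) (arrange_false_false h l₁ u n m (by simpa using hn))
    rw [tailMap_comp, tailMap_comp] at h1
    rw [List.count_cons_self]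
    exact h1
  | true :: l₁, u, n, 0, hn => by
    cases n <;> exact (LinearMap.comp_zero _).trans (LinearMap.zero_comp _).symm
  | true :: l₁, u, n, m + 1, hn => by
    have hn' : (l₁ ++ false :: false :: u).count false = n := by simpa using hn
    have h1 := congrArg (tailMap true) (arrange_false_false h l₁ u n m hn')
    rw [tailMap_comp, tailMap_comp] at h1
    have h2 := congrArg (· ∘ₗ front φ n (List.replicate m true)) h1
    have h3 := front_false h (List.replicate m true) n (l₁.count false) (by
      simp at hn'; omega)
    have h4 := congrArg (tailMap true (arrange φ (l₁ ++ false :: false :: u) n m) ∘ₗ ·) h3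
    rw [show (true :: l₁).count false = l₁.count false by simp]
    have h5 := h2.trans h4.symm
    cases n <;> exact h5

/-- When `V` and `W` have become neighbours, `τ` on them is the twist of the original strands. With
nothing before them this is `front_twist`. A `V` before them is removed by `twist_map`, and a `W` by
`front_twist_succ`, which lowers the index of the `W` that is wound around. -/
theorem arrange_twist (h : Separates f φ) : ∀ (l₁ u : List Bool) (n m : ℕ),
    (l₁ ++ false :: true :: u).count false = n → (l₁ ++ false :: true :: u).count true = m →
    dropMap l₁ (headMap (f false true).toLinearMap u) ∘ₗ
        arrange φ (l₁ ++ false :: true :: u) n m =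
      arrange φ (l₁ ++ false :: true :: u) n m ∘ₗ
        (twist n (fun j => opAt f j (baseWord n m)) (l₁.count false) (l₁.count true)).toLinearMap
  | [], u, 0, m, hn, _ => by simp at hn
  | [], u, _, 0, _, hm => by simp at hm
  | [], u, n + 1, m + 1, hn, hm => by
    have e : tailMap false (arrange φ (true :: u) n (m + 1)) =
      tailMap false (tailMap true (arrange φ u n m)) ∘ₗ
        tailMap false (front φ n (List.replicate m true)) := tailMap_comp _ _ _
    have h1 := headMap_tailMap (f false true).toLinearMap (arrange φ u n m)
    have h2 := congrArg (· ∘ₗ tailMap false (front φ n (List.replicate m true))) h1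
    have h3 := front_twist h (List.replicate m true) n
    have h4 := congrArg (tailMap false (tailMap true (arrange φ u n m)) ∘ₗ ·) h3
    have h5 := h2.trans h4.symm
    exact (congrArg (headMap (f false true).toLinearMap u ∘ₗ ·) e).trans
      (h5.trans (congrArg (· ∘ₗ _) e.symm))
  | false :: l₁, u, 0, m, hn, _ => by simp at hn
  | false :: l₁, u, n + 1, m, hn, hm => by
    have hn' : (l₁ ++ false :: true :: u).count false = n := by simpa using hn
    have h1 := congrArg (tailMap false) (arrange_twist h l₁ u n m hn' (by simpa using hm))
    rw [tailMap_comp, tailMap_comp] at h1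
    have e1 : twist (n + 1) (fun j => opAt f j (baseWord (n + 1) m)) (l₁.count false + 1)
        (l₁.count true) = tailHom false
          (twist n (fun j => opAt f j (baseWord n m)) (l₁.count false) (l₁.count true)) :=
      twist_map (n := n) (a := l₁.count false) (g := fun j => opAt f j (baseWord n m))
        (F := tailHom false) (by simp at hn'; omega) (fun j => rfl) _
    rw [List.count_cons_self, show (false :: l₁).count true = l₁.count true by simp, e1]
    exact h1
  | true :: l₁, u, n, 0, _, hm => by simp at hm
  | true :: l₁, u, n, 1, _, hm => by simp at hm
  | true :: l₁, u, n, m + 2, hn, hm => by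
    have hn' : (l₁ ++ false :: true :: u).count false = n := by simpa using hn
    have h1 := congrArg (tailMap true) (arrange_twist h l₁ u n (m + 1) hn'
      (by simp at hm ⊢; omega))
    rw [tailMap_comp, tailMap_comp] at h1
    have h2 := congrArg (· ∘ₗ front φ n (List.replicate (m + 1) true)) h1
    have h3 := front_twist_succ h (List.replicate m true) (n := n) (a := l₁.count false) (by
      simp at hn'; omega) (l₁.count true)
    have h4 := congrArg (tailMap true (arrange φ (l₁ ++ false :: true :: u) n (m + 1)) ∘ₗ ·) h3
    rw [show (true :: l₁).count false = l₁.count false by simp, List.count_cons_self]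
    have h5 := h2.trans h4.symm
    cases n <;> exact h5

end Front

/-! ### Colourings given by words, and the value of the representation on `η_𝓘` -/

section WordColouring

/-- The colouring of places by the letters of a word (and by `true` behind the word). -/
def colourOf (l : List Bool) : ℕ → Bool := fun j => l.getD j true

theorem numColour_succ_left (c : Bool) (x : ℕ → Bool) (i : ℕ) :
    numColour c x (i + 1) =
      (if x 0 = c then 1 else 0) + numColour c (fun j => x (j + 1)) i := by
  induction i with
  | zero => simp [numColour]
  | succ i ih => rw [numColour, ih, numColour, add_assoc]

theorem numColour_colourOf (c : Bool) (l₁ u : List Bool) :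
    numColour c (colourOf (l₁ ++ u)) l₁.length = l₁.count c := by
  induction l₁ with
  | nil => rfl
  | cons a l₁ ih =>
    rw [List.length_cons, numColour_succ_left, show (fun j => colourOf (a :: l₁ ++ u) (j + 1)) =
      colourOf (l₁ ++ u) from rfl, ih, List.count_cons, add_comm]
    have : colourOf (a :: l₁ ++ u) 0 = a := rfl
    rw [this]; cases a <;> cases c <;> rfl

theorem colourOf_append_cons (l₁ : List Bool) (a : Bool) (u : List Bool) :
    colourOf (l₁ ++ a :: u) l₁.length = a := by
  simp [colourOf]

theorem exch_colourOf : ∀ (i : ℕ) (l : List Bool), i + 1 < l.length →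
    exch (colourOf l) i = colourOf (swapAt i l)
  | 0, [], h => by simp at h
  | 0, [_], h => by simp at h
  | 0, a :: b :: l, _ => by
    funext j
    rcases j with _ | _ | j
    · exact exch_same _ _
    · exact exch_next _ _
    · exact exch_other _ (by omega) (by omega)
  | i + 1, [], h => by simp at h
  | i + 1, a :: l, h => by
    have ih := exch_colourOf i l (by simpa using h)
    funext j
    rcases j with _ | j
    · exact exch_other _ (by omega) (by omega)
    · refine Eq.trans ?_ (congrFun ih j)
      simp only [exch, Equiv.swap_apply_def]
      split_ifs <;> first | omega | rfl

theorem wordSwap_length (w : List ℕ) (l : List Bool) : (wordSwap w l).length = l.length :=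
  (wordSwap_perm w l).length_eq

variable {n m : ℕ} {G : Type*} [Group G] {g : ℕ → G}

/-- `colourOf` for a word with `n` letters `false` and `m` letters `true`. -/
def wordColouring (n m : ℕ) (l : List Bool) (h : l.count false = n ∧ l.length = n + m) :
    Colouring n m :=
  ⟨colourOf l, by
    have := numColour_colourOf false l []
    rw [List.append_nil, h.1, h.2] at this
    exact this⟩

theorem wordSwap_counts {l : List Bool} (w : List ℕ) (h : l.count false = n ∧ l.length = n + m) :
    (wordSwap w l).count false = n ∧ (wordSwap w l).length = n + m := by
  rwa [(wordSwap_perm w l).count_eq, wordSwap_length]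

theorem wordBraid_cons (N i : ℕ) (w : List ℕ) :
    wordBraid N (i :: w) = braidGen N i * wordBraid N w := by simp [wordBraid]

/-- It links the exchange of letters in `wordSwap`, used on tensors, with the exchange of colours in
the induced action. -/
theorem colourAction_word (hg : MixedBraidRelations n m g) (w : List ℕ) (l : List Bool)
    (h : l.count false = n ∧ l.length = n + m) (hw : ∀ i ∈ w, i + 1 < n + m) (u : G) :
    (colourAction hg (wordBraid (n + m) w) (wordColouring n m l h, u)).1 =
      wordColouring n m (wordSwap w l) (wordSwap_counts w h) := by
  induction w with
  | nil => simp [wordBraid]; rfl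
  | cons i w ih =>
    have hi := hw i List.mem_cons_self
    have ih := ih fun i hi => hw i (List.mem_cons_of_mem _ hi)
    apply Subtype.ext
    rw [wordBraid_cons, map_mul, Equiv.Perm.mul_apply, colourAction_gen hg hi, stepPerm_fst g hi,
      ih]
    exact exch_colourOf i _ (by rw [wordSwap_length, h.2]; exact hi)

/-- A shuffle of words permutes their letters. -/
theorem colourOf_wordSwap (w : List ℕ) (l : List Bool) (hw : ∀ i ∈ w, i + 1 < l.length)
    (x : Fin l.length) :
    colourOf (wordSwap w l) (braidPerm l.length (wordBraid l.length w) x) = colourOf l x := by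
  induction w generalizing x with
  | nil => simp [wordBraid, wordSwap]
  | cons i w ih =>
    have hi := hw i List.mem_cons_self
    have ih := ih fun i hi => hw i (List.mem_cons_of_mem _ hi)
    rw [wordBraid_cons, map_mul, Equiv.Perm.mul_apply, braidPerm_gen hi, placeSwap_val hi, wordSwap,
      ← exch_colourOf i _ (by rw [wordSwap_length]; exact hi), exch, Equiv.swap_apply_self, ih]

/-- Every crossing on the way of a `true` strand to the left past `false` strands has colours
`false`, `true`, for which the cocycle is `1`. The new colours are recorded for the strands that
move next. -/
theorem colourAction_range' (hg : MixedBraidRelations n m g) : ∀ (d i : ℕ) (p : Colouring n m × G),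
    i + d < n + m → (∀ j, i ≤ j → j < i + d → p.1.1 j = false) → p.1.1 (i + d) = true →
    (colourAction hg (wordBraid (n + m) (List.range' i d)) p).2 = p.2 ∧
    (∀ j, j < i → (colourAction hg (wordBraid (n + m) (List.range' i d)) p).1.1 j = p.1.1 j) ∧
    (∀ j, i + d < j → (colourAction hg (wordBraid (n + m) (List.range' i d)) p).1.1 j = p.1.1 j) ∧
    (colourAction hg (wordBraid (n + m) (List.range' i d)) p).1.1 i = true ∧
    (∀ j, i < j → j ≤ i + d →
      (colourAction hg (wordBraid (n + m) (List.range' i d)) p).1.1 j = false) := by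
  intro d
  induction d with
  | zero =>
    intro i p _ _ h
    simp only [List.range'_zero, wordBraid, List.map_nil, List.prod_nil, map_one,
      Equiv.Perm.one_apply, add_zero] at h ⊢
    exact ⟨trivial, fun _ _ => trivial, fun _ _ => trivial, h, fun j _ _ => by omega⟩
  | succ d ih =>
    intro i p hi hf ht
    obtain ⟨h1, h2, h3, h4, h5⟩ := ih (i + 1) p (by omega) (fun j _ _ => hf j (by omega) (by omega))
      (by rwa [show i + 1 + d = i + (d + 1) by omega])
    set p' := colourAction hg (wordBraid (n + m) (List.range' (i + 1) d)) p
    have hi' : i + 1 < n + m := by omega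
    have hpi : p'.1.1 i = false := by rw [h2 i (by omega), hf i le_rfl (by omega)]
    rw [List.range'_succ, wordBraid_cons, map_mul, Equiv.Perm.mul_apply, colourAction_gen hg hi',
      stepPerm_snd g hi', stepPerm_fst g hi']
    refine ⟨?_, fun j hj => ?_, fun j hj => ?_, ?_, fun j hj hj' => ?_⟩
    · have : cocycle n g p'.1.1 i = 1 := by simp only [cocycle, hpi, h4]
      rw [this, one_mul, h1]
    · rw [exch_other _ (by omega) (by omega), h2 j (by omega)]
    · rw [exch_other _ (by omega) (by omega), h3 j (by omega)]
    · rw [exch_same, h4]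
    · by_cases e : j = i + 1
      · rw [e, exch_next, hpi]
      · rw [exch_other _ (by omega) e, h5 j (by omega) (by omega)]

/-- The lift moves one `true` strand after the other to the left past `false` strands only: the
`true` strands moved before have been brought to smaller places. So `colourAction_range'` applies to
each. -/
theorem colourAction_liftWord (hg : MixedBraidRelations n m g) : ∀ (l : List ℕ) (q : ℕ)
    (p : Colouring n m × G), q + l.length ≤ n + m → l.Pairwise (· < ·) →
    (∀ y ∈ l, ∀ j, y ≤ j → j < q → p.1.1 j = false) → (∀ j, q ≤ j → p.1.1 j = true) →
    (colourAction hg (wordBraid (n + m) (liftWord q l)) p).2 = p.2 := by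
  intro l
  induction l with
  | nil => intro q p _ _ _ _; simp [wordBraid, liftWord]
  | cons i l ih =>
    intro q p hq hl hf ht
    simp only [List.length_cons] at hq
    rw [List.pairwise_cons] at hl
    rw [liftWord, wordBraid_append, map_mul, Equiv.Perm.mul_apply]
    -- Here the subtraction in `q - i` truncates and the word is empty: the strand need not be
    -- moved.
    by_cases hiq : q ≤ i
    · rw [show q - i = 0 by omega]
      simp only [List.range'_zero, wordBraid, List.map_nil, List.prod_nil, map_one,
        Equiv.Perm.one_apply]
      exact ih (q + 1) p (by omega) hl.2
        (fun y hy j h1 h2 => by have := hl.1 y hy; omega) (fun j hj => ht j (by omega))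
    · obtain ⟨h1, h2, h3, h4, h5⟩ := colourAction_range' hg (q - i) i p (by omega)
        (fun j h1 h2 => hf i List.mem_cons_self j h1 (by omega)) (ht _ (by omega))
      rw [ih (q + 1) _ (by omega) hl.2 (fun y hy j hj1 hj2 => ?_) (fun j hj => ?_), h1]
      · have := hl.1 y hy
        exact h5 j (by omega) (by omega)
      · rw [h3 j (by omega), ht j (by omega)]

/-- The colouring of the places in `I`, and of those behind the last one, by `true`. -/
theorem colourAction_shuffleLift (hg : MixedBraidRelations n m g) (I : Finset (Fin (n + m)))
    (hI : I.card = m) (x : Colouring n m) (hx : ∀ j : Fin (n + m), x.1 j = true ↔ j ∈ I)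
    (hx' : ∀ j, n + m ≤ j → x.1 j = true) (u : G) :
    colourAction hg (shuffleLift n m I) (baseColouring n m, u) = (x, u) := by
  refine Prod.ext (Subtype.ext ?_) ?_
  · obtain ⟨h1, h2⟩ := colourAction_place hg (shuffleLift n m I) (baseColouring n m, u)
    funext j
    by_cases hj : j < n + m
    · have h3 := h1 ((braidPerm (n + m) (shuffleLift n m I))⁻¹ ⟨j, hj⟩)
      have h4 := shuffleLift_perm n m I hI ((braidPerm (n + m) (shuffleLift n m I))⁻¹ ⟨j, hj⟩)
      have e : braidPerm (n + m) (shuffleLift n m I)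
        ((braidPerm (n + m) (shuffleLift n m I))⁻¹ ⟨j, hj⟩) = ⟨j, hj⟩ := by simp
      rw [e] at h3 h4
      rw [← hx] at h4
      simp only at h3 h4 ⊢
      rw [h3, Bool.eq_iff_iff, h4]
      simp [baseColouring]
    · rw [h2 j (by omega), hx' j (by omega)]
      simp only [baseColouring, decide_eq_true_eq]; omega
  · refine colourAction_liftWord hg _ n _ (by simp [sortedPlaces, hI])
      (Finset.sortedLT_sort _).pairwise (fun y _ j _ hj => ?_) (fun j hj => ?_)
    · simpa [baseColouring] using hj
    · simpa [baseColouring] using hj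

/-- Both lifts `α̃` in `η_I(b)` change only the colouring: one leads from the base colouring to `I`,
the inverse of the other from the image of `I` back. Hence the group component is the one picked up
along `b`. -/
theorem mixedBraidLift_eta (hg : MixedBraidRelations n m g) (I : Finset (Fin (n + m)))
    (hI : I.card = m) (b : BraidGroup (n + m)) (x : Colouring n m)
    (hx : ∀ j : Fin (n + m), x.1 j = true ↔ j ∈ I) (hx' : ∀ j, n + m ≤ j → x.1 j = true) :
    mixedBraidLift hg (eta I hI b) = (colourAction hg b (x, 1)).2 := by
  change (colourAction hg ((shuffleLift n m (I.map (braidPerm (n + m) b).toEmbedding))⁻¹ * b *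
    shuffleLift n m I) (baseColouring n m, 1)).2 = _
  rw [map_mul, map_mul, Equiv.Perm.mul_apply, Equiv.Perm.mul_apply,
    colourAction_shuffleLift hg I hI x hx hx', map_inv]
  obtain ⟨h1, h2⟩ := colourAction_place hg b (x, 1)
  -- The colouring reached after `b` is the one of the set `b(I)`, so it is also reached from the
  -- base colouring by the lift for `b(I)`, with the same group component.
  have h3 := colourAction_shuffleLift hg (I.map (braidPerm (n + m) b).toEmbedding)
    (by rw [Finset.card_map, hI]) (colourAction hg b (x, 1)).1 (fun j => ?_)
    (fun j hj => (h2 j hj).trans (hx' j hj)) (colourAction hg b (x, 1)).2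
  · rw [Prod.mk.eta] at h3
    have h4 := Equiv.Perm.inv_eq_iff_eq.2 h3.symm
    rw [h4]
  · have := h1 ((braidPerm (n + m) b)⁻¹ j)
    rw [Finset.mem_map_equiv, ← hx]
    have e : braidPerm (n + m) b ((braidPerm (n + m) b)⁻¹ j) = j := by simp
    rw [e] at this
    rw [this]; rfl

end WordColouring

/-! ### Braid words acting on arranged tensors -/

section Arranged

variable {k : Type u} [Field k]

section Words

variable {Y : Bool → Type u} [∀ b, AddCommGroup (Y b)] [∀ b, Module k (Y b)]

/-- `arrange`, with values in the sum over all words. -/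
def arrangeT (φ : Y false ⊗[k] Y true →ₗ[k] Y true ⊗[k] Y false) (n m : ℕ) (l : List Bool) :
    WordTensor k Y (baseWord n m) →ₗ[k] Tens k Y := ofW l ∘ₗ arrange φ l n m

theorem crossT_dropMap (R : ∀ a b, Y a ⊗[k] Y b →ₗ[k] Y b ⊗[k] Y a) (a b : Bool) (u : List Bool) :
    ∀ (l₁ : List Bool) (X : WordTensor k Y (l₁ ++ a :: b :: u)),
      crossT R l₁.length (ofW (l₁ ++ a :: b :: u) X) =
        ofW (l₁ ++ b :: a :: u) (dropMap l₁ (headMap (R a b) u) X)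
  | [], X => crossT_zero R a b u X
  | _ :: l₁, X => crossT_ofW_cons R (crossT_dropMap R a b u l₁) X

theorem swapAt_append (a b : Bool) (u : List Bool) : ∀ l₁ : List Bool,
    swapAt l₁.length (l₁ ++ a :: b :: u) = l₁ ++ b :: a :: u
  | [] => rfl
  | c :: l₁ => congrArg (c :: ·) (swapAt_append a b u l₁)

theorem exists_append_of_lt {i : ℕ} {l : List Bool} (h : i + 1 < l.length) :
    ∃ l₁ a b u, l = l₁ ++ a :: b :: u ∧ l₁.length = i := by
  refine ⟨l.take i, l[i], l[i + 1], l.drop (i + 2), ?_, by simp; omega⟩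
  rw [← List.drop_eq_getElem_cons, ← List.drop_eq_getElem_cons, List.take_append_drop]

theorem wordSwap_append (l₁ u : List Bool) (w : List ℕ) (c : List Bool)
    (hw : ∀ i ∈ w, i + 1 < c.length) :
    wordSwap (w.map (l₁.length + ·)) (l₁ ++ (c ++ u)) = l₁ ++ (wordSwap w c ++ u) := by
  induction w with
  | nil => rfl
  | cons i w ih =>
    have ih := ih fun i hi => hw i (List.mem_cons_of_mem _ hi)
    obtain ⟨c₁, a, b, c₂, e, rfl⟩ := exists_append_of_lt (i := i) (l := wordSwap w c)
      (by rw [wordSwap_length]; exact hw i List.mem_cons_self)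
    rw [List.map_cons, wordSwap, ih, wordSwap, e, swapAt_append]
    have := swapAt_append a b (c₂ ++ u) (l₁ ++ c₁)
    simpa using this

end Words

variable {V W : Type u} [AddCommGroup V] [Module k V] [AddCommGroup W] [Module k W]
  {B : MixedBraided k V W} {φ : V ⊗[k] W ≃ₗ[k] W ⊗[k] V}

theorem MixedBraided.separates (hφ : B.IsSeparatedBraiding φ) (hB : B.Compatible φ) :
    Separates (k := k) (Y := Two V W) B.op φ.toLinearMap :=
  ⟨hφ.braid, hφ.twist, hB⟩

/-- A crossing acts on arranged tensors by the cocycle of the induced representation. -/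
theorem MixedBraided.crossT_arrangeT (hφ : B.IsSeparatedBraiding φ) (hB : B.Compatible φ)
    {n m : ℕ} (l₁ : List Bool) (a b : Bool) (u : List Bool) (hab : (a && b) = false)
    (hn : (l₁ ++ a :: b :: u).count false = n) (hm : (l₁ ++ a :: b :: u).count true = m)
    (x : BaseTensor k V W n m) :
    crossT (noTrueCross (B.crossing φ)) l₁.length
        (arrangeT (Y := Two V W) φ.toLinearMap n m (l₁ ++ a :: b :: u) x) =
      arrangeT (Y := Two V W) φ.toLinearMap n m (l₁ ++ b :: a :: u)
        (cocycle n (fun i => opAt B.op i (baseWord n m)) (colourOf (l₁ ++ a :: b :: u))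
          l₁.length x) := by
  have hs := B.separates hφ hB
  have e1 : colourOf (l₁ ++ a :: b :: u) (l₁.length + 1) = b := by
    have := colourOf_append_cons (l₁ ++ [a]) b u
    simpa using this
  rw [arrangeT, LinearMap.comp_apply, crossT_dropMap, arrangeT, LinearMap.comp_apply]
  congr 1
  unfold cocycle
  rw [colourOf_append_cons, e1, numColour_colourOf, numColour_colourOf]
  rcases a <;> rcases b
  · exact LinearMap.congr_fun (arrange_false_false hs l₁ u n m hn) x
  · exact LinearMap.congr_fun (arrange_false_true l₁ u n m) x
  · have h1 := arrange_false_true (φ := φ.toLinearMap) (Y := Two V W) l₁ u n m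
    have h2 := arrange_twist hs l₁ u n m (by simpa using hn) (by simpa using hm)
    have h3 : headMap (noTrueCross (B.crossing φ) true false) u ∘ₗ
        headMap (Y := Two V W) (a := false) (b := true) (a' := true) (b' := false)
          φ.toLinearMap u =
        headMap (Y := Two V W) (a := false) (b := true) (a' := false) (b' := true)
          B.τ.toLinearMap u := by
      rw [← headMap_comp]
      congr 1
      refine LinearMap.ext fun t => ?_
      exact congrArg B.τ (φ.symm_apply_apply t)
    rw [← h1, LinearMap.comp_apply, ← LinearMap.comp_apply, ← dropMap_comp, h3]
    exact LinearMap.congr_fun h2 x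
  · simp at hab

/-- The crossings act one after the other by `crossT_arrangeT`, and their cocycles multiply exactly
as in the induced action. The part `c` will be the two blocks that are merged. -/
theorem MixedBraided.wordProd_arrangeT (hφ : B.IsSeparatedBraiding φ) (hB : B.Compatible φ)
    {n m : ℕ} (l₁ c u : List Bool) (w : List ℕ) (hw : ∀ i ∈ w, i + 1 < c.length)
    (hc : c.count true ≤ 1) (h : (l₁ ++ (c ++ u)).count false = n ∧ (l₁ ++ (c ++ u)).length = n + m)
    (x : BaseTensor k V W n m) :
    wordProd (crossT (noTrueCross (B.crossing φ))) (w.map (l₁.length + ·))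
        (arrangeT (Y := Two V W) φ.toLinearMap n m (l₁ ++ (c ++ u)) x) =
      arrangeT (Y := Two V W) φ.toLinearMap n m (l₁ ++ (wordSwap w c ++ u))
        ((colourAction (B.relations n m) (wordBraid (n + m) (w.map (l₁.length + ·)))
          (wordColouring n m (l₁ ++ (c ++ u)) h, 1)).2 x) := by
  induction w with
  | nil => simp [wordProd, wordBraid, wordSwap]
  | cons i w ih =>
    have hw' : ∀ i ∈ w, i + 1 < c.length := fun i hi => hw i (List.mem_cons_of_mem _ hi)
    have ih := ih hw'
    have hi := hw i List.mem_cons_self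
    have hlen := h.2
    simp only [List.length_append] at hlen
    have hcol := colourAction_word (B.relations n m) (w.map (l₁.length + ·)) _ h (by
      intro j hj
      obtain ⟨j, hj', rfl⟩ := List.mem_map.1 hj
      have := hw' j hj'
      omega) 1
    have hcs := wordSwap_counts (w.map (l₁.length + ·)) h
    simp only [wordSwap_append l₁ u w c hw'] at hcol hcs
    have hper := (wordSwap_perm w c).count_eq true
    have hi' : i + 1 < (wordSwap w c).length := by rwa [wordSwap_length]
    rw [List.map_cons, wordProd, List.map_cons, List.prod_cons, Module.End.mul_apply]
    rw [wordProd] at ih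
    rw [ih, wordBraid_cons, map_mul, Equiv.Perm.mul_apply, colourAction_gen _ (by omega),
      stepPerm_snd _ (by omega), hcol, wordSwap]
    obtain ⟨c₁, a, b, c₂, e, rfl⟩ := exists_append_of_lt hi'
    simp only [e] at hcs hper ⊢
    rw [swapAt_append]
    -- The two letters that cross belong to a rearrangement of `c`, which has at most one letter
    -- `true`; so they are not both `true`.
    have key := B.crossT_arrangeT hφ hB (l₁ ++ c₁) a b (c₂ ++ u)
      (n := n) (m := m) (by
        rw [List.count_append] at hper
        simp only [List.count_cons] at hper
        revert hper; cases a <;> cases b <;> simp; omega)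
      (by simpa using hcs.1) (by
        have h1 := hcs.1
        have h2 := hcs.2
        have h3 := List.count_false_add_count_true (l₁ ++ (c₁ ++ a :: b :: c₂ ++ u))
        have h4 : (l₁ ++ c₁ ++ a :: b :: (c₂ ++ u)) = (l₁ ++ (c₁ ++ a :: b :: c₂ ++ u)) := by simp
        rw [h4]; omega)
      ((colourAction (B.relations n m) (wordBraid (n + m) (w.map (l₁.length + ·)))
          (wordColouring n m (l₁ ++ (c ++ u)) h, 1)).2 x)
    simp only [List.append_assoc, List.cons_append, List.length_append] at key ⊢
    rw [key]
    rfl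

/-- The sign of `W ⊗ V → V ⊗ W` comes from the factor `φ⁻¹` in `τ φ⁻¹`, since `τ` itself is not
twisted. Two letters `W` cross by `0` on both sides. -/
theorem MixedBraided.noTrueCross_signTwist (B : MixedBraided k V W)
    (φ : V ⊗[k] W ≃ₗ[k] W ⊗[k] V) : ∀ a b,
    noTrueCross (B.signTwist.crossing (negEquiv φ)) a b = -noTrueCross (B.crossing φ) a b
  | false, false => coe_negEquiv _
  | false, true => coe_negEquiv _
  | true, false => (congrArg (B.τ.toLinearMap ∘ₗ ·) (coe_negEquiv_symm φ)).trans
      (LinearMap.comp_neg _ _)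
  | true, true => neg_zero.symm

end Arranged

/-! ### The Yang-Baxter equation for the crossings -/

section YangBaxter

variable {k : Type u} [Field k]

section Inverse

variable {A A' C C' T : Type u} [AddCommGroup A] [Module k A] [AddCommGroup A'] [Module k A']
  [AddCommGroup C] [Module k C] [AddCommGroup C'] [Module k C'] [AddCommGroup T] [Module k T]

theorem tensorId_symm_apply (f : A ⊗[k] C ≃ₗ[k] A' ⊗[k] C') (x : A ⊗[k] (C ⊗[k] T)) :
    tensorId T f.symm.toLinearMap (tensorId T f.toLinearMap x) = x :=
  (tensorIdEquiv T f).symm_apply_apply x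

theorem tensorId_apply_symm (f : A ⊗[k] C ≃ₗ[k] A' ⊗[k] C') (x : A' ⊗[k] (C' ⊗[k] T)) :
    tensorId T f.toLinearMap (tensorId T f.symm.toLinearMap x) = x :=
  (tensorIdEquiv T f).apply_symm_apply x

theorem lTensor_symm_apply (f : A ≃ₗ[k] A') (x : T ⊗[k] A) :
    f.symm.toLinearMap.lTensor T (f.toLinearMap.lTensor T x) = x :=
  (f.lTensor T).symm_apply_apply x

theorem lTensor_apply_symm (f : A ≃ₗ[k] A') (x : T ⊗[k] A') :
    f.toLinearMap.lTensor T (f.symm.toLinearMap.lTensor T x) = x :=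
  (f.lTensor T).apply_symm_apply x

theorem tensorId_zero : tensorId T (0 : A ⊗[k] C →ₗ[k] A' ⊗[k] C') = 0 := by
  ext x; simp [tensorId]

end Inverse

variable {V W : Type u} [AddCommGroup V] [Module k V] [AddCommGroup W] [Module k W]
  {B : MixedBraided k V W} {φ : V ⊗[k] W ≃ₗ[k] W ⊗[k] V}

/-- Compose with `(1 ⊗ φ)(σV⁻¹ ⊗ 1)`. By the braid equation the left side becomes `(τ ⊗ 1)(1 ⊗ φ)`,
and the right side is `(1 ⊗ φ)(σV ⊗ 1)(1 ⊗ τ)(σV⁻¹ ⊗ 1)`; these agree by the twist equation. -/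
theorem MixedBraided.yangBaxter_mixed (hφ : B.IsSeparatedBraiding φ) :
    tensorId V (B.τ.toLinearMap ∘ₗ φ.symm.toLinearMap) ∘ₗ B.σV.toLinearMap.lTensor W ∘ₗ
        tensorId V φ.toLinearMap =
      φ.toLinearMap.lTensor V ∘ₗ tensorId W B.σV.toLinearMap ∘ₗ
        (B.τ.toLinearMap ∘ₗ φ.symm.toLinearMap).lTensor V := by
  refine LinearMap.ext fun x => ?_
  obtain ⟨x, rfl⟩ : ∃ y, x = φ.toLinearMap.lTensor V y := ⟨_, (lTensor_apply_symm φ x).symm⟩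
  obtain ⟨x, rfl⟩ : ∃ y, x = tensorId W B.σV.symm.toLinearMap y :=
    ⟨_, (tensorId_symm_apply B.σV x).symm⟩
  have h1 := LinearMap.congr_fun hφ.braid (tensorId W B.σV.symm.toLinearMap x)
  have h2 := LinearMap.congr_fun hφ.twist x
  simp only [LinearMap.comp_apply] at h1 h2
  simp only [tensorId_comp, LinearMap.lTensor_comp, LinearMap.comp_apply]
  rw [h1, tensorId_symm_apply, tensorId_apply_symm, lTensor_symm_apply, h2]

/-- Compose with `(φ ⊗ 1)(1 ⊗ φ)(σV⁻¹ ⊗ 1)`. The braid equation and the twist equation remove all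
`φ`, and what remains is the four-term relation of `σV` and `τ` on `V ⊗ V ⊗ W`, composed with
`σV⁻²`. -/
theorem MixedBraided.yangBaxter_right (hφ : B.IsSeparatedBraiding φ) :
    tensorId W B.σV.toLinearMap ∘ₗ (B.τ.toLinearMap ∘ₗ φ.symm.toLinearMap).lTensor V ∘ₗ
        tensorId V (B.τ.toLinearMap ∘ₗ φ.symm.toLinearMap) =
      (B.τ.toLinearMap ∘ₗ φ.symm.toLinearMap).lTensor V ∘ₗ
        tensorId V (B.τ.toLinearMap ∘ₗ φ.symm.toLinearMap) ∘ₗ B.σV.toLinearMap.lTensor W := by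
  refine LinearMap.ext fun x => ?_
  obtain ⟨x, rfl⟩ : ∃ y, x = tensorId V φ.toLinearMap y := ⟨_, (tensorId_apply_symm φ x).symm⟩
  obtain ⟨x, rfl⟩ : ∃ y, x = φ.toLinearMap.lTensor V y := ⟨_, (lTensor_apply_symm φ x).symm⟩
  obtain ⟨x, rfl⟩ : ∃ y, x = tensorId W B.σV.symm.toLinearMap y :=
    ⟨_, (tensorId_symm_apply B.σV x).symm⟩
  have h1 := LinearMap.congr_fun hφ.braid (tensorId W B.σV.symm.toLinearMap x)
  have h2 := fun x => LinearMap.congr_fun hφ.twist x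
  have h3 := LinearMap.congr_fun B.mixedV (tensorId W B.σV.symm.toLinearMap
    (tensorId W B.σV.symm.toLinearMap x))
  simp only [LinearMap.comp_apply] at h1 h2 h3
  simp only [tensorId_comp, LinearMap.lTensor_comp, LinearMap.comp_apply]
  rw [h1, tensorId_symm_apply, tensorId_symm_apply, tensorId_apply_symm, h2, h2,
    lTensor_symm_apply, lTensor_symm_apply, h3, tensorId_apply_symm]

/-- Any two of the three strands cross once on each side. So if two of them are `W`, both sides
contain the crossing that was set to `0`; no equation between `σW` and `φ` is called for. -/
theorem MixedBraided.yangBaxter (hφ : B.IsSeparatedBraiding φ) : ∀ a b c,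
    tensorId (Two V W a) (noTrueCross (B.crossing φ) b c) ∘ₗ
        (noTrueCross (B.crossing φ) a c).lTensor (Two V W b) ∘ₗ
        tensorId (Two V W c) (noTrueCross (B.crossing φ) a b) =
      (noTrueCross (B.crossing φ) a b).lTensor (Two V W c) ∘ₗ
        tensorId (Two V W b) (noTrueCross (B.crossing φ) a c) ∘ₗ
        (noTrueCross (B.crossing φ) b c).lTensor (Two V W a)
  | false, false, false => B.braidV
  | false, false, true => hφ.braid.symm
  | false, true, false => B.yangBaxter_mixed hφ
  | true, false, false => B.yangBaxter_right hφ
  | true, true, _ => by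
    simp only [noTrueCross, tensorId_zero, LinearMap.lTensor_zero, LinearMap.comp_zero,
      LinearMap.zero_comp]
  | true, false, true => by
    simp only [noTrueCross, tensorId_zero, LinearMap.lTensor_zero, LinearMap.comp_zero,
      LinearMap.zero_comp]
  | false, true, true => by
    simp only [noTrueCross, tensorId_zero, LinearMap.lTensor_zero, LinearMap.comp_zero,
      LinearMap.zero_comp]

theorem IsBraidSeq.neg {A : Type*} [Ring A] {σ σ' : ℕ → A} (h : IsBraidSeq σ)
    (hσ : ∀ i, σ' i = -σ i) : IsBraidSeq σ' where
  comm i j hij := by simp only [hσ, neg_mul_neg, h.comm i j hij]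
  braid i := by simp only [hσ, neg_mul, mul_neg, neg_neg, h.braid i]

/-- The crossings on the tensor algebra of `V` and `W` that occur in the quantum shuffle algebra
of `(V, -σV)` and its bimodule. -/
abbrev MixedBraided.signedCross (B : MixedBraided k V W) (φ : V ⊗[k] W ≃ₗ[k] W ⊗[k] V) :
    ℕ → Module.End k (Tens k (Two V W)) :=
  crossT (noTrueCross (B.signTwist.crossing (negEquiv φ)))

theorem MixedBraided.signedCross_eq (B : MixedBraided k V W) (φ : V ⊗[k] W ≃ₗ[k] W ⊗[k] V)
    (i : ℕ) : B.signedCross φ i = -crossT (noTrueCross (B.crossing φ)) i :=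
  crossT_neg (B.noTrueCross_signTwist φ) i

theorem MixedBraided.signedCross_isBraidSeq (hφ : B.IsSeparatedBraiding φ) :
    IsBraidSeq (B.signedCross φ) :=
  (crossT_isBraidSeq (B.yangBaxter hφ)).neg (B.signedCross_eq φ)

end YangBaxter

/-! ### Multiplying neighbouring factors, and the projection to `F_q` -/

section Merge

variable {k : Type u} [Field k] {Y : Bool → Type u} [∀ b, AddCommGroup (Y b)]
  [∀ b, Module k (Y b)]

theorem supp_append_induction {p s M : ℕ} {P : Tens k Y → Prop}
    (h : ∀ c l x z, c.length = p → l.length = s → c.count true + l.count true = M →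
      P (mulT (ofW c x) (ofW l z))) (h0 : P 0) (ha : ∀ x y, P x → P y → P (x + y)) {X : Tens k Y}
    (hX : X ∈ supp k Y (p + s) M) : P X := by
  refine supp_induction (fun l x hl hm => ?_) h0 ha hX
  obtain ⟨c, l', rfl, hc⟩ : ∃ c l', l = c ++ l' ∧ c.length = p :=
    ⟨l.take p, l.drop p, (List.take_append_drop p l).symm, by simp; omega⟩
  refine ofW_append_induction c l' (fun x z => h c l' x z hc ?_ ?_) h0 ha x
  · simp at hl; omega
  · simpa using hm

/-- Multiply the factors `i` and `i + 1` (`0` on too short words). -/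
def mergeT (μ : ∀ a b, Y a →ₗ[k] Y b →ₗ[k] Y (a || b)) (i : ℕ) : Module.End k (Tens k Y) :=
  ofWords fun l => if i + 1 < l.length then ofW (mergeAt i l) ∘ₗ mulAt μ i l else 0

variable {μ : ∀ a b, Y a →ₗ[k] Y b →ₗ[k] Y (a || b)}

theorem mergeT_ofW {i : ℕ} {l : List Bool} (h : i + 1 < l.length) (x : WordTensor k Y l) :
    mergeT μ i (ofW l x) = ofW (mergeAt i l) (mulAt μ i l x) := by
  rw [mergeT, ofWords_ofW, if_pos h]; rfl

theorem mergeT_zero (a b : Bool) (v : Y a) (w : Y b) (X : Tens k Y) :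
    mergeT μ 0 (consT a v (consT b w X)) = consT (a || b) (μ a b v w) X := by
  refine LinearMap.congr_fun (f := mergeT μ 0 ∘ₗ consT a v ∘ₗ consT b w)
    (g := consT (a || b) (μ a b v w)) (tens_ext_ofW fun l x => ?_) X
  simp only [LinearMap.comp_apply, consT_ofW]
  rw [mergeT_ofW (by simp)]
  rfl

theorem mergeT_succ (i : ℕ) (a : Bool) (v : Y a) (X : Tens k Y) :
    mergeT μ (i + 1) (consT a v X) = consT a v (mergeT μ i X) := by
  refine LinearMap.congr_fun (f := mergeT μ (i + 1) ∘ₗ consT a v)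
    (g := consT a v ∘ₗ mergeT μ i) (tens_ext_ofW fun l x => ?_) X
  simp only [LinearMap.comp_apply, consT_ofW]
  by_cases h : i + 1 < l.length
  · rw [mergeT_ofW (by simpa using h), mergeT_ofW h, consT_ofW]
    rfl
  · rw [mergeT, mergeT, ofWords_ofW, ofWords_ofW, if_neg (by simpa using h), if_neg h]
    simp

/-- The projection to a column complex. -/
def columnProj (k : Type u) [Field k] (Y : Bool → Type u) [∀ b, AddCommGroup (Y b)]
    [∀ b, Module k (Y b)] (m : ℕ) (q : ℤ) : Tens k Y →ₗ[k] ColumnComplex k Y m q :=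
  ofWords (columnIncl k Y m q)

theorem columnD_columnProj (m N : ℕ) (s : ℤ) {X : Tens k Y} (hX : X ∈ supp k Y N m) :
    columnD μ m N s (columnProj k Y m N X) =
      ∑ i ∈ Finset.range (N - 1), (-1 : k) ^ i • columnProj k Y m s (mergeT μ i X) := by
  refine supp_induction (p := fun X => columnD μ m N s (columnProj k Y m N X) =
      ∑ i ∈ Finset.range (N - 1), (-1 : k) ^ i • columnProj k Y m s (mergeT μ i X)) ?_ (by simp)
    ?_ hX
  · rintro l x rfl rfl
    rw [columnProj, ofWords_ofW, columnIncl, dif_pos ⟨rfl, rfl⟩, columnD, DirectSum.toModule_lof,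
      LinearMap.sum_apply]
    refine Finset.sum_congr rfl fun i hi => ?_
    rw [mergeT_ofW (by rw [Finset.mem_range] at hi; omega), columnProj, ofWords_ofW]
    rfl
  · intro x y hx hy
    simp only [map_add, hx, hy, smul_add, Finset.sum_add_distrib]

end Merge

/-! ### Cutting words into blocks -/

section Blocks

variable {k V W : Type u} [Field k] [AddCommGroup V] [Module k V] [AddCommGroup W] [Module k W]

/-- The element of a factor given by a tensor along a word (`0` if the word does not fit). -/
def toFactor (k V W : Type u) [Field k] [AddCommGroup V] [Module k V] [AddCommGroup W]
    [Module k W] : ∀ b, Tens k (Two V W) →ₗ[k] Factor k V W b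
  | false => ofWords fun c => if h : c.count true = 0 ∧ c ≠ [] then
      ((DirectSum.lof k {c : List Bool // c.count true = false.toNat}
        (fun c => WordTensor k (Two V W) c.1) ⟨c, h.1⟩).codRestrict (augmentationIdeal k V W)
        fun x => Submodule.mem_iSup_of_mem (c.length - 1) (Submodule.subset_span
          ⟨⟨c, h.1⟩, x, by have := List.length_pos_of_ne_nil h.2; simp only; omega, rfl⟩) :)
    else (0 : WordTensor k (Two V W) c →ₗ[k] augmentationIdeal k V W)
  | true => ofWords fun c => if h : c.count true = 1 then
      DirectSum.lof k {c : List Bool // c.count true = true.toNat}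
        (fun c => WordTensor k (Two V W) c.1) ⟨c, h⟩ else
      (0 : WordTensor k (Two V W) c →ₗ[k] Graded k V W true)

theorem toFactor_false {c : List Bool} (h : c.count true = false.toNat) (hc : c ≠ [])
    (x : WordTensor k (Two V W) c) :
    (augmentationIdeal k V W).subtype (toFactor k V W false (ofW c x)) =
      DirectSum.lof k {c : List Bool // c.count true = false.toNat}
        (fun c => WordTensor k (Two V W) c.1) ⟨c, h⟩ x := by
  rw [toFactor, ofWords_ofW, dif_pos ⟨h, hc⟩]; rfl

theorem toFactor_true {c : List Bool} (h : c.count true = true.toNat)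
    (x : WordTensor k (Two V W) c) :
    toFactor k V W true (ofW c x) =
      DirectSum.lof k {c : List Bool // c.count true = true.toNat}
        (fun c => WordTensor k (Two V W) c.1) ⟨c, h⟩ x := by
  rw [toFactor, ofWords_ofW, dif_pos (show c.count true = 1 from h)]

theorem toFactor_of_ne {N M : ℕ} {b : Bool} (h : M ≠ b.toNat) {X : Tens k (Two V W)}
    (hX : X ∈ supp k (Two V W) N M) : toFactor k V W b X = 0 := by
  refine supp_induction (p := fun X => toFactor k V W b X = 0) ?_ (map_zero _)
    (fun x y hx hy => by rw [map_add, hx, hy, add_zero]) hX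
  rintro c x - rfl
  cases b
  · rw [toFactor, ofWords_ofW, dif_neg fun h' => h h'.1]; rfl
  · rw [toFactor, ofWords_ofW, dif_neg (show ¬c.count true = 1 from h)]; rfl

/-- Cut a word into blocks of the given sizes, and map each block to the factor in which it lies. -/
def blocks (k V W : Type u) [Field k] [AddCommGroup V] [Module k V] [AddCommGroup W]
    [Module k W] : List ℕ → Tens k (Two V W) →ₗ[k] Tens k (Factor k V W)
  | [] => ofWords fun l => match l with
    | [] => (LinearMap.toSpanSingleton k _ (oneT k (Factor k V W)) :)
    | _ :: _ => 0
  | p :: s => TensorProduct.lift (∑ b, (consT b ∘ₗ toFactor k V W b).compl₂ (blocks k V W s)) ∘ₗ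
      splitT p

theorem blocks_nil : blocks k V W [] (oneT k (Two V W)) = oneT k (Factor k V W) := by
  rw [blocks]
  exact (ofWords_ofW _ [] (nilW k (Two V W))).trans (one_smul k _)

theorem blocks_ofW (c : List Bool) (x : WordTensor k (Two V W) c) (s : List ℕ)
    (Z : Tens k (Two V W)) : blocks k V W (c.length :: s) (mulT (ofW c x) Z) =
      ∑ b, consT b (toFactor k V W b (ofW c x)) (blocks k V W s Z) := by
  rw [blocks, LinearMap.comp_apply, splitT_mulT, TensorProduct.lift.tmul, LinearMap.sum_apply,
    LinearMap.sum_apply]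
  rfl

theorem blocks_mulT {p M : ℕ} {X : Tens k (Two V W)} (hX : X ∈ supp k (Two V W) p M) (s : List ℕ)
    (Z : Tens k (Two V W)) : blocks k V W (p :: s) (mulT X Z) =
      ∑ b, consT b (toFactor k V W b X) (blocks k V W s Z) := by
  refine supp_induction (p := fun X => blocks k V W (p :: s) (mulT X Z) =
      ∑ b, consT b (toFactor k V W b X) (blocks k V W s Z)) ?_ (by simp) ?_ hX
  · rintro c x rfl -
    exact blocks_ofW c x s Z
  · intro x y hx hy
    simp only [map_add, LinearMap.add_apply, hx, hy, Finset.sum_add_distrib]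

theorem blocks_mem_supp (s : List ℕ) {M : ℕ} {X : Tens k (Two V W)}
    (hX : X ∈ supp k (Two V W) s.sum M) :
    blocks k V W s X ∈ supp k (Factor k V W) s.length M := by
  induction s generalizing X M with
  | nil =>
    refine supp_induction (p := fun X => blocks k V W [] X ∈ supp k (Factor k V W) 0 M) ?_ (by simp)
      (fun x y hx hy => by rw [map_add]; exact Submodule.add_mem _ hx hy) hX
    intro l x hl hm
    obtain rfl := List.length_eq_zero_iff.1 hl
    obtain ⟨t, rfl⟩ := wordTensor_nil x
    rw [map_smul, map_smul, show ofW [] (nilW k (Two V W)) = oneT k _ from rfl, blocks_nil]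
    refine Submodule.smul_mem _ _ ?_
    subst hm
    exact ofW_mem_supp [] _
  | cons p s ih =>
    rw [List.sum_cons] at hX
    refine supp_append_induction (P := fun X => blocks k V W (p :: s) X ∈
      supp k (Factor k V W) (s.length + 1) M) ?_ (by simp)
      (fun x y hx hy => by rw [map_add]; exact Submodule.add_mem _ hx hy) hX
    rintro c l x z rfl hl rfl
    rw [blocks_ofW]
    refine Submodule.sum_mem _ fun b _ => ?_
    by_cases h : c.count true = b.toNat
    · rw [h, Nat.add_comm b.toNat]
      refine consT_mem_supp (ih ?_) b _
      rw [← hl]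
      exact ofW_mem_supp l z
    · rw [toFactor_of_ne h (ofW_mem_supp c x), map_zero, LinearMap.zero_apply]
      exact Submodule.zero_mem _

end Blocks

/-! ### Multiplication of blocks is the sum of shuffle lifts -/

section BlockMerge

variable {k V W : Type u} [Field k] [AddCommGroup V] [Module k V] [AddCommGroup W] [Module k W]
  (B : MixedBraided k V W) (φ : V ⊗[k] W ≃ₗ[k] W ⊗[k] V)

theorem shuffleSum_mulT_ofW (R : ∀ a b, Two V W a ⊗[k] Two V W b →ₗ[k] Two V W b ⊗[k] Two V W a)
    (c c' : List Bool) (h : (c ++ c').count true ≤ 1)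
    (x : WordTensor k (Two V W) c) (y : WordTensor k (Two V W) c') :
    shuffleSum (crossT (noTrueCross R)) c.length c'.length (mulT (ofW c x) (ofW c' y)) =
      ∑ γ ∈ shuffles c.length c'.length, ofW (wordSwap (shuffleWord _ _ γ) (c ++ c'))
        (wordCross R (shuffleWord _ _ γ) (c ++ c') (concat c c' (x ⊗ₜ y))) := by
  rw [mulT_ofW, shuffleSum_eq, LinearMap.sum_apply]
  refine Finset.sum_congr rfl fun γ _ => ?_
  exact wordProd_noTrueCross R _ _ (by
    intro i hi
    rw [List.length_append]
    exact shuffleWord_bound γ i hi) h _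

theorem shuffleSum_mem_supp (R : ∀ a b, Two V W a ⊗[k] Two V W b →ₗ[k] Two V W b ⊗[k] Two V W a)
    (p q : ℕ) {N M : ℕ} {X : Tens k (Two V W)} (hX : X ∈ supp k (Two V W) N M) :
    shuffleSum (crossT R) p q X ∈ supp k (Two V W) N M := by
  rw [shuffleSum_eq, LinearMap.sum_apply]
  exact Submodule.sum_mem _ fun γ _ => wordProd_crossT_mem_supp R _ hX

/-- Both sides are the same sum over shuffles, by definition of the product. As there is at most one
`W` in the two words together, it does not matter that the crossing of two letters `W` was replaced
by `0`. -/
theorem MixedBraided.toFactor_shuffle {a b : Bool} (hab : (a && b) = false) {c c' : List Bool}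
    (hc : c.count true = a.toNat) (hc' : c'.count true = b.toNat) (h0 : c ≠ []) (h0' : c' ≠ [])
    (x : WordTensor k (Two V W) c) (y : WordTensor k (Two V W) c') :
    toFactor k V W (a || b) (shuffleSum (crossT (noTrueCross (B.crossing φ))) c.length c'.length
        (mulT (ofW c x) (ofW c' y))) =
      B.factorMul φ a b (toFactor k V W a (ofW c x)) (toFactor k V W b (ofW c' y)) := by
  rw [shuffleSum_mulT_ofW _ _ _ (by
    rw [List.count_append, hc, hc']; revert hab; cases a <;> cases b <;> simp), map_sum]
  have hcount := fun w => wordSwap_count hab w hc hc'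
  have hne : ∀ w, wordSwap w (c ++ c') ≠ [] := by
    intro w hw
    have h1 := congrArg List.length hw
    rw [wordSwap_length, List.length_append, List.length_nil] at h1
    have := List.length_pos_of_ne_nil h0
    omega
  rcases a <;> rcases b
  · apply Submodule.subtype_injective (augmentationIdeal k V W)
    have key := B.shuffleMul_lof φ (a := false) (b := false) rfl ⟨c, hc⟩ ⟨c', hc'⟩ x y
    rw [← toFactor_false hc h0, ← toFactor_false hc' h0'] at key
    refine Eq.trans ?_ key.symm
    rw [map_sum]
    exact Finset.sum_congr rfl fun γ _ => toFactor_false (hcount _) (hne _) _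
  · have key := B.shuffleMul_lof φ (a := false) (b := true) rfl ⟨c, hc⟩ ⟨c', hc'⟩ x y
    rw [← toFactor_false hc h0, ← toFactor_true hc'] at key
    refine Eq.trans ?_ key.symm
    exact Finset.sum_congr rfl fun γ _ => toFactor_true (hcount _) _
  · have key := B.shuffleMul_lof φ (a := true) (b := false) rfl ⟨c, hc⟩ ⟨c', hc'⟩ x y
    rw [← toFactor_true hc, ← toFactor_false hc' h0'] at key
    refine Eq.trans ?_ key.symm
    exact Finset.sum_congr rfl fun γ _ => toFactor_true (hcount _) _
  · simp at hab

/-- With at most one `W` in the two words, one summand survives on each side, and these are compared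
by `toFactor_shuffle`. Otherwise the shuffled words lie in no factor, and on the right at most the
product of two elements of `𝔐` is left, which is `0`. -/
theorem MixedBraided.sum_consT_shuffle {c c' : List Bool} (h0 : c ≠ []) (h0' : c' ≠ [])
    (x : WordTensor k (Two V W) c) (y : WordTensor k (Two V W) c') (Z : Tens k (Factor k V W)) :
    ∑ d, consT d (toFactor k V W d (shuffleSum (crossT (noTrueCross (B.crossing φ))) c.length
        c'.length (mulT (ofW c x) (ofW c' y)))) Z =
      ∑ a, ∑ b, consT (a || b) (B.factorMul φ a b (toFactor k V W a (ofW c x))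
        (toFactor k V W b (ofW c' y))) Z := by
  have hS : shuffleSum (crossT (noTrueCross (B.crossing φ))) c.length c'.length
      (mulT (ofW c x) (ofW c' y)) ∈ supp k (Two V W) (c ++ c').length ((c ++ c').count true) := by
    refine shuffleSum_mem_supp _ _ _ ?_
    rw [mulT_ofW]
    exact ofW_mem_supp _ _
  have hinj : ∀ a b : Bool, a.toNat = b.toNat → a = b := by decide
  by_cases h : ∃ a b : Bool, c.count true = a.toNat ∧ c'.count true = b.toNat ∧ (a && b) = false
  · obtain ⟨a, b, hc, hc', hab⟩ := h
    rw [Finset.sum_eq_single (a || b), Finset.sum_eq_single a, Finset.sum_eq_single b,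
      B.toFactor_shuffle φ hab hc hc' h0 h0']
    · intro b' _ hb
      rw [toFactor_of_ne (b := b') (fun h => hb (hinj _ _ (h.symm.trans hc'))) (ofW_mem_supp c' y),
        map_zero, map_zero, LinearMap.zero_apply]
    · simp
    · intro a' _ ha
      refine Finset.sum_eq_zero fun b' _ => ?_
      rw [toFactor_of_ne (b := a') (fun h => ha (hinj _ _ (h.symm.trans hc))) (ofW_mem_supp c x),
        map_zero, LinearMap.zero_apply, map_zero, LinearMap.zero_apply]
    · simp
    · intro d _ hd
      rw [toFactor_of_ne (b := d) (fun h => hd (hinj _ _ ?_)) hS, map_zero, LinearMap.zero_apply]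
      rw [List.count_append, hc, hc'] at h
      rw [← h]
      revert hab; cases a <;> cases b <;> simp
    · simp
  · have hz : ∀ d : Bool, (c ++ c').count true ≠ d.toNat := by
      intro d hd
      rw [List.count_append] at hd
      apply h
      rcases d
      · exact ⟨false, false, by simp at hd ⊢; omega, by simp at hd ⊢; omega, rfl⟩
      · rcases Nat.eq_zero_or_pos (c.count true) with h1 | h1
        · exact ⟨false, true, h1, by simp at hd ⊢; omega, rfl⟩
        · exact ⟨true, false, by simp at hd ⊢; omega, by simp at hd ⊢; omega, rfl⟩
    rw [Finset.sum_eq_zero fun d _ => by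
      rw [toFactor_of_ne (b := d) (hz d) hS, map_zero, LinearMap.zero_apply]]
    refine (Finset.sum_eq_zero fun a _ => Finset.sum_eq_zero fun b _ => ?_).symm
    by_cases ha : c.count true = a.toNat
    · by_cases hb : c'.count true = b.toNat
      · have hab : (a && b) = true := by
          by_contra hab
          exact h ⟨a, b, ha, hb, by simpa using hab⟩
        obtain ⟨rfl, rfl⟩ : a = true ∧ b = true := by simpa using hab
        rw [show B.factorMul φ true true = 0 from rfl, LinearMap.zero_apply, LinearMap.zero_apply,
          map_zero, LinearMap.zero_apply]
      · rw [toFactor_of_ne hb (ofW_mem_supp c' y), map_zero, map_zero, LinearMap.zero_apply]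
    · rw [toFactor_of_ne ha (ofW_mem_supp c x), map_zero, LinearMap.zero_apply, map_zero,
        LinearMap.zero_apply]

/-- Multiplying neighbouring factors shuffles the corresponding blocks. -/
theorem MixedBraided.mergeT_blocks : ∀ (i : ℕ) (s : List ℕ) (σ : ℕ → Module.End k (Tens k (Two V W)))
    (M : ℕ) (X : Tens k (Two V W)), σ = crossT (noTrueCross (B.crossing φ)) → (∀ p ∈ s, 0 < p) →
    i + 1 < s.length → X ∈ supp k (Two V W) s.sum M →
    mergeT (B.factorMul φ) i (blocks k V W s X) = blocks k V W (mergeSizes i s) (faceSum σ i s X)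
  | 0, [], _, _, _, _, _, h, _ => by simp at h
  | 0, [_], _, _, _, _, _, h, _ => by simp at h
  | 0, p :: q :: s, σ, M, X, hσ, hs, _, hX => by
    rw [List.sum_cons, List.sum_cons] at hX
    refine supp_append_induction (P := fun X => mergeT (B.factorMul φ) 0
      (blocks k V W (p :: q :: s) X) = blocks k V W ((p + q) :: s) (shuffleSum σ p q X)) ?_ (by simp)
      (fun x y hx hy => by simp only [map_add, hx, hy]) hX
    rintro c l x z rfl hl -
    have hz := ofW_mem_supp (k := k) (Y := Two V W) l z
    rw [hl] at hz
    refine supp_append_induction (P := fun Z => mergeT (B.factorMul φ) 0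
      (blocks k V W (c.length :: q :: s) (mulT (ofW c x) Z)) =
        blocks k V W ((c.length + q) :: s) (shuffleSum σ c.length q (mulT (ofW c x) Z))) ?_ (by simp)
      (fun x y hx hy => by simp only [map_add, hx, hy]) hz
    rintro c' l' y z' rfl - -
    have h0 : c ≠ [] := List.length_pos_iff.1 (hs _ List.mem_cons_self)
    have h0' : c' ≠ [] :=
      List.length_pos_iff.1 (hs _ (List.mem_cons_of_mem _ List.mem_cons_self))
    have hmem : mulT (ofW c x) (ofW c' y) ∈ supp k (Two V W) (c.length + c'.length)
        (c.count true + c'.count true) := by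
      rw [mulT_ofW, ← List.length_append, ← List.count_append]
      exact ofW_mem_supp _ _
    -- The crossings of this shuffle stay within the first two blocks, so the rest of the tensor can
    -- be split off.
    have h1 : shuffleSum σ c.length c'.length (mulT (ofW c x) (mulT (ofW c' y) (ofW l' z'))) =
        mulT (shuffleSum σ c.length c'.length (mulT (ofW c x) (ofW c' y))) (ofW l' z') := by
      rw [← mulT_assoc, hσ, shuffleSum_eq, LinearMap.sum_apply, LinearMap.sum_apply, map_sum,
        LinearMap.sum_apply]
      refine Finset.sum_congr rfl fun γ _ => ?_
      exact wordProd_crossT_mulT _ _ (shuffleWord_bound γ) hmem _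
    have h2 : shuffleSum σ c.length c'.length (mulT (ofW c x) (ofW c' y)) ∈
        supp k (Two V W) (c.length + c'.length) (c.count true + c'.count true) := by
      rw [hσ]
      exact shuffleSum_mem_supp _ _ _ hmem
    rw [h1, blocks_mulT h2, blocks_ofW, blocks_ofW, hσ, B.sum_consT_shuffle φ h0 h0', map_sum]
    refine Finset.sum_congr rfl fun a _ => ?_
    rw [map_sum, map_sum]
    refine Finset.sum_congr rfl fun b _ => ?_
    rw [mergeT_zero]
  | i + 1, [], _, _, _, _, _, h, _ => by simp at h
  | i + 1, p :: s, σ, M, X, hσ, hs, hi, hX => by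
    rw [List.sum_cons] at hX
    refine supp_append_induction (P := fun X => mergeT (B.factorMul φ) (i + 1)
      (blocks k V W (p :: s) X) = blocks k V W (p :: mergeSizes i s)
        (faceSum (fun j => σ (j + p)) i s X)) ?_ (by simp)
      (fun x y hx hy => by simp only [map_add, hx, hy]) hX
    rintro c l x z rfl hl -
    -- Multiplication by the first block intertwines the crossings of the rest with the crossings
    -- shifted by the size of that block.
    have h1 : faceSum (fun j => σ (j + c.length)) i s (mulT (ofW c x) (ofW l z)) =
        mulT (ofW c x) (faceSum σ i s (ofW l z)) := by
      have := faceSum_intertwine (A := Module.End k (Tens k (Two V W))) (σ := σ)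
        (σ' := fun j => σ (j + c.length)) (x := mulT (ofW c x)) (fun j => by
          refine LinearMap.ext fun Z => ?_
          rw [hσ]
          exact (crossT_mulT_left _ c x j Z).symm) i s
      exact (LinearMap.congr_fun this (ofW l z)).symm
    have ih := MixedBraided.mergeT_blocks i s σ (l.count true) (ofW l z) hσ
      (fun p hp => hs p (List.mem_cons_of_mem _ hp)) (by simpa using hi)
      (by rw [← hl]; exact ofW_mem_supp l z)
    rw [h1, blocks_ofW, blocks_ofW, map_sum]
    refine Finset.sum_congr rfl fun b _ => ?_
    rw [mergeT_succ, ih]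

theorem faceSum_mem_supp (R : ∀ a b, Two V W a ⊗[k] Two V W b →ₗ[k] Two V W b ⊗[k] Two V W a)
    {N M : ℕ} {X : Tens k (Two V W)} (hX : X ∈ supp k (Two V W) N M) :
    ∀ (i : ℕ) (s : List ℕ) (a : ℕ),
      faceSum (fun j => crossT R (j + a)) i s X ∈ supp k (Two V W) N M
  | 0, [], a => Submodule.zero_mem _
  | 0, [_], a => Submodule.zero_mem _
  | 0, p :: q :: s, a => by
    rw [faceSum, shuffleSum_eq, LinearMap.sum_apply]
    refine Submodule.sum_mem _ fun γ _ => ?_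
    rw [wordProd_shift]
    exact wordProd_crossT_mem_supp R _ hX
  | i + 1, [], a => Submodule.zero_mem _
  | i + 1, p :: s, a => by
    rw [faceSum]
    simp only [add_assoc]
    exact faceSum_mem_supp R hX i s (p + a)

end BlockMerge

/-! ### The part of given total degree is spanned by cut words -/

section Homogeneous

variable {k V W : Type u} [Field k] [AddCommGroup V] [Module k V] [AddCommGroup W] [Module k W]

/-- The tensor along words that belongs to an element of `Graded k V W b`. -/
def gradedToTens (k V W : Type u) [Field k] [AddCommGroup V] [Module k V] [AddCommGroup W]
    [Module k W] (b : Bool) : Graded k V W b →ₗ[k] Tens k (Two V W) :=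
  DirectSum.toModule k {c : List Bool // c.count true = b.toNat} _ fun c => ofW c.1

theorem gradedToTens_lof {b : Bool} (c : {c : List Bool // c.count true = b.toNat})
    (x : WordTensor k (Two V W) c.1) :
    gradedToTens k V W b (DirectSum.lof k _ (fun c => WordTensor k (Two V W) c.1) c x) =
      ofW c.1 x := DirectSum.toModule_lof ..

theorem gradedToTens_mem_supp {b : Bool} {d : ℕ} {x : Graded k V W b}
    (hx : x ∈ gradedPart k V W b d) : gradedToTens k V W b x ∈ supp k (Two V W) d b.toNat := by
  refine (Submodule.span_le (p := (supp k (Two V W) d b.toNat).comap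
    (gradedToTens k V W b))).2 ?_ hx
  rintro _ ⟨c, y, rfl, rfl⟩
  rw [SetLike.mem_coe, Submodule.mem_comap, gradedToTens_lof]
  exact Submodule.subset_span ⟨c.1, y, rfl, c.2, rfl⟩

/-- The tensor along words that belongs to an element of a factor. -/
def ofFactor (k V W : Type u) [Field k] [AddCommGroup V] [Module k V] [AddCommGroup W]
    [Module k W] : ∀ b, Factor k V W b →ₗ[k] Tens k (Two V W)
  | false => (gradedToTens k V W false ∘ₗ (augmentationIdeal k V W).subtype :)
  | true => gradedToTens k V W true

theorem ofFactor_mem_supp : ∀ (b : Bool) {d : ℕ} {x : Factor k V W b},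
    x ∈ factorPart k V W b d → ofFactor k V W b x ∈ supp k (Two V W) d b.toNat
  | false, _, x, hx => gradedToTens_mem_supp (b := false) (x := x.1) hx
  | true, _, _, hx => gradedToTens_mem_supp hx

theorem toFactor_ofFactor_true (x : Factor k V W true) :
    toFactor k V W true (ofFactor k V W true x) = x := by
  refine LinearMap.congr_fun (f := toFactor k V W true ∘ₗ gradedToTens k V W true)
    (g := LinearMap.id) (DirectSum.linearMap_ext _ fun c => LinearMap.ext fun y => ?_) x
  simp only [LinearMap.comp_apply, gradedToTens_lof]
  exact toFactor_true c.2 y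

theorem toFactor_ofFactor_false (x : Factor k V W false) :
    toFactor k V W false (ofFactor k V W false x) = x := by
  apply Submodule.subtype_injective (augmentationIdeal k V W)
  obtain ⟨x, hx⟩ := x
  change (augmentationIdeal k V W).subtype (toFactor k V W false (gradedToTens k V W false x)) = x
  have hle : augmentationIdeal k V W ≤ LinearMap.eqLocus
      ((augmentationIdeal k V W).subtype ∘ₗ toFactor k V W false ∘ₗ gradedToTens k V W false)
      LinearMap.id := by
    refine iSup_le fun d => Submodule.span_le.2 ?_
    rintro _ ⟨c, y, hc, rfl⟩
    rw [SetLike.mem_coe, LinearMap.mem_eqLocus, LinearMap.comp_apply, LinearMap.comp_apply,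
      gradedToTens_lof]
    exact toFactor_false c.2 (by rintro h; rw [h] at hc; simp at hc) y
  exact hle hx

theorem toFactor_ofFactor : ∀ (b : Bool) (x : Factor k V W b),
    toFactor k V W b (ofFactor k V W b x) = x
  | false, x => toFactor_ofFactor_false x
  | true, x => toFactor_ofFactor_true x

theorem toFactor_mem_part (b : Bool) (c : List Bool) (x : WordTensor k (Two V W) c) :
    toFactor k V W b (ofW c x) ∈ factorPart k V W b c.length := by
  by_cases h : c.count true = b.toNat
  · rcases b
    · by_cases hc : c = []
      · have : toFactor k V W false (ofW c x) = 0 := by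
          rw [toFactor, ofWords_ofW, dif_neg fun h' => h'.2 hc]; rfl
        rw [this]
        exact Submodule.zero_mem _
      · change (augmentationIdeal k V W).subtype (toFactor k V W false (ofW c x)) ∈
          gradedPart k V W false c.length
        rw [toFactor_false h hc]
        exact Submodule.subset_span ⟨⟨c, h⟩, x, rfl, rfl⟩
    · rw [toFactor_true h]
      exact Submodule.subset_span ⟨⟨c, h⟩, x, rfl, rfl⟩
  · rw [toFactor_of_ne h (ofW_mem_supp c x)]
    exact Submodule.zero_mem _

/-- Neither factor has a part of degree `0`: the ideal `𝔍` excludes the empty word, and the words of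
`𝔐` contain a letter `W`. This is why the sizes form a composition with positive parts. -/
theorem toFactor_supp_zero (b : Bool) {M : ℕ} {X : Tens k (Two V W)}
    (hX : X ∈ supp k (Two V W) 0 M) : toFactor k V W b X = 0 := by
  refine supp_induction (p := fun X => toFactor k V W b X = 0) ?_ (map_zero _)
    (fun x y hx hy => by rw [map_add, hx, hy, add_zero]) hX
  intro c x hc _
  obtain rfl := List.length_eq_zero_iff.1 hc
  rcases b
  · rw [toFactor, ofWords_ofW, dif_neg fun h' => h'.2 rfl]; rfl
  · rw [toFactor, ofWords_ofW, dif_neg (by simp)]; rfl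

theorem mulT_mem_supp {Y : Bool → Type u} [∀ b, AddCommGroup (Y b)] [∀ b, Module k (Y b)]
    {N N' M M' : ℕ} {X Z : Tens k Y} (hX : X ∈ supp k Y N M) (hZ : Z ∈ supp k Y N' M') :
    mulT X Z ∈ supp k Y (N + N') (M + M') := by
  refine supp_induction (p := fun X => mulT X Z ∈ supp k Y (N + N') (M + M')) ?_ (by simp)
    (fun x y hx hy => by rw [map_add, LinearMap.add_apply]; exact Submodule.add_mem _ hx hy) hX
  rintro l x rfl rfl
  refine supp_induction (p := fun Z => mulT (ofW l x) Z ∈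
    supp k Y (l.length + N') (l.count true + M')) ?_ (by simp)
    (fun x y hx hy => by rw [map_add]; exact Submodule.add_mem _ hx hy) hZ
  rintro l' z rfl rfl
  rw [mulT_ofW, ← List.length_append, ← List.count_append]
  exact ofW_mem_supp _ _

/-- Pure tensors of homogeneous elements come from blocks. -/
theorem exists_blocks : ∀ (l : List Bool) (N : ℕ) (y : WordTensor k (Factor k V W) l),
    IsHomogeneousPure (factorPart k V W) l N y → y = 0 ∨ ∃ s X, (∀ p ∈ s, 0 < p) ∧
      s.length = l.length ∧ s.sum = N ∧ X ∈ supp k (Two V W) N (l.count true) ∧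
      ofW l y = blocks k V W s X
  | [], N, y, h => by
    obtain rfl : N = 0 := h
    obtain ⟨t, rfl⟩ := wordTensor_nil y
    refine Or.inr ⟨[], t • oneT k _, by simp, rfl, rfl,
      Submodule.smul_mem _ _ (ofW_mem_supp [] _), ?_⟩
    rw [map_smul, map_smul, blocks_nil]; rfl
  | b :: l, N, y, h => by
    obtain ⟨d, e, rfl, v, hv, z, hz, rfl⟩ := h
    have hv' := ofFactor_mem_supp b hv
    have zero_of : ∀ (v : Factor k V W b) (z : WordTensor k (Factor k V W) l), v = 0 ∨ z = 0 →
        consW b l v z = 0 := by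
      rintro v z (rfl | rfl) <;> simp
    -- A factor of degree `0` makes the pure tensor vanish; so all blocks that are really needed
    -- have positive size.
    rcases Nat.eq_zero_or_pos d with rfl | hd
    · refine Or.inl (zero_of v z (Or.inl ?_))
      rw [← toFactor_ofFactor b v, toFactor_supp_zero b hv']
    · rcases exists_blocks l e z hz with rfl | ⟨s, Z, hs, hl, hsum, hZ, he⟩
      · exact Or.inl (zero_of v 0 (Or.inr rfl))
      · refine Or.inr ⟨d :: s, mulT (ofFactor k V W b v) Z, ?_, by simp [hl], by simp [hsum], ?_, ?_⟩
        · intro p hp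
          rcases List.mem_cons.1 hp with rfl | hp
          · exact hd
          · exact hs p hp
        · have := mulT_mem_supp hv' hZ
          rwa [show (b :: l).count true = b.toNat + l.count true by
            rw [List.count_cons]; cases b <;> simp [add_comm]]
        · rw [blocks_mulT hv', Finset.sum_eq_single b, toFactor_ofFactor, ← he, consT_ofW]
          · rfl
          · intro b' _ hb
            rw [toFactor_of_ne (fun h => hb ?_) hv', map_zero, LinearMap.zero_apply]
            revert h; cases b <;> cases b' <;> simp
          · simp

/-- The span of the pure tensors of homogeneous elements of total degree `N`. -/
def homogeneousSpan (k V W : Type u) [Field k] [AddCommGroup V] [Module k V] [AddCommGroup W]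
    [Module k W] (q m N : ℕ) : Submodule k (Tens k (Factor k V W)) :=
  Submodule.span k {X | ∃ l y, l.length = q ∧ l.count true = m ∧
    IsHomogeneousPure (factorPart k V W) l N y ∧ X = ofW l y}

theorem consT_mem_homogeneousSpan {q m N d : ℕ} {b : Bool} {v : Factor k V W b}
    (hv : v ∈ factorPart k V W b d) {X : Tens k (Factor k V W)}
    (hX : X ∈ homogeneousSpan k V W q m N) :
    consT b v X ∈ homogeneousSpan k V W (q + 1) (b.toNat + m) (d + N) := by
  refine (Submodule.span_le (p := (homogeneousSpan k V W (q + 1) (b.toNat + m) (d + N)).comap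
    (consT b v))).2 ?_ hX
  rintro _ ⟨l, y, rfl, rfl, hy, rfl⟩
  rw [SetLike.mem_coe, Submodule.mem_comap, consT_ofW]
  refine Submodule.subset_span ⟨b :: l, _, rfl, ?_, ⟨d, N, rfl, v, hv, y, hy, rfl⟩, rfl⟩
  rw [List.count_cons]; cases b <;> simp [add_comm]

theorem blocks_mem_homogeneousSpan (s : List ℕ) {M : ℕ} {X : Tens k (Two V W)}
    (hX : X ∈ supp k (Two V W) s.sum M) :
    blocks k V W s X ∈ homogeneousSpan k V W s.length M s.sum := by
  induction s generalizing X M with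
  | nil =>
    refine supp_induction (p := fun X => blocks k V W [] X ∈ homogeneousSpan k V W 0 M 0) ?_
      (by simp) (fun x y hx hy => by rw [map_add]; exact Submodule.add_mem _ hx hy) hX
    intro l x hl hm
    obtain rfl := List.length_eq_zero_iff.1 hl
    obtain ⟨t, rfl⟩ := wordTensor_nil x
    rw [map_smul, map_smul, show ofW [] (nilW k (Two V W)) = oneT k _ from rfl, blocks_nil]
    exact Submodule.smul_mem _ _ (Submodule.subset_span ⟨[], _, rfl, hm, rfl, rfl⟩)
  | cons p s ih =>
    rw [List.sum_cons] at hX ⊢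
    refine supp_append_induction (P := fun X => blocks k V W (p :: s) X ∈
      homogeneousSpan k V W (s.length + 1) M (p + s.sum)) ?_ (by simp)
      (fun x y hx hy => by rw [map_add]; exact Submodule.add_mem _ hx hy) hX
    rintro c l x z rfl hl rfl
    rw [blocks_ofW]
    refine Submodule.sum_mem _ fun b _ => ?_
    by_cases h : c.count true = b.toNat
    · rw [h]
      refine consT_mem_homogeneousSpan (toFactor_mem_part b c x) (ih ?_)
      rw [← hl]
      exact ofW_mem_supp l z
    · rw [toFactor_of_ne h (ofW_mem_supp c x), map_zero, LinearMap.zero_apply]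
      exact Submodule.zero_mem _

theorem columnProj_blocks_mem (s : List ℕ) (m : ℕ) {X : Tens k (Two V W)}
    (hX : X ∈ supp k (Two V W) s.sum m) :
    columnProj k (Factor k V W) m s.length (blocks k V W s X) ∈
      columnPart (factorPart k V W) m s.length s.sum := by
  refine (Submodule.span_le (p := (columnPart (factorPart k V W) m s.length s.sum).comap
    (columnProj k (Factor k V W) m s.length))).2 ?_ (blocks_mem_homogeneousSpan s hX)
  rintro _ ⟨l, y, hl, hm, hy, rfl⟩
  rw [SetLike.mem_coe, Submodule.mem_comap, columnProj, ofWords_ofW, columnIncl,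
    dif_pos ⟨by rw [hl], hm⟩]
  exact Submodule.subset_span ⟨⟨l, by rw [hl], hm⟩, y, hy, rfl⟩

/-- It reduces both `d² = 0` and surjectivity to tensors along words cut into blocks. -/
theorem columnPart_le_span (m N : ℕ) (q : ℤ) : columnPart (factorPart k V W) m q N ≤
    Submodule.span k {x | ∃ s X, (∀ p ∈ s, 0 < p) ∧ (s.length : ℤ) = q ∧ s.sum = N ∧
      X ∈ supp k (Two V W) N m ∧ x = columnProj k (Factor k V W) m q (blocks k V W s X)} := by
  refine Submodule.span_le.2 ?_
  rintro _ ⟨l, y, hy, rfl⟩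
  rcases exists_blocks l.1 N y hy with rfl | ⟨s, X, hs, hl, hsum, hX, he⟩
  · rw [map_zero]
    exact Submodule.zero_mem _
  · refine Submodule.subset_span ⟨s, X, hs, by rw [hl, l.2.1], hsum, by rwa [l.2.2] at hX, ?_⟩
    rw [← he, columnProj, ofWords_ofW, columnIncl, dif_pos l.2]

end Homogeneous

/-! ### The square of the differential of `F_*` vanishes -/

section SquareZero

/-- The pairs `(i, j)` with `i ≤ j` correspond to the pairs `(j + 1, i)`, whose first entry is
larger than the second. Corresponding terms are equal up to opposite signs. -/
theorem sum_alternating_eq_zero {k M : Type*} [CommRing k] [AddCommGroup M] [Module k M] (n : ℕ)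
    (F : ℕ → ℕ → M) (h : ∀ i j, i ≤ j → j < n → F i j = F (j + 1) i) :
    ∑ i ∈ Finset.range (n + 1), ∑ j ∈ Finset.range n, ((-1 : k) ^ i * (-1 : k) ^ j) • F i j = 0 := by
  rw [← Finset.sum_product']
  refine Finset.sum_involution
    (fun p _ => if p.1 ≤ p.2 then (p.2 + 1, p.1) else (p.2, p.1 - 1)) ?_ ?_ ?_ ?_
  · rintro ⟨i, j⟩ hp
    rw [Finset.mem_product, Finset.mem_range, Finset.mem_range] at hp
    by_cases hij : i ≤ j
    · simp only [hij, if_true]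
      rw [h i j hij hp.2, ← add_smul]
      convert zero_smul k _
      ring
    · simp only [hij, if_false]
      obtain ⟨i, rfl⟩ : ∃ i', i = i' + 1 := ⟨i - 1, by omega⟩
      simp only at hp
      rw [Nat.add_sub_cancel, h j i (by omega) (by omega), ← add_smul]
      convert zero_smul k _
      ring
  · rintro ⟨i, j⟩ hp _ he
    by_cases hij : i ≤ j
    · simp only [hij, if_true, Prod.mk.injEq] at he; omega
    · simp only [hij, if_false, Prod.mk.injEq] at he; omega
  · rintro ⟨i, j⟩ hp
    rw [Finset.mem_product, Finset.mem_range, Finset.mem_range] at hp ⊢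
    simp only at hp
    by_cases hij : i ≤ j
    · simp only [hij, if_true]; omega
    · simp only [hij, if_false]; omega
  · rintro ⟨i, j⟩ hp
    by_cases hij : i ≤ j
    · simp only [hij, if_true]
      rw [if_neg (by omega)]
      simp
    · simp only [hij, if_false]
      rw [if_pos (by omega)]
      simp; omega

variable {k V W : Type u} [Field k] [AddCommGroup V] [Module k V] [AddCommGroup W] [Module k W]
  {B : MixedBraided k V W} {φ : V ⊗[k] W ≃ₗ[k] W ⊗[k] V}

variable (B φ) in
theorem MixedBraided.columnD_blocks (m : ℕ) (t : ℤ) (s : List ℕ) (hs : ∀ p ∈ s, 0 < p)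
    {X : Tens k (Two V W)} (hX : X ∈ supp k (Two V W) s.sum m) :
    columnD (B.factorMul φ) m s.length t (columnProj k _ m s.length (blocks k V W s X)) =
      ∑ i ∈ Finset.range (s.length - 1), (-1 : k) ^ i • columnProj k _ m t
        (blocks k V W (mergeSizes i s) (faceSum (crossT (noTrueCross (B.crossing φ))) i s X)) := by
  rw [columnD_columnProj m _ t (blocks_mem_supp s hX)]
  refine Finset.sum_congr rfl fun i hi => ?_
  rw [Finset.mem_range] at hi
  rw [B.mergeT_blocks φ i s _ m X rfl hs (by omega) hX]

/-- On cut words each face is a merge of sizes together with an element of the ring generated by the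
crossings. Both components satisfy the simplicial identities, by `mergeSizes_mergeSizes` and
`faceSum_faceSum`. -/
theorem MixedBraided.columnD_columnD
    (hσ : IsBraidSeq (crossT (k := k) (Y := Two V W) (noTrueCross (B.crossing φ)))) (m : ℕ)
    (t : ℤ) (s : List ℕ) (hs : ∀ p ∈ s, 0 < p) {X : Tens k (Two V W)}
    (hX : X ∈ supp k (Two V W) s.sum m) :
    columnD (B.factorMul φ) m (s.length - 1) t (columnD (B.factorMul φ) m s.length (s.length - 1)
      (columnProj k _ m s.length (blocks k V W s X))) = 0 := by
  rw [B.columnD_blocks φ m _ s hs hX, map_sum]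
  -- With fewer than two blocks there is no face. With `n + 2` blocks there are `n + 1` first faces,
  -- each followed by `n` second ones.
  rcases hn : s.length with _ | _ | n
  · simp
  · simp
  · have key : ∀ i ∈ Finset.range (n + 2 - 1), columnD (B.factorMul φ) m (((n + 1 + 1 : ℕ) : ℤ) - 1) t
        ((-1 : k) ^ i • columnProj k _ m (((n + 1 + 1 : ℕ) : ℤ) - 1) (blocks k V W (mergeSizes i s)
          (faceSum (crossT (noTrueCross (B.crossing φ))) i s X))) =
        ∑ j ∈ Finset.range n, ((-1 : k) ^ i * (-1 : k) ^ j) • columnProj k _ m t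
          (blocks k V W (mergeSizes j (mergeSizes i s))
            ((faceSum (crossT (noTrueCross (B.crossing φ))) j (mergeSizes i s) *
              faceSum (crossT (noTrueCross (B.crossing φ))) i s) X)) := by
      intro i hi
      rw [Finset.mem_range] at hi
      have hl := mergeSizes_length i s (by omega)
      have hl' : (((n + 1 + 1 : ℕ) : ℤ) - 1) = (mergeSizes i s).length := by omega
      rw [hl', map_smul, B.columnD_blocks φ m t (mergeSizes i s) (mergeSizes_pos i s hs)
        (by rw [mergeSizes_sum]; exact faceSum_mem_supp _ hX i s 0), Finset.smul_sum,
        show (mergeSizes i s).length - 1 = n by omega]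
      refine Finset.sum_congr rfl fun j _ => ?_
      rw [smul_smul]
      rfl
    rw [Finset.sum_congr rfl key]
    refine sum_alternating_eq_zero n _ fun i j hij hj => ?_
    rw [hσ.faceSum_faceSum i j s hij (by omega), mergeSizes_mergeSizes i j s hij (by omega)]

theorem MixedBraided.shuffleD_shuffleD
    (hσ : IsBraidSeq (crossT (k := k) (Y := Two V W) (noTrueCross (B.crossing φ)))) (m N : ℕ)
    (q t : ℤ) : B.shuffleD φ m N (q - 1) t ∘ₗ B.shuffleD φ m N q (q - 1) = 0 := by
  refine LinearMap.ext fun ⟨x, hx⟩ => Subtype.ext ?_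
  change columnD (B.factorMul φ) m (q - 1) t (columnD (B.factorMul φ) m q (q - 1) x) = 0
  refine (Submodule.span_le (p := LinearMap.ker (columnD (B.factorMul φ) m (q - 1) t ∘ₗ
    columnD (B.factorMul φ) m q (q - 1)))).2 ?_ (columnPart_le_span m N q hx)
  rintro _ ⟨s, X, hs, rfl, rfl, hX, rfl⟩
  exact B.columnD_columnD hσ m t s hs hX

end SquareZero

/-! ### Columns and cells as words -/

section ColumnWords

/-- The letters of the points of a column (from below), `true` being the puncture. -/
def Column.word (c : Column) : List Bool :=
  match c.mark with
  | none => List.replicate c.size false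
  | some j => List.replicate j false ++ true :: List.replicate (c.size - j - 1) false

/-- The puncture of a column is one of its points. -/
def Column.Valid (c : Column) : Prop := ∀ j ∈ c.mark, j < c.size

theorem Column.word_length {c : Column} (h : c.Valid) : c.word.length = c.size := by
  obtain ⟨p, _ | j⟩ := c
  · simp [word]
  · have : j < p := h j rfl
    simp [word]; omega

theorem Column.word_count (c : Column) : c.word.count true = c.mark.isSome.toNat := by
  obtain ⟨p, _ | j⟩ := c
  · simp [word, List.count_replicate]
  · simp [word, List.count_replicate]

/-- The number of letters before the only `true` is the mark of the column. -/
theorem Column.exists_word {l : List Bool} (h : l.count true ≤ 1) :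
    ∃ c : Column, c.Valid ∧ c.size = l.length ∧ c.word = l := by
  by_cases ht : true ∈ l
  · obtain ⟨l₁, l₂, rfl⟩ := List.append_of_mem ht
    rw [List.count_append, List.count_cons_self] at h
    have e : ∀ l : List Bool, l.count true = 0 → l = List.replicate l.length false := by
      intro l hl
      refine List.eq_replicate_iff.2 ⟨rfl, fun b hb => ?_⟩
      rw [List.count_eq_zero] at hl
      cases b
      · rfl
      · exact absurd hb hl
    refine ⟨⟨(l₁ ++ true :: l₂).length, some l₁.length⟩, ?_, rfl, ?_⟩
    · rintro j hj
      obtain rfl : l₁.length = j := by simpa using hj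
      simp
    · simp only [word, List.length_append, List.length_cons]
      rw [show l₁.length + (l₂.length + 1) - l₁.length - 1 = l₂.length by omega,
        ← e l₁ (by omega), ← e l₂ (by omega)]
  · refine ⟨⟨l.length, none⟩, by rintro j ⟨⟩, rfl, ?_⟩
    refine (List.eq_replicate_iff.2 ⟨rfl, fun b hb => ?_⟩).symm
    cases b
    · rfl
    · exact absurd hb ht

theorem colourOf_replicate {p x : ℕ} (h : x < p) : colourOf (List.replicate p false) x = false := by
  simp [colourOf, h]

theorem colourOf_append_left {l l' : List Bool} {x : ℕ} (h : x < l.length) :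
    colourOf (l ++ l') x = colourOf l x := by
  simp [colourOf, List.getElem?_append_left h]

theorem colourOf_append_right (l l' : List Bool) (x : ℕ) :
    colourOf (l ++ l') (l.length + x) = colourOf l' x := by
  simp [colourOf, List.getElem?_append_right]

theorem Column.colourOf_word {c : Column} (h : c.Valid) {x : ℕ} (hx : x < c.size) :
    colourOf c.word x = decide (c.mark = some x) := by
  obtain ⟨p, _ | j⟩ := c
  · simpa [word] using colourOf_replicate hx
  · have hj : j < p := h j rfl
    simp only [word] at hx ⊢
    rcases lt_trichotomy x j with h1 | rfl | h1
    · rw [colourOf_append_left (by simpa using h1), colourOf_replicate h1]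
      simp; omega
    · have := colourOf_append_cons (List.replicate x false) true
        (List.replicate (p - x - 1) false)
      rw [List.length_replicate] at this
      simpa using this
    · obtain ⟨d, rfl⟩ : ∃ d, x = j + 1 + d := ⟨x - j - 1, by omega⟩
      have := colourOf_append_right (List.replicate j false ++ [true])
        (List.replicate (p - j - 1) false) d
      simp only [List.append_assoc, List.singleton_append, List.length_append,
        List.length_replicate, List.length_singleton] at this
      rw [this, colourOf_replicate (by omega)]
      simp; omega

theorem eq_of_colourOf {l l' : List Bool} (h : l.length = l'.length)
    (hc : ∀ x, x < l.length → colourOf l x = colourOf l' x) : l = l' := by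
  refine List.ext_getElem h fun x hx hx' => ?_
  simpa [colourOf, hx, hx'] using hc x hx

/-- The letters of all points of a list of columns. -/
def cellWord (C : List Column) : List Bool := C.flatMap Column.word

/-- The sizes of a list of columns. -/
abbrev sizes (C : List Column) : List ℕ := C.map Column.size

theorem cellWord_cons (c : Column) (C : List Column) : cellWord (c :: C) = c.word ++ cellWord C :=
  List.flatMap_cons

theorem cellWord_append (C C' : List Column) : cellWord (C ++ C') = cellWord C ++ cellWord C' :=
  List.flatMap_append

theorem cellWord_length {C : List Column} (h : ∀ c ∈ C, c.Valid) :
    (cellWord C).length = (sizes C).sum := by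
  induction C with
  | nil => rfl
  | cons c C ih =>
    rw [cellWord_cons, List.length_append, Column.word_length (h c List.mem_cons_self),
      ih fun c hc => h c (List.mem_cons_of_mem _ hc)]
    rfl

theorem cellWord_count (C : List Column) :
    (cellWord C).count true = C.countP (fun c => c.mark.isSome) := by
  induction C with
  | nil => rfl
  | cons c C ih =>
    rw [cellWord_cons, List.count_append, Column.word_count, ih, List.countP_cons, add_comm]
    cases c.mark <;> simp

theorem Column.eq_of_word {c c' : Column} (h : c.Valid) (h' : c'.Valid) (hs : c.size = c'.size)
    (hw : c.word = c'.word) : c = c' := by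
  obtain ⟨p, a⟩ := c
  obtain ⟨p', b⟩ := c'
  obtain rfl : p = p' := hs
  have key : ∀ x, x < p → (a = some x ↔ b = some x) := by
    intro x hx
    have h1 := colourOf_word h hx
    have h2 := colourOf_word h' hx
    rw [hw, h2] at h1
    simpa using h1.symm
  congr 1
  rcases a with _ | i
  · rcases b with _ | j
    · rfl
    · exact absurd ((key j (h' j rfl)).2 rfl) (by simp)
  · exact ((key i (h i rfl)).1 rfl).symm

/-- The sizes show where to cut the word, and each piece determines its column. So a cell is the
same as a cut word, and `cellMap` keeps different cells apart. -/
theorem eq_of_cellWord : ∀ {C C' : List Column}, (∀ c ∈ C, c.Valid) → (∀ c ∈ C', c.Valid) →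
    sizes C = sizes C' → cellWord C = cellWord C' → C = C'
  | [], [], _, _, _, _ => rfl
  | [], _ :: _, _, _, h, _ => by simp at h
  | _ :: _, [], _, _, h, _ => by simp at h
  | c :: C, c' :: C', h, h', hs, hw => by
    simp only [sizes, List.map_cons, List.cons.injEq] at hs
    rw [cellWord_cons, cellWord_cons] at hw
    have hc := h c List.mem_cons_self
    have hc' := h' c' List.mem_cons_self
    obtain ⟨h1, h2⟩ := List.append_inj hw (by
      rw [Column.word_length hc, Column.word_length hc', hs.1])
    rw [Column.eq_of_word hc hc' hs.1 h1, eq_of_cellWord (fun c hc => h c (List.mem_cons_of_mem _ hc))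
      (fun c hc => h' c (List.mem_cons_of_mem _ hc)) hs.2 h2]

/-- It identifies the set `𝓘`, from which `η_𝓘` is formed, with the places of the letters `W` in the
word of the cell. -/
theorem mem_positions {C : List Column} (h : ∀ c ∈ C, c.Valid) (s x : ℕ)
    (hx : x < (sizes C).sum) : s + x ∈ positions s C ↔ colourOf (cellWord C) x = true := by
  induction C generalizing s x with
  | nil => simp at hx
  | cons c C ih =>
    have hc := h c List.mem_cons_self
    have hC : ∀ c ∈ C, c.Valid := fun c hc => h c (List.mem_cons_of_mem _ hc)
    have hlen := Column.word_length hc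
    simp only [sizes, List.map_cons, List.sum_cons] at hx
    rw [positions, List.mem_append, cellWord_cons]
    have hps := (positions_spec C (s + c.size) hC).1
    by_cases hxc : x < c.size
    · rw [colourOf_append_left (by omega), Column.colourOf_word hc hxc, decide_eq_true_eq]
      constructor
      · rintro (h1 | h1)
        · cases hm : c.mark with
          | none => rw [hm] at h1; simp at h1
          | some j => rw [hm] at h1; simp at h1; rw [h1]
        · have := hps _ h1; omega
      · intro h1
        left
        rw [h1]; simp
    · obtain ⟨y, rfl⟩ : ∃ y, x = c.size + y := ⟨x - c.size, by omega⟩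
      have := ih hC (s + c.size) y (by simp only [sizes]; omega)
      rw [← hlen, colourOf_append_right, hlen, ← this, ← add_assoc]
      refine or_iff_right fun h1 => ?_
      cases hm : c.mark with
      | none => rw [hm] at h1; simp at h1
      | some j =>
        rw [hm] at h1
        simp at h1
        have := hc j hm
        omega

end ColumnWords

/-! ### Merging columns by shuffles -/

section ShuffledColumns

theorem add_le_of_block_mono {N lo hi : ℕ} {γ : Equiv.Perm (Fin N)}
    (h : ∀ x y : Fin N, x < y → lo ≤ (x : ℕ) → (y : ℕ) < hi → γ x < γ y) :
    ∀ (d : ℕ) (x y : Fin N), (y : ℕ) = x + d → lo ≤ (x : ℕ) → (y : ℕ) < hi →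
      (γ x : ℕ) + d ≤ γ y := by
  intro d
  induction d with
  | zero =>
    intro x y hxy _ _
    obtain rfl : y = x := Fin.ext hxy
    simp
  | succ d ih =>
    intro x y hxy hx hy
    have h1 := ih x ⟨x + d, by omega⟩ rfl hx (by simp only; omega)
    have h2 := h ⟨x + d, by omega⟩ y (by rw [Fin.lt_def]; simp only; omega) (by simp only; omega) hy
    rw [Fin.lt_def] at h2
    omega

/-- The `j` right elements before this one are placed below it and the `q - 1 - j` after it above.
Hence `γ(p + j) - j` lies between `0` and `p`, the range of `h` in the differential. -/
theorem shuffle_right_bounds {p q : ℕ} {γ : Equiv.Perm (Fin (p + q))} (hγ : γ ∈ shuffles p q)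
    {j : ℕ} (x : Fin (p + q)) (hx : (x : ℕ) = p + j) : j ≤ (γ x : ℕ) ∧ (γ x : ℕ) ≤ p + j := by
  rw [shuffles, Finset.mem_filter] at hγ
  have h : ∀ x y : Fin (p + q), x < y → p ≤ (x : ℕ) → (y : ℕ) < p + q → γ x < γ y :=
    fun x y hxy hx _ => hγ.2.2 x y hxy hx
  have hj := x.2
  have h1 := add_le_of_block_mono h j ⟨p, by omega⟩ x (by simp only; omega) le_rfl x.2
  have h2 := add_le_of_block_mono h (q - 1 - j) x ⟨p + q - 1, by omega⟩ (by simp only; omega)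
    (by omega) (by simp only; omega)
  have h3 := (γ ⟨p + q - 1, by omega⟩).2
  omega

theorem shuffle_left_bounds {p q : ℕ} {γ : Equiv.Perm (Fin (p + q))} (hγ : γ ∈ shuffles p q)
    {j : ℕ} (hj : j < p) (x : Fin (p + q)) (hx : (x : ℕ) = j) :
    j ≤ (γ x : ℕ) ∧ (γ x : ℕ) ≤ q + j := by
  rw [shuffles, Finset.mem_filter] at hγ
  have h : ∀ x y : Fin (p + q), x < y → 0 ≤ (x : ℕ) → (y : ℕ) < p → γ x < γ y :=
    fun x y hxy _ hy => hγ.2.1 x y hxy hy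
  have h1 := add_le_of_block_mono h j ⟨0, by omega⟩ x (by simp only; omega) (by simp only; omega)
    (by omega)
  have h2 := add_le_of_block_mono h (p - 1 - j) x ⟨p - 1, by omega⟩ (by simp only; omega)
    (by omega) (by simp only; omega)
  have h3 := (γ ⟨p - 1, by omega⟩).2
  omega

/-- The position to which a shuffle carries `x`. -/
def permVal {N : ℕ} (γ : Equiv.Perm (Fin N)) (x : ℕ) : ℕ := if h : x < N then γ ⟨x, h⟩ else x

/-- The puncture of two merged columns. -/
def mergeMark (a b : Column) (γ : Equiv.Perm (Fin (a.size + b.size))) : Option ℕ :=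
  match a.mark, b.mark with
  | none, none => none
  | none, some j => some (permVal γ (a.size + j))
  | some j, _ => some (permVal γ j)

/-- Every shuffle belongs to exactly one `h`, the number of points of the unmarked column that it
puts below the puncture. The double sum is therefore a sum over all shuffles, with the new mark read
off from `γ`. -/
theorem mergeSum_eq {M : Type*} [AddCommMonoid M] {a b : Column} (ha : a.Valid) (hb : b.Valid)
    (hab : a.mark = none ∨ b.mark = none)
    (f : Column → Equiv.Perm (Fin (a.size + b.size)) → M) :
    mergeSum a b f = ∑ γ ∈ shuffles a.size b.size, f ⟨a.size + b.size, mergeMark a b γ⟩ γ := by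
  obtain ⟨p, a⟩ := a
  obtain ⟨q, b⟩ := b
  rcases a with _ | i <;> rcases b with _ | j
  · rfl
  · have hj : j < q := hb j rfl
    simp only [mergeSum, mergeMark]
    -- The index `h` is recovered as `γ(p + j) - j`; the subtraction does not truncate, by the lower
    -- bound for `γ(p + j)`.
    rw [← Finset.sum_fiberwise_of_maps_to (s := shuffles p q) (t := Finset.range (p + 1))
      (g := fun γ => permVal γ (p + j) - j)]
    · refine Finset.sum_congr rfl fun h _ => ?_
      refine Finset.sum_congr ?_ ?_
      · ext γ
        simp only [shufflesLeft, Finset.mem_filter, and_congr_right_iff]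
        intro hγ
        have h1 := shuffle_right_bounds hγ ⟨p + j, by omega⟩ rfl
        rw [permVal, dif_pos (by omega)]
        constructor
        · intro h2
          have := h2 ⟨p + j, by omega⟩ rfl
          omega
        · rintro h2 x hx
          rw [show x = ⟨p + j, by omega⟩ from Fin.ext hx]
          omega
      · intro γ hγ
        rw [Finset.mem_filter] at hγ
        have h1 := shuffle_right_bounds hγ.1 ⟨p + j, by omega⟩ rfl
        have h2 := hγ.2
        rw [permVal, dif_pos (by omega)] at h2 ⊢
        congr 3
        omega
    · intro γ hγ
      have h1 := shuffle_right_bounds hγ ⟨p + j, by omega⟩ rfl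
      rw [permVal, dif_pos (by omega), Finset.mem_range]
      omega
  · have hi : i < p := ha i rfl
    simp only [mergeSum, mergeMark]
    rw [← Finset.sum_fiberwise_of_maps_to (s := shuffles p q) (t := Finset.range (q + 1))
      (g := fun γ => permVal γ i - i)]
    · refine Finset.sum_congr rfl fun h _ => ?_
      refine Finset.sum_congr ?_ ?_
      · ext γ
        simp only [shufflesRight, Finset.mem_filter, and_congr_right_iff]
        intro hγ
        have h1 := shuffle_left_bounds hγ hi ⟨i, by omega⟩ rfl
        rw [permVal, dif_pos (by omega)]
        constructor
        · intro h2
          have := h2 ⟨i, by omega⟩ rfl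
          omega
        · rintro h2 x hx
          rw [show x = ⟨i, by omega⟩ from Fin.ext hx]
          omega
      · intro γ hγ
        rw [Finset.mem_filter] at hγ
        have h1 := shuffle_left_bounds hγ.1 hi ⟨i, by omega⟩ rfl
        have h2 := hγ.2
        rw [permVal, dif_pos (by omega)] at h2 ⊢
        congr 3
        omega
    · intro γ hγ
      have h1 := shuffle_left_bounds hγ hi ⟨i, by omega⟩ rfl
      rw [permVal, dif_pos (by omega), Finset.mem_range]
      omega
  · simp at hab

theorem mergeMark_valid {a b : Column} (ha : a.Valid) (hb : b.Valid)
    (γ : Equiv.Perm (Fin (a.size + b.size))) :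
    Column.Valid ⟨a.size + b.size, mergeMark a b γ⟩ := by
  have key : ∀ x, x < a.size + b.size → permVal γ x < a.size + b.size := by
    intro x hx
    rw [permVal, dif_pos hx]
    exact (γ _).2
  obtain ⟨p, a⟩ := a
  obtain ⟨q, b⟩ := b
  rcases a with _ | i <;> rcases b with _ | j <;> intro x hx <;>
    simp only [mergeMark, Option.mem_def, Option.some.injEq, reduceCtorEq] at hx
  · have := hb j rfl
    rw [← hx]
    exact key _ (by simp only at this ⊢; omega)
  all_goals
    have := ha i rfl
    rw [← hx]
    exact key _ (by simp only at this ⊢; omega)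

/-- Shuffling the words of two columns gives the word of the merged column. -/
theorem wordSwap_columns {a b : Column} (ha : a.Valid) (hb : b.Valid)
    (hab : a.mark = none ∨ b.mark = none) {γ : Equiv.Perm (Fin (a.size + b.size))}
    (hγ : γ ∈ shuffles a.size b.size) :
    wordSwap (shuffleWord a.size b.size γ) (a.word ++ b.word) =
      Column.word ⟨a.size + b.size, mergeMark a b γ⟩ := by
  have hlen : (a.word ++ b.word).length = a.size + b.size := by
    rw [List.length_append, Column.word_length ha, Column.word_length hb]
  have hv := mergeMark_valid ha hb γ
  refine eq_of_colourOf ?_ fun y hy => ?_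
  · rw [wordSwap_length, hlen, Column.word_length hv]
  · rw [wordSwap_length, hlen] at hy
    rw [Column.colourOf_word hv hy]
    obtain ⟨x, hx⟩ := γ.surjective ⟨y, hy⟩
    -- The number of strands is made a variable because `γ` permutes `a.size + b.size` places, which
    -- equals the length of the word only by `hlen`.
    have h1 : ∀ (N : ℕ) (l : List Bool) (w : List ℕ) (x : Fin N), l.length = N →
        (∀ i ∈ w, i + 1 < N) → colourOf (wordSwap w l) (braidPerm N (wordBraid N w) x) =
          colourOf l x := by
      rintro _ l w x rfl hw
      exact colourOf_wordSwap w l hw x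
    have h2 := h1 _ (a.word ++ b.word) (shuffleWord a.size b.size γ) x hlen (shuffleWord_bound γ)
    rw [braidPerm_shuffleWord hγ, hx] at h2
    rw [h2]
    -- The letter in place `y` after the shuffle is the letter that stood in the place `x` with `γ x
    -- = y`; so the new puncture is at `y` exactly if the old one was at `x`.
    have hinj : ∀ z : ℕ, z < a.size + b.size → (permVal γ z = y ↔ z = x) := by
      intro z hz
      rw [permVal, dif_pos hz]
      constructor
      · intro h3
        have : γ ⟨z, hz⟩ = γ x := by rw [hx]; exact Fin.ext h3
        exact congrArg Fin.val (γ.injective this)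
      · rintro rfl
        exact congrArg Fin.val hx
    have hla := Column.word_length ha
    have key : colourOf (a.word ++ b.word) x = decide (a.mark = some (x : ℕ) ∨
        ∃ j, b.mark = some j ∧ (x : ℕ) = a.size + j) := by
      by_cases hxa : (x : ℕ) < a.size
      · rw [colourOf_append_left (by omega), Column.colourOf_word ha hxa, decide_eq_decide]
        refine ⟨Or.inl, ?_⟩
        rintro (h | ⟨j, -, hj⟩)
        · exact h
        · omega
      · obtain ⟨z, hz⟩ : ∃ z, (x : ℕ) = a.size + z := ⟨x - a.size, by omega⟩
        have := x.2
        rw [hz, ← hla, colourOf_append_right, Column.colourOf_word hb (by omega),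
          decide_eq_decide, hla]
        constructor
        · intro h
          exact Or.inr ⟨z, h, rfl⟩
        · rintro (h | ⟨j, hj, e⟩)
          · have := ha _ h; omega
          · rw [hj]; congr 1; omega
    rw [key, decide_eq_decide]
    obtain ⟨p, a⟩ := a
    obtain ⟨q, b⟩ := b
    rcases a with _ | i <;> rcases b with _ | j <;> simp only [mergeMark]
    · simp
    · have := hb j rfl
      simp only [Option.some.injEq]
      rw [hinj _ (by simp only at this ⊢; omega)]
      simp [eq_comm]
    · have := ha i rfl
      simp only [Option.some.injEq]
      rw [hinj _ (by simp only at this ⊢; omega)]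
      simp
    · simp at hab

end ShuffledColumns

/-! ### Faces at a given position of a list of blocks -/

section FaceSum

theorem faceSum_append {A : Type*} [Ring A] (p q : ℕ) (s₂ : List ℕ) : ∀ (s₁ : List ℕ) (σ : ℕ → A),
    faceSum σ s₁.length (s₁ ++ p :: q :: s₂) = shuffleSum (fun j => σ (j + s₁.sum)) p q
  | [], _ => rfl
  | a :: s₁, σ => by
    change faceSum (fun j => σ (j + a)) s₁.length (s₁ ++ p :: q :: s₂) = _
    rw [faceSum_append p q s₂ s₁, List.sum_cons]
    congr 1
    funext j
    congr 1
    omega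

theorem mergeSizes_append (p q : ℕ) (s₂ : List ℕ) : ∀ s₁ : List ℕ,
    mergeSizes s₁.length (s₁ ++ p :: q :: s₂) = s₁ ++ (p + q) :: s₂
  | [] => rfl
  | a :: s₁ => congrArg (a :: ·) (mergeSizes_append p q s₂ s₁)

theorem neg_one_pow_apply {k M : Type*} [CommRing k] [AddCommGroup M] [Module k M] (d : ℕ) (x : M) :
    ((-1 : Module.End k M) ^ d) x = (-1 : k) ^ d • x := by
  rcases Nat.even_or_odd d with hd | hd <;> simp [hd.neg_one_pow]

end FaceSum

/-! ### The comparison map and its compatibility with the differentials -/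

section CellMap

variable {k V W : Type u} [Field k] [AddCommGroup V] [Module k V] [AddCommGroup W] [Module k W]

/-- The element of `F_q((𝔐, …, 𝔐), 𝔍)` that belongs to `C ⊗ ℓ`. -/
def cellMap (φ : V ⊗[k] W ≃ₗ[k] W ⊗[k] V) (n m : ℕ) (q : ℤ) :
    CellComplex n m (BaseTensor k V W n m) (q + n - m) →ₗ[k]
      ColumnComplex k (Factor k V W) m q :=
  Finsupp.lsum k fun C => columnProj k (Factor k V W) m q ∘ₗ blocks k V W (sizes C.1) ∘ₗ
    arrangeT (Y := Two V W) φ.toLinearMap n m (cellWord C.1)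

theorem cellMap_single (φ : V ⊗[k] W ≃ₗ[k] W ⊗[k] V) (n m : ℕ) (q : ℤ)
    (C : Cell n m (q + n - m)) (x : BaseTensor k V W n m) :
    cellMap φ n m q (Finsupp.single C x) = columnProj k (Factor k V W) m q
      (blocks k V W (sizes C.1) (arrangeT (Y := Two V W) φ.toLinearMap n m (cellWord C.1) x)) := by
  rw [cellMap, Finsupp.lsum_single]; rfl

theorem cellMap_cellIncl (φ : V ⊗[k] W ≃ₗ[k] W ⊗[k] V) (n m : ℕ) (q : ℤ) {C : List Column}
    (h : IsCell n m (q + n - m) C) (x : BaseTensor k V W n m) :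
    cellMap φ n m q (cellIncl k n m _ _ C x) = columnProj k (Factor k V W) m q
      (blocks k V W (sizes C) (arrangeT (Y := Two V W) φ.toLinearMap n m (cellWord C) x)) := by
  rw [cellIncl, dif_pos h]
  exact cellMap_single φ n m q ⟨C, h⟩ x

/-- The blocks of two columns with punctures both lie in `𝔐` and in no other factor, and products of
two elements of `𝔐` are `0`. This matches the vanishing of `d_i` for `i, i + 1 ∈ I`. -/
theorem mergeT_blocks_marked (B : MixedBraided k V W) (φ : V ⊗[k] W ≃ₗ[k] W ⊗[k] V)
    {a b : Column} (ha : a.Valid) (hb : b.Valid) (ha' : a.mark.isSome) (hb' : b.mark.isSome)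
    (C₂ : List Column) : ∀ (C₁ : List Column), (∀ c ∈ C₁, c.Valid) → ∀ (l : List Bool),
    l = cellWord (C₁ ++ a :: b :: C₂) → ∀ X : WordTensor k (Two V W) l,
    mergeT (B.factorMul φ) C₁.length (blocks k V W (sizes (C₁ ++ a :: b :: C₂)) (ofW l X)) = 0
  | [], _, l, hl, X => by
    rw [List.nil_append, cellWord_cons, cellWord_cons] at hl
    subst hl
    refine ofW_append_induction (p := fun X => mergeT (B.factorMul φ) 0
      (blocks k V W (a.size :: b.size :: sizes C₂) X) = 0) a.word _ (fun x z => ?_) (by simp)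
      (fun x y hx hy => by simp only [map_add, hx, hy, add_zero]) X
    refine ofW_append_induction (p := fun Z => mergeT (B.factorMul φ) 0
      (blocks k V W (a.size :: b.size :: sizes C₂) (mulT (ofW a.word x) Z)) = 0) b.word _
      (fun y z => ?_) (by simp) (fun x y hx hy => by simp only [map_add, hx, hy, add_zero]) z
    rw [← Column.word_length ha, ← Column.word_length hb, blocks_ofW, blocks_ofW]
    have h1 := toFactor_of_ne (k := k) (b := false) (by rw [Column.word_count, ha']; simp)
      (ofW_mem_supp (k := k) (Y := Two V W) a.word x)
    have h2 := toFactor_of_ne (k := k) (b := false) (by rw [Column.word_count, hb']; simp)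
      (ofW_mem_supp (k := k) (Y := Two V W) b.word y)
    rw [Fintype.sum_bool, Fintype.sum_bool, h1, h2, map_zero, LinearMap.zero_apply,
      LinearMap.zero_apply, add_zero, add_zero, mergeT_zero,
      show B.factorMul φ true true = 0 from rfl, LinearMap.zero_apply, LinearMap.zero_apply,
      map_zero, LinearMap.zero_apply]
  | c :: C₁, hC, l, hl, X => by
    rw [List.cons_append, cellWord_cons] at hl
    subst hl
    refine ofW_append_induction (p := fun X => mergeT (B.factorMul φ) (C₁.length + 1)
      (blocks k V W (c.size :: sizes (C₁ ++ a :: b :: C₂)) X) = 0) c.word _ (fun x z => ?_) (by simp)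
      (fun x y hx hy => by simp only [map_add, hx, hy, add_zero]) X
    rw [← Column.word_length (hC c List.mem_cons_self), blocks_ofW, map_sum]
    refine Finset.sum_eq_zero fun b' _ => ?_
    rw [mergeT_succ, mergeT_blocks_marked B φ ha hb ha' hb' C₂ C₁
      (fun c hc => hC c (List.mem_cons_of_mem _ hc)) _ rfl z, map_zero]

theorem isCell_merge {n m : ℕ} {r : ℤ} {C₁ C₂ : List Column} {a b : Column}
    (h : IsCell n m r (C₁ ++ a :: b :: C₂)) (hab : a.mark = none ∨ b.mark = none)
    (γ : Equiv.Perm (Fin (a.size + b.size))) :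
    IsCell n m (r - 1) (C₁ ++ ⟨a.size + b.size, mergeMark a b γ⟩ :: C₂) := by
  obtain ⟨h1, h2, h3, h4, h5⟩ := h
  have ha : a.Valid := h5 a (by simp)
  have hb : b.Valid := h5 b (by simp)
  have hv := mergeMark_valid ha hb γ
  have hpa := h1 a (by simp)
  refine ⟨?_, ?_, ?_, ?_, ?_⟩
  · intro c hc
    rcases List.mem_append.1 hc with hc | hc
    · exact h1 c (by simp [hc])
    · rcases List.mem_cons.1 hc with rfl | hc
      · simp only; omega
      · exact h1 c (by simp [hc])
  · rw [← h2]
    simp [add_assoc]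
  · simp only [List.length_append, List.length_cons] at h3 ⊢
    push_cast at h3 ⊢
    omega
  · rw [← h4]
    simp only [List.countP_append, List.countP_cons, mergeMark]
    rcases ha' : a.mark with _ | i <;> rcases hb' : b.mark with _ | j <;> simp
    rw [ha', hb'] at hab
    simp at hab
  · intro c hc
    rcases List.mem_append.1 hc with hc | hc
    · exact h5 c (by simp [hc])
    · rcases List.mem_cons.1 hc with rfl | hc
      · exact hv
      · exact h5 c (by simp [hc])

theorem IsCell.word_counts {n m : ℕ} {r : ℤ} {C : List Column} (h : IsCell n m r C) :
    (cellWord C).count false = n ∧ (cellWord C).length = n + m ∧ (cellWord C).count true = m := by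
  have h1 := cellWord_length h.2.2.2.2
  have h2 := cellWord_count C
  have h3 := List.count_false_add_count_true (cellWord C)
  rw [h.2.2.2.1] at h2
  rw [show (sizes C).sum = n + m from h.2.1] at h1
  omega

theorem arrangeT_mem_supp (φ : V ⊗[k] W ≃ₗ[k] W ⊗[k] V) {n m : ℕ} {r : ℤ} {C : List Column}
    (h : IsCell n m r C) (x : BaseTensor k V W n m) :
    arrangeT (Y := Two V W) φ.toLinearMap n m (cellWord C) x ∈
      supp k (Two V W) (sizes C).sum m := by
  have := ofW_mem_supp (k := k) (Y := Two V W) (cellWord C) (arrange φ.toLinearMap (cellWord C) n m x)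
  rwa [h.word_counts.2.2, cellWord_length h.2.2.2.2] at this

/-- The faces of `F_*` are those of `D(n,m)_*`, if not both columns contain a puncture. -/
theorem MixedBraided.faceSum_arrangeT {B : MixedBraided k V W} {φ : V ⊗[k] W ≃ₗ[k] W ⊗[k] V}
    (hφ : B.IsSeparatedBraiding φ) (hB : B.Compatible φ) {n m : ℕ} {r : ℤ}
    {C₁ C₂ : List Column} {a b : Column} (h : IsCell n m r (C₁ ++ a :: b :: C₂))
    (hab : a.mark = none ∨ b.mark = none) (I : Finset (Fin (n + m))) (hI : I.card = m)
    (hmem : ∀ j : Fin (n + m), colourOf (cellWord (C₁ ++ a :: b :: C₂)) j = true ↔ j ∈ I)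
    (x : BaseTensor k V W n m) :
    faceSum (B.signedCross φ) C₁.length (sizes (C₁ ++ a :: b :: C₂))
        (arrangeT (Y := Two V W) φ.toLinearMap n m (cellWord (C₁ ++ a :: b :: C₂)) x) =
      ∑ γ ∈ shuffles a.size b.size, ((Equiv.Perm.sign γ : ℤ) : k) •
        arrangeT (Y := Two V W) φ.toLinearMap n m
          (cellWord (C₁ ++ ⟨a.size + b.size, mergeMark a b γ⟩ :: C₂))
          (B.rep n m (eta I hI (localLift (n + m) (sizes C₁).sum _ _ γ)) x) := by
  have ha : a.Valid := h.2.2.2.2 a (by simp)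
  have hb : b.Valid := h.2.2.2.2 b (by simp)
  have hC₁ : ∀ c ∈ C₁, c.Valid := fun c hc => h.2.2.2.2 c (by simp [hc])
  have hword : cellWord (C₁ ++ a :: b :: C₂) =
      cellWord C₁ ++ ((a.word ++ b.word) ++ cellWord C₂) := by
    rw [cellWord_append, cellWord_cons, cellWord_cons, List.append_assoc]
  have hcounts := h.word_counts
  have hl₁ := cellWord_length hC₁
  have hlen : (a.word ++ b.word).length = a.size + b.size := by
    rw [List.length_append, Column.word_length ha, Column.word_length hb]
  have hf := faceSum_append (A := Module.End k (Tens k (Two V W))) a.size b.size (sizes C₂)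
    (sizes C₁) (B.signedCross φ)
  rw [List.length_map] at hf
  rw [show sizes (C₁ ++ a :: b :: C₂) = sizes C₁ ++ a.size :: b.size :: sizes C₂ by simp, hf,
    shuffleSum_eq, LinearMap.sum_apply]
  refine Finset.sum_congr rfl fun γ hγ => ?_
  -- The signs of the crossings are collected in front; the unsigned crossings then act on the
  -- arranged tensor, which was formed with `φ` and not with `-φ`.
  rw [wordProd_shift, wordProd_neg (B.signedCross_eq φ), List.length_map, Module.End.mul_apply]
  rw [hword] at hcounts hmem ⊢
  have key := B.wordProd_arrangeT hφ hB (n := n) (m := m) (cellWord C₁) (a.word ++ b.word)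
    (cellWord C₂) (shuffleWord a.size b.size γ) (by rw [hlen]; exact shuffleWord_bound γ) (by
      rw [List.count_append, Column.word_count, Column.word_count]
      rcases hab with hab | hab <;> rw [hab] <;>
        simp [Bool.toNat_le]) ⟨hcounts.1, hcounts.2.1⟩ x
  rw [hl₁] at key
  rw [key, wordSwap_columns ha hb hab hγ, cellWord_append, cellWord_cons]
  have hs : ((Equiv.Perm.sign γ : ℤ) : k) = (-1) ^ (shuffleWord a.size b.size γ).length := by
    rw [sign_shuffle hγ]; simp
  -- Behind the last place `colourOf` has the default value `true`, as `baseColouring` has there;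
  -- otherwise the two colourings could not be joined by a braid.
  have hr := mixedBraidLift_eta (B.relations n m) I hI
    (localLift (n + m) (sizes C₁).sum a.size b.size γ)
    (wordColouring n m _ ⟨hcounts.1, hcounts.2.1⟩) hmem (fun j hj => by
      simp only [wordColouring, colourOf]
      rw [List.getD_eq_default _ _ (by rw [hcounts.2.1]; exact hj)])
  rw [hs, neg_one_pow_apply]
  congr 2
  exact (congrArg (fun g : BaseTensor k V W n m ≃ₗ[k] BaseTensor k V W n m => g x) hr).symm

/-- This is one face of the chain map. If at most one of the two columns is marked, the terms agree
shuffle by shuffle; if both are, both sides vanish. -/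
theorem MixedBraided.cellMap_mergeSum {B : MixedBraided k V W} {φ : V ⊗[k] W ≃ₗ[k] W ⊗[k] V}
    (hφ : B.IsSeparatedBraiding φ) (hB : B.Compatible φ) {n m : ℕ} {q t : ℤ} (ht : t = q - 1)
    {C C₁ C₂ : List Column} {a b : Column} (hC : C = C₁ ++ a :: b :: C₂)
    (h : IsCell n m (q + n - m) C) (I : Finset (Fin (n + m))) (hI : I.card = m)
    (hmem : ∀ j : Fin (n + m), colourOf (cellWord C) j = true ↔ j ∈ I)
    (x : BaseTensor k V W n m) (u : k) :
    cellMap φ n m t ((mergeSum a b fun c γ => (u * ((Equiv.Perm.sign γ : ℤ) : k)) •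
        (cellIncl k n m (BaseTensor k V W n m) (t + n - m) (C₁ ++ c :: C₂) ∘ₗ
          B.rep n m (eta I hI (localLift (n + m) (sizes C₁).sum _ _ γ)))) x) =
      u • columnProj k (Factor k V W) m t (blocks k V W (mergeSizes C₁.length (sizes C))
        (faceSum (B.signedCross φ) C₁.length (sizes C)
          (arrangeT (Y := Two V W) φ.toLinearMap n m (cellWord C) x))) := by
  subst hC
  have ha : a.Valid := h.2.2.2.2 a (by simp)
  have hb : b.Valid := h.2.2.2.2 b (by simp)
  by_cases hab : a.mark = none ∨ b.mark = none
  · rw [mergeSum_eq ha hb hab, LinearMap.sum_apply, map_sum,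
      B.faceSum_arrangeT hφ hB h hab I hI hmem, map_sum, map_sum, Finset.smul_sum]
    refine Finset.sum_congr rfl fun γ _ => ?_
    have hcell := isCell_merge h hab γ
    rw [show q + n - m - 1 = t + n - m by omega] at hcell
    have hms := mergeSizes_append a.size b.size (sizes C₂) (sizes C₁)
    rw [List.length_map] at hms
    rw [LinearMap.smul_apply, map_smul, LinearMap.comp_apply, cellMap_cellIncl φ n m t hcell,
      map_smul, map_smul, smul_smul,
      show sizes (C₁ ++ a :: b :: C₂) = sizes C₁ ++ a.size :: b.size :: sizes C₂ by simp, hms]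
    simp
  · have ha' : a.mark.isSome := by
      rw [Option.isSome_iff_ne_none]; exact fun h => hab (Or.inl h)
    have hb' : b.mark.isSome := by
      rw [Option.isSome_iff_ne_none]; exact fun h => hab (Or.inr h)
    have h0 : mergeSum a b (fun c γ => (u * ((Equiv.Perm.sign γ : ℤ) : k)) •
        (cellIncl k n m (BaseTensor k V W n m) (t + n - m) (C₁ ++ c :: C₂) ∘ₗ
          B.rep n m (eta I hI (localLift (n + m) (sizes C₁).sum _ _ γ)))) = 0 := by
      obtain ⟨i, hi⟩ := Option.isSome_iff_exists.1 ha'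
      obtain ⟨j, hj⟩ := Option.isSome_iff_exists.1 hb'
      simp only [mergeSum]
      rw [hi, hj]
    -- The shuffled tensor on the right need not be zero before it is cut. Its vanishing is seen by
    -- reading the expression backwards, as a product of two neighbouring factors in `𝔐`.
    have h1 := B.signTwist.mergeT_blocks (negEquiv φ) C₁.length (sizes (C₁ ++ a :: b :: C₂))
      (B.signedCross φ) m _ rfl (by
        intro p hp
        obtain ⟨c, hc, rfl⟩ := List.mem_map.1 hp
        exact h.1 c hc) (by simp) (arrangeT_mem_supp φ h x)
    rw [h0, ← h1, arrangeT, LinearMap.comp_apply, mergeT_blocks_marked _ _ ha hb ha' hb' C₂ C₁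
      (fun c hc => h.2.2.2.2 c (by simp [hc])) _ rfl]
    simp

/-- `cellMap` is a chain map. -/
theorem MixedBraided.cellMap_cellD {B : MixedBraided k V W} {φ : V ⊗[k] W ≃ₗ[k] W ⊗[k] V}
    (hφ : B.IsSeparatedBraiding φ) (hB : B.Compatible φ) {n m : ℕ} {q t : ℤ} (ht : t = q - 1)
    (x : CellComplex n m (BaseTensor k V W n m) (q + n - m)) :
    cellMap φ n m t (cellD (B.rep n m) (q + n - m) (t + n - m) x) =
      columnD (B.signTwist.factorMul (negEquiv φ)) m q t (cellMap φ n m q x) := by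
  induction x using Finsupp.induction_linear with
  | zero => simp
  | add x y hx hy => simp only [map_add, hx, hy]
  | single C x =>
    obtain ⟨C, hC⟩ := C
    have hq : q = (sizes C).length := by
      have := hC.2.2.1
      rw [List.length_map]; omega
    have hpos : ∀ p ∈ sizes C, 0 < p := by
      intro p hp
      obtain ⟨c, hc, rfl⟩ := List.mem_map.1 hp
      exact hC.1 c hc
    rw [cellMap_single]
    have hd := B.signTwist.columnD_blocks (negEquiv φ) m t (sizes C) hpos
      (arrangeT_mem_supp φ hC x)
    rw [← hq] at hd
    rw [hd, cellD, Finsupp.lsum_single, LinearMap.sum_apply, map_sum, List.length_map,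
      ← Fin.sum_univ_eq_sum_range (fun i => (-1 : k) ^ i • columnProj k (Factor k V W) m t
        (blocks k V W (mergeSizes i (sizes C)) (faceSum (B.signedCross φ) i (sizes C)
          (arrangeT (Y := Two V W) φ.toLinearMap n m (cellWord C) x))))]
    refine Finset.sum_congr rfl fun i _ => ?_
    have hi : (i : ℕ) + 1 < C.length := by have := i.2; simp only at this; omega
    have e : C = C.take i ++ C[(i : ℕ)] :: C[(i : ℕ) + 1] :: C.drop (i + 2) := by
      rw [← List.drop_eq_getElem_cons, ← List.drop_eq_getElem_cons, List.take_append_drop]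
    have hlen : (C.take i).length = i := by rw [List.length_take]; omega
    have key := B.cellMap_mergeSum hφ hB ht e hC (positionSet (n + m) C)
      (Cell.card_positionSet ⟨C, hC⟩) (fun j => by
        have hj : (j : ℕ) < (sizes C).sum := by rw [show (sizes C).sum = n + m from hC.2.1]; exact j.2
        have := mem_positions (C := C) hC.2.2.2.2 0 j hj
        rw [zero_add] at this
        simp [positionSet, this]) x ((-1) ^ (i : ℕ))
    rw [hlen] at key
    exact key

end CellMap

/-! ### Arrangement is bijective -/

section ArrangeBijective

variable {k : Type u} [Field k] {Y : Bool → Type u} [∀ b, AddCommGroup (Y b)]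
  [∀ b, Module k (Y b)]

theorem tailMap_bijective (a : Bool) {l l' : List Bool}
    {f : WordTensor k Y l →ₗ[k] WordTensor k Y l'} (hf : Function.Bijective f) :
    Function.Bijective (tailMap a f) :=
  ((LinearEquiv.ofBijective f hf).lTensor (Y a)).bijective

theorem front_bijective (φ : Y false ⊗[k] Y true ≃ₗ[k] Y true ⊗[k] Y false) (u : List Bool) :
    ∀ n : ℕ, Function.Bijective (front φ.toLinearMap n u)
  | 0 => Function.bijective_id
  | n + 1 => by
    have h := (tensorIdEquiv (WordTensor k Y (falseWord n u)) φ).bijective.comp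
      (tailMap_bijective false (front_bijective φ u n))
    exact h

theorem arrange_bijective (φ : Y false ⊗[k] Y true ≃ₗ[k] Y true ⊗[k] Y false) :
    ∀ (l : List Bool) (n m : ℕ), l.count false = n → l.count true = m →
      Function.Bijective (arrange φ.toLinearMap l n m)
  | [], 0, 0, _, _ => Function.bijective_id
  | [], _ + 1, _, h, _ => by simp at h
  | [], 0, _ + 1, _, h => by simp at h
  | false :: l, 0, _, h, _ => by simp at h
  | false :: l, n + 1, m, hn, hm =>
    tailMap_bijective false (arrange_bijective φ l n m (by simpa using hn) (by simpa using hm))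
  | true :: l, _, 0, _, h => by simp at h
  | true :: l, n, m + 1, hn, hm => by
    have h := (tailMap_bijective true (arrange_bijective φ l n m (by simpa using hn)
      (by simpa using hm))).comp (front_bijective φ (List.replicate m true) n)
    cases n <;> exact h

end ArrangeBijective

/-! ### Recovering a word and its cut from the factors -/

section Unblock

variable {k V W : Type u} [Field k] [AddCommGroup V] [Module k V] [AddCommGroup W] [Module k W]

/-- The projection to the words of length `p`. -/
def lengthProj (k V W : Type u) [Field k] [AddCommGroup V] [Module k V] [AddCommGroup W]
    [Module k W] (p : ℕ) : Tens k (Two V W) →ₗ[k] Tens k (Two V W) :=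
  ofWords fun c => if c.length = p then ofW c else 0

/-- Concatenate tensors in the factors, if their degrees are the given ones. -/
def unblock (k V W : Type u) [Field k] [AddCommGroup V] [Module k V] [AddCommGroup W]
    [Module k W] : List ℕ → Tens k (Factor k V W) →ₗ[k] Tens k (Two V W)
  | [] => ofWords fun l => match l with
    | [] => (LinearMap.toSpanSingleton k _ (oneT k (Two V W)) :)
    | _ :: _ => 0
  | p :: s => ofWords fun l => match l with
    | [] => 0
    | b :: l => liftW ((mulT ∘ₗ lengthProj k V W p ∘ₗ ofFactor k V W b).compl₂
        (unblock k V W s ∘ₗ ofW l))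

theorem unblock_nil_one : unblock k V W [] (oneT k (Factor k V W)) = oneT k (Two V W) := by
  rw [unblock]
  exact (ofWords_ofW _ [] (nilW k (Factor k V W))).trans (one_smul k _)

theorem unblock_cons_one (p : ℕ) (s : List ℕ) :
    unblock k V W (p :: s) (oneT k (Factor k V W)) = 0 := by
  rw [unblock]
  exact ofWords_ofW _ [] (nilW k (Factor k V W))

theorem unblock_nil_cons (b : Bool) (v : Factor k V W b) (Z : Tens k (Factor k V W)) :
    unblock k V W [] (consT b v Z) = 0 := by
  refine LinearMap.congr_fun (f := unblock k V W [] ∘ₗ consT b v) (g := 0)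
    (tens_ext_ofW fun l x => ?_) Z
  rw [LinearMap.comp_apply, consT_ofW, unblock]
  exact ofWords_ofW _ (b :: l) _

theorem unblock_cons_cons (p : ℕ) (s : List ℕ) (b : Bool) (v : Factor k V W b)
    (Z : Tens k (Factor k V W)) : unblock k V W (p :: s) (consT b v Z) =
      mulT (lengthProj k V W p (ofFactor k V W b v)) (unblock k V W s Z) := by
  refine LinearMap.congr_fun (f := unblock k V W (p :: s) ∘ₗ consT b v)
    (g := mulT (lengthProj k V W p (ofFactor k V W b v)) ∘ₗ unblock k V W s)
    (tens_ext_ofW fun l x => ?_) Z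
  rw [LinearMap.comp_apply, consT_ofW, unblock]
  exact (ofWords_ofW _ (b :: l) _).trans (liftW_cons _ _ _)

theorem ofFactor_toFactor : ∀ {b : Bool} {c : List Bool}, c.count true = b.toNat → c ≠ [] →
    ∀ x : WordTensor k (Two V W) c, ofFactor k V W b (toFactor k V W b (ofW c x)) = ofW c x
  | false, c, h, hc, x => by
    change gradedToTens k V W false ((augmentationIdeal k V W).subtype _) = _
    rw [toFactor_false h hc]
    exact gradedToTens_lof ⟨c, h⟩ x
  | true, c, h, _, x => by
    rw [toFactor_true h]
    exact gradedToTens_lof ⟨c, h⟩ x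

/-- Factors are concatenated only in their components of the prescribed degrees. So `unblock s`
undoes the cut into sizes `s` and kills every other cut, even of the same word. -/
theorem unblock_blocks : ∀ (C : List Column), (∀ c ∈ C, c.Valid) → (∀ c ∈ C, 0 < c.size) →
    ∀ (s : List ℕ) (x : WordTensor k (Two V W) (cellWord C)),
      unblock k V W s (blocks k V W (sizes C) (ofW (cellWord C) x)) =
        if s = sizes C then ofW (cellWord C) x else 0
  | [], _, _, s, x => by
    have : ∀ x : WordTensor k (Two V W) [], unblock k V W s (blocks k V W [] (ofW [] x)) =
        if s = [] then ofW [] x else 0 := by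
      intro x
      obtain ⟨t, rfl⟩ := wordTensor_nil x
      rw [map_smul, show ofW [] (nilW k (Two V W)) = oneT k _ from rfl, map_smul, map_smul,
        blocks_nil]
      rcases s with _ | ⟨p, s⟩
      · rw [unblock_nil_one, if_pos rfl]
      · rw [unblock_cons_one, if_neg (by simp), smul_zero]
    exact this x
  | c :: C, hv, hpos, s, x => by
    have hc := hv c List.mem_cons_self
    have hlen := Column.word_length hc
    have hne : c.word ≠ [] := by
      intro h
      rw [h] at hlen
      have := hpos c List.mem_cons_self
      simp at hlen; omega
    have key : ∀ x : WordTensor k (Two V W) (c.word ++ cellWord C),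
        unblock k V W s (blocks k V W (c.size :: sizes C) (ofW (c.word ++ cellWord C) x)) =
          if s = c.size :: sizes C then ofW (c.word ++ cellWord C) x else 0 := by
      refine fun x => ofW_append_induction (p := fun X =>
        unblock k V W s (blocks k V W (c.size :: sizes C) X) =
          if s = c.size :: sizes C then X else 0) c.word (cellWord C) (fun x z => ?_) (by simp)
        (fun x y hx hy => by rw [map_add, map_add, hx, hy]; split_ifs <;> simp) x
      have ih := fun s => unblock_blocks C (fun c hc => hv c (List.mem_cons_of_mem _ hc))
        (fun c hc => hpos c (List.mem_cons_of_mem _ hc)) s z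
      have hcount := Column.word_count c
      -- The first block lies in the one factor that fits its number of letters `W`, that is,
      -- whether the column is marked.
      rw [← hlen, blocks_ofW, Finset.sum_eq_single c.mark.isSome]
      · rcases s with _ | ⟨p, s⟩
        · rw [unblock_nil_cons, if_neg (by simp)]
        · rw [unblock_cons_cons, ofFactor_toFactor hcount hne, ih, lengthProj, ofWords_ofW]
          by_cases hp : c.word.length = p
          · by_cases hs : s = sizes C
            · rw [if_pos hp, if_pos hs, if_pos (by rw [hp, hs])]
            · rw [if_neg hs, map_zero, if_neg (show ¬ (p :: s = c.word.length :: sizes C) from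
                fun h => hs (List.cons.inj h).2)]
          · rw [if_neg hp, LinearMap.zero_apply, map_zero, LinearMap.zero_apply,
              if_neg (show ¬ (p :: s = c.word.length :: sizes C) from
                fun h => hp (List.cons.inj h).1.symm)]
      · intro b _ hb
        rw [toFactor_of_ne (fun h => hb ?_) (ofW_mem_supp c.word x), map_zero, LinearMap.zero_apply]
        rw [hcount] at h
        revert h; cases c.mark.isSome <;> cases b <;> simp
      · simp
    exact key x

/-- A block with more than one `W` lies in no factor, so a cut with such a block gives `0`. In all
other cases every block is the word of a column. -/
theorem blocks_eq_zero_or : ∀ (s : List ℕ) (l : List Bool), l.length = s.sum →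
    (∀ x : WordTensor k (Two V W) l, blocks k V W s (ofW l x) = 0) ∨
      ∃ C : List Column, (∀ c ∈ C, c.Valid) ∧ sizes C = s ∧ cellWord C = l
  | [], l, h => by
    obtain rfl := List.length_eq_zero_iff.1 h
    exact Or.inr ⟨[], by simp, rfl, rfl⟩
  | p :: s, l, h => by
    rw [List.sum_cons] at h
    obtain ⟨c, l', rfl, rfl⟩ : ∃ c l', l = c ++ l' ∧ c.length = p :=
      ⟨l.take p, l.drop p, (List.take_append_drop p l).symm, by simp; omega⟩
    rw [List.length_append] at h
    by_cases hc : c.count true ≤ 1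
    · rcases blocks_eq_zero_or s l' (by omega) with h0 | ⟨C, hC, rfl, rfl⟩
      · refine Or.inl fun x => ofW_append_induction (p := fun X => blocks k V W (c.length :: s) X = 0)
          c l' (fun x z => ?_) (by simp) (fun x y hx hy => by rw [map_add, hx, hy, add_zero]) x
        rw [blocks_ofW, h0]
        simp
      · obtain ⟨a, ha, hs, rfl⟩ := Column.exists_word hc
        refine Or.inr ⟨a :: C, ?_, ?_, cellWord_cons a C⟩
        · intro c hc
          rcases List.mem_cons.1 hc with rfl | hc
          · exact ha
          · exact hC c hc
        · rw [← hs]; rfl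
    · refine Or.inl fun x => ofW_append_induction (p := fun X => blocks k V W (c.length :: s) X = 0)
        c l' (fun x z => ?_) (by simp) (fun x y hx hy => by rw [map_add, hx, hy, add_zero]) x
      rw [blocks_ofW]
      refine Finset.sum_eq_zero fun b _ => ?_
      rw [toFactor_of_ne (b := b) (by cases b <;> simp <;> omega) (ofW_mem_supp c x), map_zero,
        LinearMap.zero_apply]

end Unblock

/-! ### The isomorphism of complexes -/

section CellIso

variable {k V W : Type u} [Field k] [AddCommGroup V] [Module k V] [AddCommGroup W] [Module k W]
  (φ : V ⊗[k] W ≃ₗ[k] W ⊗[k] V)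

/-- Forget the degree. -/
def columnToTens (k : Type u) [Field k] (Y : Bool → Type u) [∀ b, AddCommGroup (Y b)]
    [∀ b, Module k (Y b)] (m : ℕ) (q : ℤ) : ColumnComplex k Y m q →ₗ[k] Tens k Y :=
  DirectSum.toModule k (Arrangement m q) _ fun l => ofW l.1

theorem columnToTens_columnProj {Y : Bool → Type u} [∀ b, AddCommGroup (Y b)]
    [∀ b, Module k (Y b)] {q m : ℕ} {X : Tens k Y} (hX : X ∈ supp k Y q m) :
    columnToTens k Y m q (columnProj k Y m q X) = X := by
  refine supp_induction (p := fun X => columnToTens k Y m q (columnProj k Y m q X) = X) ?_ (by simp)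
    (fun x y hx hy => by rw [map_add, map_add, hx, hy]) hX
  rintro l x rfl rfl
  rw [columnProj, ofWords_ofW, columnIncl, dif_pos ⟨rfl, rfl⟩]
  exact DirectSum.toModule_lof ..

theorem IsCell.length_sizes {n m : ℕ} {q : ℤ} {C : List Column}
    (h : IsCell n m (q + n - m) C) : q = (sizes C).length := by
  have := h.2.2.1
  rw [List.length_map]; omega

/-- The coefficient of a cell. -/
def cellCoeff (k V W : Type u) [Field k] [AddCommGroup V] [Module k V] [AddCommGroup W]
    [Module k W] (m : ℕ) (q : ℤ) (C : List Column) :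
    ColumnComplex k (Factor k V W) m q →ₗ[k] WordTensor k (Two V W) (cellWord C) :=
  DirectSum.component k (List Bool) (fun l => WordTensor k (Two V W) l) (cellWord C) ∘ₗ
    unblock k V W (sizes C) ∘ₗ columnToTens k (Factor k V W) m q

/-- A different cell differs in its sizes, and is then removed by `unblock`, or in its word, and is
then removed by the projection to one summand. Since `arrange` is injective on the word of a cell,
this gives injectivity of `cellMap`. -/
theorem cellCoeff_cellMap {n m : ℕ} {q : ℤ} (C : Cell n m (q + n - m))
    (x : CellComplex n m (BaseTensor k V W n m) (q + n - m)) :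
    cellCoeff k V W m q C.1 (cellMap φ n m q x) =
      arrange (Y := Two V W) φ.toLinearMap (cellWord C.1) n m (x C) := by
  induction x using Finsupp.induction_linear with
  | zero => simp
  | add x y hx hy => simp only [map_add, hx, hy, Finsupp.add_apply]
  | single C' x =>
    have hq := C'.2.length_sizes
    have h1 : columnToTens k (Factor k V W) m q (cellMap φ n m q (Finsupp.single C' x)) =
        blocks k V W (sizes C'.1)
          (arrangeT (Y := Two V W) φ.toLinearMap n m (cellWord C'.1) x) := by
      rw [cellMap_single]
      have := columnToTens_columnProj (blocks_mem_supp _ (arrangeT_mem_supp φ C'.2 x))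
      rwa [← hq] at this
    rw [cellCoeff, LinearMap.comp_apply, LinearMap.comp_apply, h1, arrangeT, LinearMap.comp_apply,
      unblock_blocks C'.1 C'.2.2.2.2.2 C'.2.1]
    by_cases hC : C' = C
    · subst hC
      rw [if_pos rfl, Finsupp.single_eq_same]
      exact DirectSum.component.lof_self ..
    · rw [Finsupp.single_eq_of_ne (Ne.symm hC), map_zero]
      by_cases hs : sizes C.1 = sizes C'.1
      · rw [if_pos hs]
        have hw : cellWord C'.1 ≠ cellWord C.1 := fun h =>
          hC (Subtype.ext (eq_of_cellWord C'.2.2.2.2.2 C.2.2.2.2.2 hs.symm h))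
        exact (DirectSum.component.of ..).trans (dif_neg hw)
      · rw [if_neg hs, map_zero]

theorem cellMap_injective (n m : ℕ) (q : ℤ) : Function.Injective (cellMap φ n m q) := by
  rw [injective_iff_map_eq_zero]
  intro x hx
  ext1 C
  have h := cellCoeff_cellMap φ C x
  rw [hx, map_zero] at h
  have hc := C.2.word_counts
  refine (arrange_bijective (Y := Two V W) φ (cellWord C.1) n m hc.1 hc.2.2).1 ?_
  rw [← h]; simp

/-- For the inclusion that is not immediate, `columnPart_le_span` reduces to one cut word. Either
the cut gives `0`, or the cut word is that of a cell, and its tensor is in the image of the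
surjective map `arrange`. -/
theorem range_cellMap (n m : ℕ) (q : ℤ) :
    LinearMap.range (cellMap φ n m q) = columnPart (factorPart k V W) m q (n + m) := by
  apply le_antisymm
  · rintro _ ⟨x, rfl⟩
    induction x using Finsupp.induction_linear with
    | zero => simp
    | add x y hx hy => rw [map_add]; exact Submodule.add_mem _ hx hy
    | single C x =>
      rw [cellMap_single]
      have := columnProj_blocks_mem (sizes C.1) m (arrangeT_mem_supp φ C.2 x)
      rwa [← C.2.length_sizes, show (sizes C.1).sum = n + m from C.2.2.1] at this
  · refine (columnPart_le_span m (n + m) q).trans (Submodule.span_le.2 ?_)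
    rintro _ ⟨s, X, hs, hq, hsum, hX, rfl⟩
    refine supp_induction (p := fun X => columnProj k (Factor k V W) m q (blocks k V W s X) ∈
      LinearMap.range (cellMap φ n m q)) ?_ (by simp)
      (fun x y hx hy => by rw [map_add, map_add]; exact Submodule.add_mem _ hx hy) hX
    intro l x hl hm
    rcases blocks_eq_zero_or (k := k) (V := V) (W := W) s l (by rw [hl, hsum]) with
      h0 | ⟨C, hC, rfl, rfl⟩
    · rw [h0, map_zero]
      exact Submodule.zero_mem _
    · have hcell : IsCell n m (q + n - m) C := by
        refine ⟨fun c hc => hs _ (List.mem_map_of_mem hc), hsum, ?_, ?_, hC⟩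
        · rw [List.length_map] at hq; omega
        · rw [← cellWord_count, hm]
      have hc := hcell.word_counts
      obtain ⟨y, rfl⟩ := (arrange_bijective (Y := Two V W) φ (cellWord C) n m hc.1 hc.2.2).2 x
      exact ⟨Finsupp.single ⟨C, hcell⟩ y, cellMap_single φ n m q ⟨C, hcell⟩ y⟩

/-- `D(n,m)_* ⊗ (V^{⊗ n} ⊗ W^{⊗ m})` and `F_{*,n+m}` are isomorphic in each degree. -/
def cellEquiv (n m : ℕ) (q : ℤ) :
    CellComplex n m (BaseTensor k V W n m) (q + n - m) ≃ₗ[k] ShuffleComplex k V W m (n + m) q :=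
  (LinearEquiv.ofInjective (cellMap φ n m q) (cellMap_injective φ n m q)).trans
    (LinearEquiv.ofEq _ _ (range_cellMap φ n m q))

variable {φ} {B : MixedBraided k V W}

theorem MixedBraided.cellEquiv_cellD (hφ : B.IsSeparatedBraiding φ) (hB : B.Compatible φ)
    {n m : ℕ} {q t : ℤ} (ht : t = q - 1)
    (x : CellComplex n m (BaseTensor k V W n m) (q + n - m)) :
    cellEquiv φ n m t (cellD (B.rep n m) (q + n - m) (t + n - m) x) =
      B.signTwist.shuffleD (negEquiv φ) m (n + m) q t (cellEquiv φ n m q x) :=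
  Subtype.ext (B.cellMap_cellD hφ hB ht x)

/-- Transport from `F_*`: the degreewise isomorphisms commute with the differentials, and every
degree `r` is of the form `q + n - m`. -/
theorem MixedBraided.cellD_cellD (hφ : B.IsSeparatedBraiding φ) (hB : B.Compatible φ) (n m : ℕ)
    (r : ℤ) : cellD (B.rep n m) (r - 1) (r - 2) ∘ₗ cellD (B.rep n m) r (r - 1) = 0 := by
  obtain ⟨q, rfl⟩ : ∃ q : ℤ, r = q + n - m := ⟨r - n + m, by omega⟩
  rw [show q + n - m - 1 = (q - 1) + n - m by omega, show q + n - m - 2 = (q - 2) + n - m by omega]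
  refine LinearMap.ext fun x => (cellEquiv φ n m (q - 2)).injective ?_
  rw [LinearMap.comp_apply, B.cellEquiv_cellD hφ hB (by omega), B.cellEquiv_cellD hφ hB rfl,
    LinearMap.zero_apply, map_zero]
  exact LinearMap.congr_fun (B.signTwist.shuffleD_shuffleD (φ := negEquiv φ)
    (B.signedCross_isBraidSeq hφ) m (n + m) q (q - 2)) (cellEquiv φ n m q x)

end CellIso

end
end QuantumShuffle

theorem proposition4 {k V W : Type u} [Field k] [AddCommGroup V] [Module k V]
    [FiniteDimensional k V] [AddCommGroup W] [Module k W] [FiniteDimensional k W]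
    (B : QuantumShuffle.MixedBraided k V W) (φ : V ⊗[k] W ≃ₗ[k] W ⊗[k] V)
    (hφ : B.IsSeparatedBraiding φ) (hB : B.Compatible φ) (n m : ℕ) (hm : 1 ≤ m) :
    -- both sides are chain complexes
    (∀ q : ℤ, B.signTwist.shuffleD (QuantumShuffle.negEquiv φ) m (n + m) (q - 1) (q - 2) ∘ₗ
      B.signTwist.shuffleD (QuantumShuffle.negEquiv φ) m (n + m) q (q - 1) = 0) ∧
    (∀ r : ℤ, QuantumShuffle.cellD (B.rep n m) (r - 1) (r - 2) ∘ₗ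
      QuantumShuffle.cellD (B.rep n m) r (r - 1) = 0) ∧
    -- and they are isomorphic
    ∃ e : ∀ q : ℤ, QuantumShuffle.ShuffleComplex k V W m (n + m) q ≃ₗ[k]
        QuantumShuffle.CellComplex n m (QuantumShuffle.BaseTensor k V W n m) (q + n - m),
      ∀ (q : ℤ) (x : QuantumShuffle.ShuffleComplex k V W m (n + m) q),
        e (q - 1) (B.signTwist.shuffleD (QuantumShuffle.negEquiv φ) m (n + m) q (q - 1) x) =
          QuantumShuffle.cellD (B.rep n m) (q + n - m) (q - 1 + n - m) (e q x) := by
  refine ⟨fun q => B.signTwist.shuffleD_shuffleD (B.signedCross_isBraidSeq hφ) m (n + m) q (q - 2),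
    fun r => B.cellD_cellD hφ hB n m r, fun q => (QuantumShuffle.cellEquiv φ n m q).symm,
    fun q x => ?_⟩
  rw [LinearEquiv.symm_apply_eq, B.cellEquiv_cellD hφ hB rfl, LinearEquiv.apply_symm_apply]
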